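/- \textbf{Setting.} A server is located at a point $s$ of a finite metric space $X$ with $n$ points; moving it is instantaneous and costs the distance travelled. An input is a finite sequence of $k$ requests; a request $q$ is released at a time $r_q$ on a point of $X$, and is served at the first time from $r_q$ on at which the server is at that point. In \emph{online service with delay}, each request $q$ has a nondecreasing continuous delay function $y_q:[r_q,\infty)\to\mathbb{R}$ with $y_q(r_q)=0$ and $y_q(t)\to\infty$ as $t\to\infty$; every request must be served, and the cost of a solution is the total movement of the server plus the sum of $y_q(t_q)$ over all requests $q$, where $t_q$ is the time at which $q$ is served. In \emph{online service with deadlines}, each request $q$ has a deadline $d_q\ge r_q$ and must be served in $[r_q,d_q]$; the cost is the total movement of the server. A deterministic online algorithm learns of a request, including its whole delay function or its deadline, at the release time of the request; its movements up to time $t$ depend only on the requests released by time $t$. In particular, $k$ is not known in advance. \textbf{Theorem.} There is an absolute constant $C>0$ such that for every finite metric space $X$ with $n$ points and every initial location $s\in X$ of the server, there is a deterministic online algorithm for online service with delay which, on every input with $k$ requests, produces a solution of cost at most $$C\,\bigl(1+\log\min\{n,k\}\bigr)\cdot \mathrm{OPT},$$ where $\mathrm{OPT}$ is the infimum of the costs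 of all (offline) solutions of this input starting at $s$, and $\log 0$ is read as $0$. The same holds for online service with deadlines. That is, both problems admit $O(\log\min\{n,k\})$-competitive deterministic online algorithms. -/

import Mathlib

open Filter Set

namespace OnlineService

/-- A request: the point of the metric space on which it is released, and its release time. -/
structure Request (X : Type*) where
  location : X
  release : ℝ

/-- A request of online service with delay. `delay t` is the total delay cost which the request
has accrued by time `t` if it is still pending; only its values on `[release, ∞)` matter. -/
structure DelayRequest (X : Type*) extends Request X where
  delay : ℝ → ℝ
  delay_release : delay release = 0
  delay_mono : MonotoneOn delay (Ici release)
  delay_continuous : ContinuousOn delay (Ici release)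
  delay_tendsto : Tendsto delay atTop atTop

/-- A request of online service with deadlines: it must be served during
`[release, deadline]`. -/
structure DeadlineRequest (X : Type*) extends Request X where
  deadline : ℝ
  release_le_deadline : release ≤ deadline

/-- An input: finitely many requests (of type `Q`, released at the times given by `rel`),
listed in order of arrival. -/
structure Input (Q : Type*) (rel : Q → ℝ) where
  requests : List Q
  sorted : requests.Pairwise (fun q q' => rel q ≤ rel q')

/-- The number of requests of an input. -/
def Input.numRequests {Q : Type*} {rel : Q → ℝ} (I : Input Q rel) : ℕ := I.requests.length

/-- What has been revealed of the input by time `t`: the requests released by then, each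
together with its deadline or its delay function. -/
noncomputable def Input.upTo {Q : Type*} {rel : Q → ℝ} (I : Input Q rel) (t : ℝ) : List Q :=
  I.requests.filter (fun q => decide (rel q ≤ t))

/-- A schedule of the server: a finite chronological list of movements `(t, p)`, meaning that
at time `t` the server moves, instantaneously, from wherever it is to the point `p`. Several
movements may take place at the same time, one after the other. -/
structure Schedule (X : Type*) where
  moves : List (ℝ × X)
  chronological : moves.Pairwise (fun m m' => m.1 ≤ m'.1)

namespace Schedule

variable {X : Type*}

/-- The movements which are performed by time `t`. -/
noncomputable def upTo (σ : Schedule X) (t : ℝ) : List (ℝ × X) :=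
  σ.moves.filter (fun m => decide (m.1 ≤ t))

/-- The location of the server just before its movements at time `t`, when it started
at `s`. -/
noncomputable def positionBefore (s : X) (σ : Schedule X) (t : ℝ) : X :=
  ((σ.moves.filter (fun m => decide (m.1 < t))).map Prod.snd).getLastD s

/-- At time `t` the server is, at least momentarily, at the point `p`: it is there before its
movements at time `t`, or one of these movements ends there. -/
def VisitsAt (s : X) (σ : Schedule X) (p : X) (t : ℝ) : Prop :=
  σ.positionBefore s t = p ∨ (t, p) ∈ σ.moves

/-- The times at which the server is at the location of the (already released) request. -/
def visitTimes (s : X) (σ : Schedule X) (q : Request X) : Set ℝ :=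
  {t | q.release ≤ t ∧ σ.VisitsAt s q.location t}

/-- The time at which a request is served: the first time, from its release on, at which the
server is at its location. (The infimum is attained, see `serviceTime_mem`.) -/
noncomputable def serviceTime (s : X) (σ : Schedule X) (q : Request X) : ℝ :=
  sInf (σ.visitTimes s q)

/-- Total distance travelled along a list of movements that starts at `s`. -/
noncomputable def travel [MetricSpace X] : X → List (ℝ × X) → ℝ
  | _, [] => 0
  | s, m :: l => dist s m.2 + travel m.2 l

/-- The movement cost of a schedule that starts at `s`. -/
noncomputable def movementCost [MetricSpace X] (s : X) (σ : Schedule X) : ℝ :=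
  travel s σ.moves

theorem serviceTime_mem (s : X) (σ : Schedule X) (q : Request X)
    (h : (σ.visitTimes s q).Nonempty) : σ.serviceTime s q ∈ σ.visitTimes s q := by
  have hbdd : BddBelow (σ.visitTimes s q) := ⟨q.release, fun t ht => ht.1⟩
  have hrel : q.release ≤ σ.serviceTime s q := le_csInf h fun t ht => ht.1
  set a := σ.serviceTime s q with ha
  obtain ⟨b, hab, hb⟩ : ∃ b, a < b ∧ ∀ m ∈ σ.moves, a < m.1 → b ≤ m.1 := by
    generalize σ.moves = l
    induction l with
    | nil => exact ⟨a + 1, by linarith, by simp⟩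
    | cons m l ih =>
      obtain ⟨b, hab, hb⟩ := ih
      by_cases hm : a < m.1
      · refine ⟨min b m.1, lt_min hab hm, fun m' hm' h' => ?_⟩
        rcases List.mem_cons.1 hm' with rfl | h1
        · exact min_le_right _ _
        · exact (min_le_left _ _).trans (hb m' h1 h')
      · refine ⟨b, hab, fun m' hm' h' => ?_⟩
        rcases List.mem_cons.1 hm' with rfl | h1
        · exact absurd h' hm
        · exact hb m' h1 h'
  obtain ⟨t, ht, htb⟩ := exists_lt_of_csInf_lt h hab
  have hat : a ≤ t := csInf_le hbdd ht
  rcases hat.eq_or_lt with hat | hat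
  · rw [hat]; exact ht
  refine ⟨hrel, ?_⟩
  have hpos : σ.positionBefore s t = q.location := by
    rcases ht.2 with h1 | h1
    · exact h1
    · exact absurd (hb _ h1 hat) (not_le.2 htb)
  have hfil : σ.moves.filter (fun m => decide (m.1 < t)) = σ.upTo a := by
    refine List.filter_congr fun m hm => decide_eq_decide.2 ⟨fun h1 => ?_, fun h1 => ?_⟩
    · by_contra h2
      exact absurd (hb m hm (not_le.1 h2)) (not_le.2 (h1.trans htb))
    · exact h1.trans_lt hat
  unfold positionBefore at hpos
  rw [hfil] at hpos
  by_cases hex : ∃ m ∈ σ.moves, m.1 = a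
  · right
    obtain ⟨m, hm, hma⟩ := hex
    have hmem : m ∈ σ.upTo a := List.mem_filter.2 ⟨hm, by simp [hma]⟩
    have hne : σ.upTo a ≠ [] := List.ne_nil_of_mem hmem
    have hsub : (σ.upTo a).Pairwise (fun m m' => m.1 ≤ m'.1) :=
      σ.chronological.sublist List.filter_sublist
    obtain ⟨l, x, hx⟩ := (List.eq_nil_or_concat (σ.upTo a)).resolve_left hne
    have hx_mem : x ∈ σ.upTo a := by rw [hx]; simp
    have hx_le : x.1 ≤ a := by simpa using (List.mem_filter.1 hx_mem).2
    have hmx : m.1 ≤ x.1 := by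
      rw [hx] at hmem hsub
      simp only [List.concat_eq_append, List.pairwise_append, List.mem_append,
        List.mem_singleton] at hmem hsub
      rcases hmem with h1 | rfl
      · exact hsub.2.2 m h1 x rfl
      · exact le_rfl
    have hxa : x.1 = a := le_antisymm hx_le (hma ▸ hmx)
    rw [hx] at hpos
    have hxq : x.2 = q.location := by simpa using hpos
    have : (a, q.location) = x := Prod.ext hxa.symm hxq.symm
    rw [this]
    exact (List.mem_filter.1 hx_mem).1
  · left
    rw [← hpos]
    unfold positionBefore upTo
    congr 2
    refine List.filter_congr fun m hm => decide_eq_decide.2 ⟨le_of_lt, fun h1 => ?_⟩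
    exact lt_of_le_of_ne h1 fun h2 => hex ⟨m, hm, h2⟩

end Schedule

/-- A deterministic online algorithm: it maps every input to a schedule of the server, and the
movements which it performs by time `t` depend only on what has been revealed of the input
by time `t`. -/
structure OnlineAlgorithm (X Q : Type*) (rel : Q → ℝ) where
  run : Input Q rel → Schedule X
  causal : ∀ (I J : Input Q rel) (t : ℝ), I.upTo t = J.upTo t →
    (run I).upTo t = (run J).upTo t

/-- Inputs of online service with delay on `X`. -/
abbrev DelayInput (X : Type*) := Input (DelayRequest X) (fun q => q.release)

/-- Inputs of online service with deadlines on `X`. -/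
abbrev DeadlineInput (X : Type*) := Input (DeadlineRequest X) (fun q => q.release)

/-- Deterministic online algorithms for online service with delay on `X`. -/
abbrev DelayAlgorithm (X : Type*) := OnlineAlgorithm X (DelayRequest X) (fun q => q.release)

/-- Deterministic online algorithms for online service with deadlines on `X`. -/
abbrev DeadlineAlgorithm (X : Type*) :=
  OnlineAlgorithm X (DeadlineRequest X) (fun q => q.release)

variable {X : Type*}

/-- A schedule is a solution of an input with delay if it eventually serves every request. -/
def DelayInput.IsSolution (s : X) (I : DelayInput X) (σ : Schedule X) : Prop :=
  ∀ q ∈ I.requests, (σ.visitTimes s q.toRequest).Nonempty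

/-- The cost of a solution with delay: the movement cost plus, for every request, its delay
cost at the time when it is served. -/
noncomputable def DelayInput.cost [MetricSpace X] (s : X) (I : DelayInput X)
    (σ : Schedule X) : ℝ :=
  σ.movementCost s + (I.requests.map (fun q => q.delay (σ.serviceTime s q.toRequest))).sum

/-- A schedule is a solution of an input with deadlines if it serves every request between its
release and its deadline. -/
def DeadlineInput.IsSolution (s : X) (I : DeadlineInput X) (σ : Schedule X) : Prop :=
  ∀ q ∈ I.requests, ∃ t ∈ σ.visitTimes s q.toRequest, t ≤ q.deadline

/-- `A`, with the server starting at `s`, is `ρ`-competitive for online service with delay,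
where the ratio `ρ` may depend on the input: it always produces a solution, whose cost is at
most `ρ` times the cost of any (offline) solution, that is, `ρ` times the optimum. -/
def DelayAlgorithm.IsCompetitive [MetricSpace X] (A : DelayAlgorithm X) (s : X)
    (ρ : DelayInput X → ℝ) : Prop :=
  ∀ I : DelayInput X, DelayInput.IsSolution s I (A.run I) ∧
    ∀ σ : Schedule X, DelayInput.IsSolution s I σ →
      DelayInput.cost s I (A.run I) ≤ ρ I * DelayInput.cost s I σ

/-- `A`, with the server starting at `s`, is `ρ`-competitive for online service with deadlines,
where the cost of a solution is its movement cost. -/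
def DeadlineAlgorithm.IsCompetitive [MetricSpace X] (A : DeadlineAlgorithm X) (s : X)
    (ρ : DeadlineInput X → ℝ) : Prop :=
  ∀ I : DeadlineInput X, DeadlineInput.IsSolution s I (A.run I) ∧
    ∀ σ : Schedule X, DeadlineInput.IsSolution s I σ →
      (A.run I).movementCost s ≤ ρ I * σ.movementCost s

end OnlineService

/-!
In a common generalization of both problems the accrued cost of a request may jump; a deadline is
a jump to more than the algorithm ever pays for one request. The algorithm performs services of
levels `ℓ`, each triggered when the unpaid delay of the pending requests up to level `ℓ` reaches
`2 ^ ℓ`. The cost of the algorithm is `O(∑ 2 ^ ℓ)`, so it suffices to bound this sum in terms of the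
cost of an offline schedule `σ`.

At scale `2 ^ ℓ`, steps shorter than `2 ^ ℓ / (128 * N)` are ignored and longer steps are truncated,
where `N ≤ min n k + 1` is the number of points which `σ` has to visit. A step of `σ` is then
charged at full length at only `O(log N)` scales. If `σ` moves little at this scale around a service
of level `ℓ`, then its server stays in a set with a short tour, and there are three cases. If `σ`
serves many requests of the service later than the algorithm does, its delay cost pays for the
service. If the requests have been left behind by a service of level `ℓ - 1`, the tour through this
set was an option there; it was over the budget, so `σ` has paid for the delay since then.
Otherwise the requests were far from the earlier location of the server and near that of `σ`; the
server relocates there, and its distance to the server of `σ` drops by a constant fraction of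
`2 ^ ℓ`. Such drops are paid for by the movements of `σ` and of the server in the other services.
-/

namespace OnlineService

/-! ### Walks and tours -/

section Walks

variable {X : Type*} [PseudoMetricSpace X]

/-- The weight `∑ g (length of the step)` of the walk that starts at a point and goes through the
points of a list. -/
noncomputable def stepSum (g : ℝ → ℝ) : X → List X → ℝ
  | _, [] => 0
  | s, x :: l => g (dist s x) + stepSum g x l

/-- The length of the walk that starts at a point and goes through the points of a list. -/
noncomputable abbrev pathLength : X → List X → ℝ := stepSum fun d => d

/-- The length of the closed walk from `a` through the points of a list and back to `a`. -/
noncomputable def tour (a : X) (l : List X) : ℝ := pathLength a (l ++ [a])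

theorem stepSum_append (g : ℝ → ℝ) (s : X) (l l' : List X) :
    stepSum g s (l ++ l') = stepSum g s l + stepSum g (l.getLastD s) l' := by
  induction l generalizing s with
  | nil => simp [stepSum]
  | cons x l ih => rw [List.cons_append, stepSum, stepSum, ih x, List.getLastD_cons, add_assoc]

theorem stepSum_nonneg {g : ℝ → ℝ} (hg : ∀ d, 0 ≤ d → 0 ≤ g d) (x : X) (w : List X) :
    0 ≤ stepSum g x w := by
  induction w generalizing x with
  | nil => exact le_rfl
  | cons y w ih => exact add_nonneg (hg _ dist_nonneg) (ih y)

theorem stepSum_min_eq_of_lt {g : ℝ → ℝ} (hg : ∀ d, 0 ≤ d → 0 ≤ g d) {b : ℝ} (hb : 0 ≤ b)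
    {x : X} {w : List X} (h : stepSum (fun d => min (g d) b) x w < b) :
    stepSum (fun d => min (g d) b) x w = stepSum g x w := by
  have hmin : ∀ d, 0 ≤ d → 0 ≤ min (g d) b := fun d hd => le_min (hg d hd) hb
  induction w generalizing x with
  | nil => rfl
  | cons y w ih =>
    rw [stepSum] at h
    have hstep := hmin _ (dist_nonneg (x := x) (y := y))
    have htail := stepSum_nonneg hmin y w
    have hlt : min (g (dist x y)) b < b := by linarith
    rw [stepSum, stepSum, ih (by linarith),
      min_eq_left ((min_lt_iff.1 hlt).resolve_right (lt_irrefl b)).le]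

theorem pathLength_nonneg (s : X) (l : List X) : 0 ≤ pathLength s l :=
  stepSum_nonneg (fun _ => id) s l

theorem pathLength_le_length_mul {D : ℝ} (hD : ∀ x y : X, dist x y ≤ D) (s : X) (l : List X) :
    pathLength s l ≤ l.length * D := by
  induction l generalizing s with
  | nil => simp [stepSum]
  | cons x l ih =>
    simp only [stepSum, List.length_cons]
    push_cast
    linarith [ih x, hD s x]

theorem dist_le_pathLength_concat (s e : X) (l : List X) : dist s e ≤ pathLength s (l ++ [e]) := by
  induction l generalizing s with
  | nil => simp [stepSum]
  | cons y l ih => exact (dist_triangle s y e).trans (add_le_add_right (ih y) _)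

theorem dist_add_dist_le_pathLength_concat {x : X} (s e : X) {l : List X} (h : x ∈ l) :
    dist s x + dist x e ≤ pathLength s (l ++ [e]) := by
  induction l generalizing s with
  | nil => simp at h
  | cons y l ih =>
    simp only [List.cons_append, stepSum]
    rcases List.mem_cons.1 h with rfl | h
    · linarith [dist_le_pathLength_concat x e l]
    · linarith [ih y h, dist_triangle s y x]

theorem pathLength_insert_le (s x y : X) (l₁ l₂ : List X) :
    pathLength s (l₁ ++ x :: y :: l₂) ≤ pathLength s (l₁ ++ x :: l₂) + 2 * dist x y := by
  simp only [stepSum_append, stepSum]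
  cases l₂ with
  | nil => simp only [stepSum]; linarith [dist_nonneg (x := x) (y := y)]
  | cons z l => simp only [stepSum]; linarith [dist_triangle_left y z x]

theorem tour_nonneg (a : X) (l : List X) : 0 ≤ tour a l := pathLength_nonneg _ _

theorem tour_nil (a : X) : tour a [] = 0 := by simp [tour, stepSum]

theorem tour_singleton_self (a : X) : tour a [a] = 0 := by simp [tour, stepSum]

theorem tour_le_length_mul {D : ℝ} (hD : ∀ x y : X, dist x y ≤ D) (a : X) (l : List X) :
    tour a l ≤ (l.length + 1) * D := by
  simpa [tour] using pathLength_le_length_mul hD a (l ++ [a])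

theorem two_mul_dist_le_tour {x a : X} {l : List X} (h : x ∈ l) : 2 * dist a x ≤ tour a l := by
  have hx := dist_add_dist_le_pathLength_concat a a h
  rw [dist_comm x a] at hx
  rw [tour]; linarith

theorem dist_le_tour {x y a : X} {l : List X} (hx : x ∈ l) (hy : y ∈ l) :
    dist x y ≤ tour a l := by
  linarith [two_mul_dist_le_tour (a := a) hx, two_mul_dist_le_tour (a := a) hy,
    dist_triangle_left x y a]

theorem tour_le_tour_add (a c : X) (l : List X) : tour a l ≤ tour c l + 2 * dist a c := by
  cases l with
  | nil => rw [tour_nil, tour_nil]; positivity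
  | cons x l =>
    simp only [tour, List.cons_append, stepSum, stepSum_append]
    linarith [dist_triangle a c x, dist_triangle_right (l.getLastD x) a c]

/-- The length charged for a step of length `d` when steps shorter than `θ` are free. -/
noncomputable def longStep (θ d : ℝ) : ℝ := if d < θ then 0 else d

theorem longStep_nonneg (θ : ℝ) {d : ℝ} (hd : 0 ≤ d) : 0 ≤ longStep θ d := by
  unfold longStep; split_ifs <;> simp [hd]

theorem longStep_le {θ d : ℝ} (hd : 0 ≤ d) : longStep θ d ≤ d := by
  unfold longStep; split_ifs <;> simp [hd]

theorem le_longStep_add {θ : ℝ} (hθ : 0 ≤ θ) (d : ℝ) : d ≤ longStep θ d + θ := by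
  unfold longStep; split_ifs <;> linarith

theorem exists_tour_insert {θ : ℝ} (hθ : 0 ≤ θ) (c y : X) {x : X} {l : List X} (hl : l.Nodup)
    (hx : x ∈ l) : ∃ l' : List X, l'.Nodup ∧ (∀ z, z ∈ l' ↔ z = y ∨ z ∈ l) ∧
      tour c l' + 2 * θ * l.length ≤
        tour c l + 2 * longStep θ (dist x y) + 2 * θ * l'.length := by
  by_cases hy : y ∈ l
  · refine ⟨l, hl, fun z => ⟨Or.inr, ?_⟩, ?_⟩
    · rintro (rfl | hz) <;> assumption
    · linarith [longStep_nonneg θ (dist_nonneg (x := x) (y := y))]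
  · obtain ⟨l₁, l₂, rfl⟩ := List.append_of_mem hx
    have hperm : (l₁ ++ x :: y :: l₂).Perm (y :: (l₁ ++ x :: l₂)) := by
      simpa using List.perm_middle (a := y) (l₁ := l₁ ++ [x]) (l₂ := l₂)
    have hlen : ((l₁ ++ x :: y :: l₂).length : ℝ) = (l₁ ++ x :: l₂).length + 1 := by
      rw [hperm.length_eq, List.length_cons, Nat.cast_add_one]
    have htour : tour c (l₁ ++ x :: y :: l₂) ≤ tour c (l₁ ++ x :: l₂) + 2 * dist x y := by
      simpa [tour] using pathLength_insert_le c x y l₁ (l₂ ++ [c])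
    refine ⟨l₁ ++ x :: y :: l₂, hperm.nodup_iff.2 (List.nodup_cons.2 ⟨hy, hl⟩),
      fun z => hperm.mem_iff.trans List.mem_cons, ?_⟩
    rw [hlen]
    linarith [le_longStep_add hθ (dist x y)]

/-- Inserting each new point of the walk `w` into the tour right after its predecessor costs twice
the step, so short steps cost at most `2 * θ` for every point of the tour. -/
theorem exists_tour_insert_walk {θ : ℝ} (hθ : 0 ≤ θ) (c : X) (w : List X) {x : X} {l : List X}
    (hl : l.Nodup) (hx : x ∈ l) : ∃ l' : List X, l'.Nodup ∧ (∀ z, z ∈ l' ↔ z ∈ w ∨ z ∈ l) ∧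
      tour c l' + 2 * θ * l.length ≤
        tour c l + 2 * stepSum (longStep θ) x w + 2 * θ * l'.length := by
  induction w generalizing x l with
  | nil => exact ⟨l, hl, by simp, by simp [stepSum]⟩
  | cons y w ih =>
    obtain ⟨l₁, hl₁, hmem₁, hlen₁⟩ := exists_tour_insert hθ c y hl hx
    obtain ⟨l₂, hl₂, hmem₂, hlen₂⟩ := ih hl₁ ((hmem₁ y).2 (Or.inl rfl))
    refine ⟨l₂, hl₂, fun z => ?_, ?_⟩
    · rw [hmem₂, hmem₁, List.mem_cons, or_left_comm, or_assoc]
    · rw [stepSum]; linarith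

/-- The part of a step of length `d` that matters at scale `2 ^ ℓ` if there are `N` points: with a
total below `2 ^ ℓ`, no step was capped, and all the free steps of a tour of `N` points together
are short. -/
noncomputable def trunc (N : ℕ) (ℓ : ℤ) (d : ℝ) : ℝ :=
  min (longStep (2 ^ ℓ / (128 * N)) d) (2 ^ ℓ)

theorem trunc_nonneg (N : ℕ) (ℓ : ℤ) {d : ℝ} (hd : 0 ≤ d) : 0 ≤ trunc N ℓ d :=
  le_min (longStep_nonneg _ hd) (by positivity)

theorem exists_short_tour (ℓ : ℤ) {x : X} {w : List X} {Y : Finset X} (hx : x ∈ Y)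
    (hw : ∀ z ∈ w, z ∈ Y) (h : stepSum (trunc Y.card ℓ) x w < 2 ^ ℓ / 128) :
    ∃ l : List X, l.Nodup ∧ (∀ z ∈ x :: w, z ∈ l) ∧ tour x l ≤ 2 ^ ℓ / 32 := by
  have hY : (0 : ℝ) < Y.card := by exact_mod_cast Finset.card_pos.2 ⟨x, hx⟩
  have h2ℓ : (0 : ℝ) < 2 ^ ℓ := by positivity
  set θ : ℝ := 2 ^ ℓ / (128 * Y.card) with hθ
  have hθ0 : 0 ≤ θ := by positivity
  obtain ⟨l, hl, hmem, hlen⟩ :=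
    exists_tour_insert_walk hθ0 x w (List.nodup_singleton x) (List.mem_singleton_self x)
  have hcard : (l.length : ℝ) ≤ Y.card := by
    classical
    rw [← List.toFinset_card_of_nodup hl]
    refine Nat.cast_le.2 (Finset.card_le_card fun z hz => ?_)
    rcases (hmem z).1 (List.mem_toFinset.1 hz) with hz | hz
    · exact hw z hz
    · rwa [List.mem_singleton.1 hz]
  have hlong : stepSum (longStep θ) x w < 2 ^ ℓ / 128 := by
    rwa [← stepSum_min_eq_of_lt (fun d => longStep_nonneg θ) h2ℓ.le]
    exact h.trans (by linarith)
  have hfree : θ * l.length ≤ 2 ^ ℓ / 128 :=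
    calc θ * l.length ≤ θ * Y.card := by gcongr
      _ = 2 ^ ℓ / 128 := by rw [hθ]; field_simp
  refine ⟨l, hl, fun z hz => (hmem z).2 ?_, ?_⟩
  · rwa [or_comm, List.mem_singleton, ← List.mem_cons]
  · rw [tour_singleton_self, List.length_singleton, Nat.cast_one] at hlen
    linarith

end Walks

/-! ### Sums over scales -/

section Sums

theorem sum_two_zpow_le_two_mul {Λ : Finset ℤ} {d : ℝ} (hd : 0 ≤ d)
    (h : ∀ ℓ ∈ Λ, (2 : ℝ) ^ ℓ ≤ d) : ∑ ℓ ∈ Λ, (2 : ℝ) ^ ℓ ≤ 2 * d := by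
  induction Λ using Finset.induction_on_max generalizing d with
  | empty => simpa using hd
  | insert a Λ ha ih =>
    have hsum : ∑ ℓ ∈ Λ, (2 : ℝ) ^ ℓ ≤ 2 * 2 ^ (a - 1) := ih (by positivity) fun ℓ hℓ =>
      zpow_le_zpow_right₀ one_le_two (Int.le_sub_one_of_lt (ha ℓ hℓ))
    rw [← zpow_one_add₀ two_ne_zero, add_sub_cancel] at hsum
    rw [Finset.sum_insert fun hmem => lt_irrefl a (ha a hmem)]
    linarith [h a (Finset.mem_insert_self a Λ)]

theorem card_le_logb_add_one {Λ : Finset ℤ} {c d : ℝ} (hc : 1 ≤ c)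
    (h : ∀ ℓ ∈ Λ, d < (2 : ℝ) ^ ℓ ∧ (2 : ℝ) ^ ℓ ≤ c * d) : (Λ.card : ℝ) ≤ Real.logb 2 c + 1 := by
  rcases Λ.eq_empty_or_nonempty with rfl | hne
  · simpa using add_nonneg (Real.logb_nonneg one_lt_two hc) zero_le_one
  set a := Λ.min' hne
  set b := Λ.max' hne
  have hab : a ≤ b := Λ.min'_le b (Λ.max'_mem hne)
  have hpow : (2 : ℝ) ^ (b - a) ≤ c := by
    rw [zpow_sub₀ two_ne_zero, div_le_iff₀ (by positivity)]
    have ha := (h a (Λ.min'_mem hne)).1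
    exact (h b (Λ.max'_mem hne)).2.trans (by gcongr)
  have hlog : ((b - a : ℤ) : ℝ) ≤ Real.logb 2 c := by
    rwa [Real.le_logb_iff_rpow_le one_lt_two (by positivity), Real.rpow_intCast]
  have hcard : (Λ.card : ℤ) ≤ b - a + 1 := by
    have hsub : Λ ⊆ Finset.Icc a b := fun ℓ hℓ =>
      Finset.mem_Icc.2 ⟨Λ.min'_le ℓ hℓ, Λ.le_max' ℓ hℓ⟩
    have := Finset.card_le_card hsub
    rw [Int.card_Icc] at this
    omega
  calc (Λ.card : ℝ) ≤ ((b - a : ℤ) : ℝ) + 1 := by exact_mod_cast hcard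
    _ ≤ Real.logb 2 c + 1 := by gcongr

/-- Only the `O(log N)` scales between `d` and `128 * N * d` see the whole step; the smaller ones
form a geometric sum, and the larger ones ignore the step. -/
theorem sum_trunc_le {N : ℕ} (hN : 0 < N) (Λ : Finset ℤ) {d : ℝ} (hd : 0 ≤ d) :
    ∑ ℓ ∈ Λ, trunc N ℓ d ≤ d * (3 + Real.logb 2 (128 * N)) := by
  have hN' : (1 : ℝ) ≤ N := by exact_mod_cast hN
  have trunc_of_lt : ∀ ℓ : ℤ, 128 * N * d < 2 ^ ℓ → trunc N ℓ d = 0 := fun ℓ hℓ => by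
    rw [trunc, longStep, if_pos, min_eq_left (by positivity)]
    rw [lt_div_iff₀ (by positivity)]
    linarith
  rw [← Finset.sum_filter_add_sum_filter_not Λ (fun ℓ : ℤ => (2 : ℝ) ^ ℓ ≤ d)]
  have hsmall : ∑ ℓ ∈ Λ with (2 : ℝ) ^ ℓ ≤ d, trunc N ℓ d ≤ 2 * d :=
    (Finset.sum_le_sum fun ℓ _ => min_le_right _ _).trans
      (sum_two_zpow_le_two_mul hd fun ℓ hℓ => (Finset.mem_filter.1 hℓ).2)
  have hlarge : ∑ ℓ ∈ Λ with ¬(2 : ℝ) ^ ℓ ≤ d, trunc N ℓ d ≤ (Real.logb 2 (128 * N) + 1) * d :=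
    calc ∑ ℓ ∈ Λ with ¬(2 : ℝ) ^ ℓ ≤ d, trunc N ℓ d
        = ∑ ℓ ∈ (Λ.filter fun ℓ : ℤ => ¬(2 : ℝ) ^ ℓ ≤ d) with (2 : ℝ) ^ ℓ ≤ 128 * N * d,
            trunc N ℓ d := by
          refine (Finset.sum_filter_of_ne fun ℓ _ hne => ?_).symm
          contrapose! hne
          exact trunc_of_lt ℓ hne
      _ ≤ _ := Finset.sum_le_card_nsmul _ _ d fun ℓ _ => (min_le_left _ _).trans (longStep_le hd)
      _ ≤ (Real.logb 2 (128 * N) + 1) * d := by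
          rw [nsmul_eq_mul]
          gcongr
          refine card_le_logb_add_one (d := d) (by linarith) fun ℓ hℓ => ?_
          simp only [Finset.mem_filter, not_le] at hℓ
          exact ⟨hℓ.1.2, hℓ.2⟩
  linarith

theorem sum_length_disjoint_intervals_le {ι : Type*} [LinearOrder ι] (F : Finset ι) (a b : ι → ℝ)
    {x y : ℝ} (hxy : x ≤ y) (ha : ∀ i ∈ F, x ≤ a i) (hb : ∀ i ∈ F, b i ≤ y)
    (hab : ∀ i ∈ F, ∀ j ∈ F, i < j → b i ≤ a j) :
    ∑ i ∈ F, max 0 (b i - a i) ≤ y - x := by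
  induction F using Finset.induction_on_max generalizing y with
  | empty => simpa using hxy
  | insert m F hm ih =>
    simp only [Finset.forall_mem_insert] at ha hb hab
    rw [Finset.sum_insert fun hmem => lt_irrefl m (hm m hmem)]
    have hF : ∑ i ∈ F, max 0 (b i - a i) ≤ min y (a m) - x :=
      ih (le_min hxy ha.1) ha.2 (fun i hi => le_min (hb.2 i hi) ((hab.2 i hi).1 (hm i hi)))
        fun i hi => (hab.2 i hi).2
    rcases le_total 0 (b m - a m) with h | h
    · rw [max_eq_right h]; linarith [min_le_right y (a m), hb.1]
    · rw [max_eq_left h]; linarith [min_le_left y (a m)]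

/-- The restriction of a distance to the range between `2 ^ (ℓ - 3)` and `2 ^ (ℓ - 2)`; these
ranges are disjoint for different `ℓ`. -/
noncomputable def band (ℓ : ℤ) (x : ℝ) : ℝ := max (2 ^ (ℓ - 3)) (min x (2 ^ (ℓ - 2)))

theorem band_sub_le (ℓ : ℤ) (x y : ℝ) :
    band ℓ y - band ℓ x ≤ max 0 (min y (2 ^ (ℓ - 2)) - max x (2 ^ (ℓ - 3))) := by
  have h : (2 : ℝ) ^ (ℓ - 3) ≤ 2 ^ (ℓ - 2) := zpow_le_zpow_right₀ one_le_two (by omega)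
  simp only [band, min_def, max_def]
  split_ifs <;> linarith

theorem sum_max_band_sub_le (Λ : Finset ℤ) (x y : ℝ) :
    ∑ ℓ ∈ Λ, max 0 (band ℓ y - band ℓ x) ≤ max 0 (y - x) := by
  refine (Finset.sum_le_sum fun ℓ _ => max_le (le_max_left _ _) (band_sub_le ℓ x y)).trans ?_
  rcases le_total x y with hxy | hyx
  · refine (sum_length_disjoint_intervals_le Λ _ _ hxy (fun _ _ => le_max_left _ _)
      (fun _ _ => min_le_left _ _) fun i _ j _ hij => ?_).trans (le_max_right _ _)
    calc min y (2 ^ (i - 2)) ≤ (2 : ℝ) ^ (i - 2) := min_le_right _ _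
      _ ≤ 2 ^ (j - 3) := zpow_le_zpow_right₀ one_le_two (by omega)
      _ ≤ max x (2 ^ (j - 3)) := le_max_right _ _
  · refine (Finset.sum_nonpos fun ℓ _ => max_le le_rfl ?_).trans (le_max_left _ _)
    linarith [min_le_left y (2 ^ (ℓ - 2)), le_max_left x (2 ^ (ℓ - 3))]

end Sums

/-! ### The algorithm -/

/-- A request of the common generalization of both problems, in which the accrued cost may jump:
`lower t` is the cost of serving the request at time `t`, and `upper t` is the limit of this cost
from the right. -/
structure GeneralRequest (X : Type*) extends Request X where
  lower : ℝ → ℝ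
  upper : ℝ → ℝ
  lower_mono : Monotone lower
  upper_mono : Monotone upper
  lower_le_upper : ∀ t, lower t ≤ upper t
  upper_le_lower : ∀ s t, s < t → upper s ≤ lower t
  lower_eq_zero : ∀ t, t ≤ release → lower t = 0
  upper_eq_zero : ∀ t, t < release → upper t = 0
  lower_lsc : LowerSemicontinuous lower
  upper_usc : UpperSemicontinuous upper
  upper_unbounded : ∀ c, ∃ t, c ≤ upper t

theorem GeneralRequest.lower_nonneg {X : Type*} (q : GeneralRequest X) (t : ℝ) :
    0 ≤ q.lower t := by
  rcases le_total t q.release with h | h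
  · exact (q.lower_eq_zero t h).ge
  · exact (q.lower_eq_zero q.release le_rfl).ge.trans (q.lower_mono h)

/-- The requests `0, …, card - 1` of an input, extended to an infinite sequence by irrelevant
values, so that prefixes of different inputs can be compared without casts. -/
structure RequestSeq (X : Type*) where
  card : ℕ
  request : ℕ → GeneralRequest X

instance {X : Type*} : CoeFun (RequestSeq X) fun _ => ℕ → GeneralRequest X :=
  ⟨RequestSeq.request⟩

/-- What the algorithm remembers: the time of its last service, the location of the server, its
movements so far, the requests it has served, and for every request a radius (`0` if it has not
been considered yet) and the delay cost which has already been paid for. -/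
structure ServerState (X : Type*) where
  time : WithBot ℝ
  pos : X
  moves : List (ℝ × X)
  served : Set ℕ
  radius : ℕ → ℝ
  paid : ℕ → ℝ

/-- The state in which the server waits at `s` before the first service. -/
def ServerState.init {X : Type*} (s : X) : ServerState X := ⟨⊥, s, [], ∅, 0, 0⟩

/-- A service of a given level: the server goes around the route and returns; the delay of the
requests left behind is paid up to the horizon; finally the server moves to the target. -/
structure Service (X : Type*) where
  time : ℝ
  level : ℤ
  route : List X
  horizon : ℝ
  target : X

/-- The movements of a service for which the server sets out from `a`. -/
def Service.moves {X : Type*} (a : X) (d : Service X) : List (ℝ × X) :=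
  (d.route ++ [a, d.target]).map fun x => (d.time, x)

theorem Service.time_eq_of_mem_moves {X : Type*} {a : X} {d : Service X} {m : ℝ × X}
    (h : m ∈ d.moves a) : m.1 = d.time := by
  obtain ⟨x, -, rfl⟩ := List.mem_map.1 h
  rfl

section Definitions

variable {X : Type*} [MetricSpace X] (J : RequestSeq X) (S : ServerState X)

/-- The distance at which a pending request is rated: its level is the least `j` such that
`reach ≤ 2 ^ j`. Services raise the radius, and with it the level, of the requests they leave
behind. -/
noncomputable def ServerState.reach (i : ℕ) : ℝ :=
  max (S.radius i) (dist S.pos (J i).location)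

open Classical in
/-- The pending requests of level at most `j`. -/
noncomputable def eligible (t : ℝ) (j : ℤ) : Finset ℕ :=
  (Finset.range J.card).filter fun i =>
    (J i).release ≤ t ∧ i ∉ S.served ∧ 0 < S.reach J i ∧ S.reach J i ≤ 2 ^ j

/-- The delay cost which has not been paid for yet. -/
noncomputable def excess (t : ℝ) (i : ℕ) : ℝ := max 0 ((J i).upper t - S.paid i)

/-- The pending requests of level exactly `j`. -/
noncomputable def outer (t : ℝ) (j : ℤ) : Finset ℕ :=
  (eligible J S t j).filter fun i => 2 ^ (j - 1) < S.reach J i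

/-- For some `j`, the unpaid delay cost of the pending requests of level at most `j` has reached
`2 ^ j`. -/
def Triggered (t : ℝ) : Prop :=
  S.time ≤ t ∧ ∃ j : ℤ, 2 ^ j ≤ ∑ i ∈ eligible J S t j, excess J S t i

/-- Most of the weight of the requests of level exactly `j` is near the point `p`. -/
def IsHeavy (t : ℝ) (j : ℤ) (p : X) : Prop :=
  3 / 4 * ∑ i ∈ outer J S t j, excess J S t i ≤
    ∑ i ∈ (outer J S t j).filter (fun i => dist p (J i).location ≤ 2 ^ j / 32), excess J S t i

open Classical in
/-- The eligible requests which are not on the route. -/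
noncomputable def missed (t : ℝ) (j : ℤ) (l : List X) : Finset ℕ :=
  (eligible J S t j).filter fun i => (J i).location ∉ l

/-- The service with which the algorithm continues in the state `S`. It takes place at the first
time at which some level is triggered, and belongs to the least such level. Within a budget of
`8 * 2 ^ level` for the tour and for the future delay of the missed requests, it looks ahead as
far as possible. The server relocates if and only if most of the weight is in one place. -/
structure IsService (d : Service X) : Prop where
  least : IsLeast {t | Triggered J S t} d.time
  threshold : 2 ^ d.level ≤ ∑ i ∈ eligible J S d.time d.level, excess J S d.time i
  below : ∀ j < d.level, ∑ i ∈ eligible J S d.time j, excess J S d.time i < 2 ^ j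
  time_le_horizon : d.time ≤ d.horizon
  budget : tour S.pos d.route + ∑ i ∈ missed J S d.time d.level d.route,
    ((J i).lower d.horizon - (J i).lower d.time) ≤ 8 * 2 ^ d.level
  maximal : missed J S d.time d.level d.route = ∅ ∨
    ∀ l : List X, l.Nodup → 8 * 2 ^ d.level ≤ tour S.pos l +
      ∑ i ∈ missed J S d.time d.level l, ((J i).upper d.horizon - (J i).lower d.time)
  target_spec : IsHeavy J S d.time d.level d.target ∨
    d.target = S.pos ∧ ∀ p, ¬ IsHeavy J S d.time d.level p

open Classical in
/-- A choice of the next service, or `none` if nothing will ever be triggered. -/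
noncomputable def nextService : Option (Service X) :=
  if h : ∃ d, IsService J S d then some h.choose else none

open Classical in
/-- The state after a service. The requests of the level of the service are moved up to the next
level, and all other released requests keep their present level. -/
noncomputable def ServerState.advance (d : Service X) : ServerState X where
  time := d.time
  pos := d.target
  moves := S.moves ++ d.moves S.pos
  served := {i | i ∈ S.served ∨ (i < J.card ∧ (J i).release ≤ d.time ∧ S.reach J i = 0) ∨
    (i ∈ eligible J S d.time d.level ∧ (J i).location ∈ d.route)}
  radius i := if i ∈ eligible J S d.time d.level then 2 ^ (d.level + 1) else
    if i < J.card ∧ (J i).release ≤ d.time then S.reach J i else S.radius i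
  paid i := if i ∈ eligible J S d.time d.level then
    max (S.paid i) ((J i).lower (if (J i).location ∈ d.route then d.time else d.horizon))
    else S.paid i

/-- One round of the algorithm, which has no effect when no service is left. -/
noncomputable def step : ServerState X := (nextService J S).elim S (S.advance J)

/-- The state after the first `n` services. -/
noncomputable def stateAt (s : X) (n : ℕ) : ServerState X := (step J)^[n] (.init s)

end Definitions

section Basic

variable {X : Type*} [MetricSpace X] {J : RequestSeq X} {S : ServerState X} {d : Service X}

theorem mem_eligible {t : ℝ} {i : ℕ} {j : ℤ} : i ∈ eligible J S t j ↔
    i < J.card ∧ (J i).release ≤ t ∧ i ∉ S.served ∧ 0 < S.reach J i ∧ S.reach J i ≤ 2 ^ j := by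
  simp only [eligible, Finset.mem_filter, Finset.mem_range]

theorem mem_missed {t : ℝ} {i : ℕ} {j : ℤ} {l : List X} :
    i ∈ missed J S t j l ↔ i ∈ eligible J S t j ∧ (J i).location ∉ l := by
  simp only [missed, Finset.mem_filter]

theorem mem_outer {t : ℝ} {i : ℕ} {j : ℤ} :
    i ∈ outer J S t j ↔ i ∈ eligible J S t j ∧ 2 ^ (j - 1) < S.reach J i :=
  Finset.mem_filter

theorem isService_of_nextService (h : nextService J S = some d) : IsService J S d := by
  unfold nextService at h
  split_ifs at h with hex
  rw [← Option.some.inj h]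
  exact hex.choose_spec

theorem IsService.time_le (h : IsService J S d) : S.time ≤ d.time := h.least.1.1

theorem step_of_none (h : nextService J S = none) : step J S = S := by rw [step, h]; rfl

theorem step_of_some (h : nextService J S = some d) : step J S = S.advance J d := by
  rw [step, h]; rfl

theorem stateAt_succ (s : X) (n : ℕ) : stateAt J s (n + 1) = step J (stateAt J s n) :=
  Function.iterate_succ_apply' _ _ _

theorem stateAt_eq_of_le {s : X} {m n : ℕ} (h : nextService J (stateAt J s m) = none)
    (hmn : m ≤ n) : stateAt J s n = stateAt J s m := by
  obtain ⟨l, rfl⟩ := Nat.exists_eq_add_of_le' hmn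
  rw [stateAt, Function.iterate_add_apply]
  exact Function.iterate_fixed (step_of_none h) l

/-- The movements so far are in chronological order, and precede the last service. -/
def ServerState.IsChronological {X : Type*} (S : ServerState X) : Prop :=
  S.moves.Pairwise (fun m m' => m.1 ≤ m'.1) ∧ ∀ m ∈ S.moves, (m.1 : WithBot ℝ) ≤ S.time

theorem ServerState.isChronological_init {X : Type*} (s : X) : (init s).IsChronological :=
  ⟨List.Pairwise.nil, fun _ hm => absurd hm List.not_mem_nil⟩

theorem IsService.isChronological_advance (h : IsService J S d) (hS : S.IsChronological) :
    (S.advance J d).IsChronological := by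
  have hold : ∀ m ∈ S.moves, (m.1 : WithBot ℝ) ≤ d.time := fun m hm =>
    (hS.2 m hm).trans h.time_le
  refine ⟨List.pairwise_append.2 ⟨hS.1, ?_, fun m hm m' hm' => ?_⟩, fun m hm => ?_⟩
  · refine List.pairwise_of_forall_mem_list fun m hm m' hm' => ?_
    rw [Service.time_eq_of_mem_moves hm, Service.time_eq_of_mem_moves hm']
  · rw [Service.time_eq_of_mem_moves hm']
    exact WithBot.coe_le_coe.1 (hold m hm)
  · rcases List.mem_append.1 hm with hm | hm
    · exact hold m hm
    · rw [Service.time_eq_of_mem_moves hm]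
      exact le_rfl

theorem isChronological_stateAt (s : X) (n : ℕ) : (stateAt J s n).IsChronological := by
  induction n with
  | zero => exact ServerState.isChronological_init s
  | succ n ih =>
    rw [stateAt_succ]
    rcases hn : nextService J (stateAt J s n) with _ | d
    · rwa [step_of_none hn]
    · rw [step_of_some hn]
      exact (isService_of_nextService hn).isChronological_advance ih

open Classical in
/-- The number of services on the whole input (`0` if there are infinitely many, which does not
happen in a finite metric space). -/
noncomputable def serviceCount (J : RequestSeq X) (s : X) : ℕ :=
  if h : ∃ n, nextService J (stateAt J s n) = none then Nat.find h else 0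

theorem nextService_serviceCount {s : X} (h : ∃ n, nextService J (stateAt J s n) = none) :
    nextService J (stateAt J s (serviceCount J s)) = none := by
  classical
  rw [serviceCount, dif_pos h]
  exact Nat.find_spec h

/-- The schedule which the algorithm produces. -/
noncomputable def generalSchedule (J : RequestSeq X) (s : X) : Schedule X :=
  ⟨(stateAt J s (serviceCount J s)).moves, (isChronological_stateAt s _).1⟩

end Basic

/-! ### Causality -/

section Causality

variable {X : Type*} {J J' : RequestSeq X} {S : ServerState X} {t : ℝ} {d : Service X}

/-- Two inputs have the same requests up to time `t`. -/
structure Agree (t : ℝ) (J J' : RequestSeq X) : Prop where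
  released_iff : ∀ i, (i < J.card ∧ (J i).release ≤ t) ↔ (i < J'.card ∧ (J' i).release ≤ t)
  request_eq : ∀ i < J.card, (J i).release ≤ t → J i = J' i

theorem Agree.symm (h : Agree t J J') : Agree t J' J :=
  ⟨fun i => (h.released_iff i).symm, fun i hi hr =>
    have hrel := (h.released_iff i).2 ⟨hi, hr⟩
    (h.request_eq i hrel.1 hrel.2).symm⟩

theorem Agree.mono (h : Agree t J J') {u : ℝ} (hu : u ≤ t) : Agree u J J' := by
  refine ⟨fun i => ⟨fun hi => ?_, fun hi => ?_⟩, fun i hi hr => h.request_eq i hi (hr.trans hu)⟩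
  · have hrel := (h.released_iff i).1 ⟨hi.1, hi.2.trans hu⟩
    exact ⟨hrel.1, h.request_eq i hi.1 (hi.2.trans hu) ▸ hi.2⟩
  · have hrel := (h.released_iff i).2 ⟨hi.1, hi.2.trans hu⟩
    exact ⟨hrel.1, (h.request_eq i hrel.1 hrel.2).symm ▸ hi.2⟩

variable [MetricSpace X]

theorem Agree.reach_eq (h : Agree t J J') {i : ℕ} (hi : i < J.card) (hr : (J i).release ≤ t) :
    S.reach J i = S.reach J' i := by
  rw [ServerState.reach, ServerState.reach, h.request_eq i hi hr]

theorem Agree.eligible_subset (h : Agree t J J') (j : ℤ) :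
    eligible J S t j ⊆ eligible J' S t j := fun i hi => by
  obtain ⟨hcard, hr, hS⟩ := mem_eligible.1 hi
  obtain ⟨hcard', hr'⟩ := (h.released_iff i).1 ⟨hcard, hr⟩
  exact mem_eligible.2 ⟨hcard', hr', h.reach_eq hcard hr ▸ hS⟩

theorem Agree.eligible_eq (h : Agree t J J') (j : ℤ) : eligible J S t j = eligible J' S t j :=
  (h.eligible_subset j).antisymm (h.symm.eligible_subset j)

theorem Agree.eq_of_mem (h : Agree t J J') {i : ℕ} {j : ℤ} (hi : i ∈ eligible J S t j) :
    J i = J' i :=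
  h.request_eq i (mem_eligible.1 hi).1 (mem_eligible.1 hi).2.1

theorem Agree.excess_eq (h : Agree t J J') {i : ℕ} {j : ℤ} (hi : i ∈ eligible J S t j) :
    excess J S t i = excess J' S t i := by
  rw [excess, excess, h.eq_of_mem hi]

theorem Agree.outer_eq (h : Agree t J J') (j : ℤ) : outer J S t j = outer J' S t j := by
  rw [outer, outer, ← h.eligible_eq]
  refine Finset.filter_congr fun i hi => ?_
  rw [h.reach_eq (mem_eligible.1 hi).1 (mem_eligible.1 hi).2.1]

theorem Agree.missed_eq (h : Agree t J J') (j : ℤ) (l : List X) :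
    missed J S t j l = missed J' S t j l := by
  classical
  rw [missed, missed, ← h.eligible_eq]
  refine Finset.filter_congr fun i hi => ?_
  rw [h.eq_of_mem hi]

theorem Agree.sum_eligible_eq (h : Agree t J J') (j : ℤ) :
    ∑ i ∈ eligible J S t j, excess J S t i = ∑ i ∈ eligible J' S t j, excess J' S t i :=
  Finset.sum_congr (h.eligible_eq j) fun _ hi => h.excess_eq (h.eligible_eq (S := S) j ▸ hi)

theorem Agree.triggered_iff (h : Agree t J J') : Triggered J S t ↔ Triggered J' S t := by
  simp only [Triggered, h.sum_eligible_eq]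

theorem Agree.isHeavy_iff (h : Agree t J J') (j : ℤ) (p : X) :
    IsHeavy J S t j p ↔ IsHeavy J' S t j p := by
  have hexcess : ∀ i ∈ outer J S t j, excess J S t i = excess J' S t i := fun i hi =>
    h.excess_eq (mem_outer.1 hi).1
  have hfilter : (outer J S t j).filter (fun i => dist p (J i).location ≤ 2 ^ j / 32) =
      (outer J S t j).filter (fun i => dist p (J' i).location ≤ 2 ^ j / 32) :=
    Finset.filter_congr fun i hi => by rw [h.eq_of_mem (mem_outer.1 hi).1]
  rw [IsHeavy, IsHeavy, ← h.outer_eq, ← hfilter, Finset.sum_congr rfl hexcess,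
    Finset.sum_congr rfl fun i hi => hexcess i (Finset.filter_subset _ _ hi)]

theorem Agree.sum_missed_eq (h : Agree t J J') (j : ℤ) (l : List X) (f : GeneralRequest X → ℝ) :
    ∑ i ∈ missed J S t j l, f (J i) = ∑ i ∈ missed J' S t j l, f (J' i) := by
  rw [← h.missed_eq]
  exact Finset.sum_congr rfl fun i hi => by rw [h.eq_of_mem (mem_missed.1 hi).1]

theorem Agree.isService (h : Agree t J J') (hd : IsService J S d) (hdt : d.time ≤ t) :
    IsService J' S d := by
  have h' := h.mono hdt
  refine ⟨⟨h'.triggered_iff.1 hd.least.1, fun u hu => ?_⟩, ?_, fun j hj => ?_,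
    hd.time_le_horizon, ?_, ?_, ?_⟩
  · rcases le_total u t with hut | hut
    · exact hd.least.2 ((h.mono hut).triggered_iff.2 hu)
    · exact hdt.trans hut
  · rw [← h'.sum_eligible_eq]; exact hd.threshold
  · rw [← h'.sum_eligible_eq]; exact hd.below j hj
  · rw [← h'.sum_missed_eq _ _ fun q => q.lower d.horizon - q.lower d.time]; exact hd.budget
  · refine hd.maximal.imp (fun he => h'.missed_eq _ _ ▸ he) fun hmax l hl => ?_
    rw [← h'.sum_missed_eq _ _ fun q => q.upper d.horizon - q.lower d.time]; exact hmax l hl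
  · simpa only [h'.isHeavy_iff] using hd.target_spec

theorem Agree.nextService_eq (h : Agree t J J') (hd : nextService J S = some d)
    (hdt : d.time ≤ t) : nextService J' S = some d := by
  have hserv := isService_of_nextService hd
  have hiff : IsService J' S = IsService J S := by
    refine funext fun d' => propext ⟨fun hd' => ?_, fun hd' => h.isService hd' ?_⟩
    · refine h.symm.isService hd' ?_
      rwa [hd'.least.unique (h.isService hserv hdt).least]
    · rwa [hd'.least.unique hserv.least]
  rw [← hd]
  unfold nextService
  generalize IsService J' S = P at hiff
  subst hiff
  rfl

theorem Agree.advance_eq (h : Agree t J J') (hdt : d.time ≤ t) :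
    S.advance J d = S.advance J' d := by
  have h' := h.mono hdt
  have heligible := h'.eligible_eq (S := S) d.level
  have hreach : ∀ i, i < J.card ∧ (J i).release ≤ d.time → S.reach J i = S.reach J' i :=
    fun i hi => h'.reach_eq hi.1 hi.2
  unfold ServerState.advance
  congr 1
  · ext i
    refine or_congr Iff.rfl (or_congr ?_ ?_)
    · rw [← and_assoc, ← and_assoc, ← h'.released_iff i]
      exact and_congr_right fun hi => by rw [hreach i hi]
    · rw [← heligible]
      exact and_congr_right fun hi => by rw [h'.eq_of_mem hi]
  · funext i
    rw [← heligible]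
    simp only [← h'.released_iff i]
    split_ifs with _ hi
    · rfl
    · exact hreach i hi
    · rfl
  · funext i
    rw [← heligible]
    by_cases hi : i ∈ eligible J S d.time d.level
    · rw [if_pos hi, if_pos hi, h'.eq_of_mem hi]
    · rw [if_neg hi, if_neg hi]

/-- No further service takes place by time `t`. -/
def IsQuiet (J : RequestSeq X) (t : ℝ) (S : ServerState X) : Prop :=
  ∀ d, nextService J S = some d → t < d.time

theorem IsQuiet.step (h : IsQuiet J t S) : IsQuiet J t (step J S) := by
  rcases hS : nextService J S with _ | d
  · rwa [step_of_none hS]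
  · rw [step_of_some hS]
    exact fun d' hd' =>
      (h d hS).trans_le (WithBot.coe_le_coe.1 (isService_of_nextService hd').time_le)

theorem IsQuiet.filter_moves_step (h : IsQuiet J t S) :
    (OnlineService.step J S).moves.filter (fun m => decide (m.1 ≤ t)) =
      S.moves.filter (fun m => decide (m.1 ≤ t)) := by
  rcases hS : nextService J S with _ | d
  · rw [step_of_none hS]
  · have hnil : (d.moves S.pos).filter (fun m => decide (m.1 ≤ t)) = [] := by
      refine List.filter_eq_nil_iff.2 fun m hm => ?_
      rw [Service.time_eq_of_mem_moves hm]
      simpa using h d hS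
    rw [step_of_some hS, ServerState.advance, List.filter_append, hnil, List.append_nil]

theorem Agree.step_eq_or_isQuiet (h : Agree t J J') (S : ServerState X) :
    step J S = step J' S ∨ IsQuiet J t S ∧ IsQuiet J' t S := by
  refine or_iff_not_imp_right.2 fun hquiet => ?_
  obtain ⟨d, hd, hd', hdt⟩ :
      ∃ d, nextService J S = some d ∧ nextService J' S = some d ∧ d.time ≤ t := by
    by_contra! hno
    exact hquiet ⟨fun d hd => not_le.1 fun hdt => (hno d hd (h.nextService_eq hd hdt)).not_ge hdt,
      fun d hd => not_le.1 fun hdt => (hno d (h.symm.nextService_eq hd hdt) hd).not_ge hdt⟩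
  rw [step_of_some hd, step_of_some hd', h.advance_eq hdt]

theorem Agree.filter_moves_stateAt_eq (h : Agree t J J') (s : X) (n : ℕ) :
    (stateAt J s n).moves.filter (fun m => decide (m.1 ≤ t)) =
      (stateAt J' s n).moves.filter (fun m => decide (m.1 ≤ t)) := by
  suffices stateAt J s n = stateAt J' s n ∨
      (IsQuiet J t (stateAt J s n) ∧ IsQuiet J' t (stateAt J' s n)) ∧
      (stateAt J s n).moves.filter (fun m => decide (m.1 ≤ t)) =
        (stateAt J' s n).moves.filter (fun m => decide (m.1 ≤ t)) from
    this.elim (fun he => by rw [he]) And.right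
  induction n with
  | zero => exact Or.inl rfl
  | succ n ih =>
    rw [stateAt_succ, stateAt_succ]
    have of_isQuiet : ∀ {S S' : ServerState X}, IsQuiet J t S → IsQuiet J' t S' →
        S.moves.filter (fun m => decide (m.1 ≤ t)) = S'.moves.filter (fun m => decide (m.1 ≤ t)) →
        (IsQuiet J t (step J S) ∧ IsQuiet J' t (step J' S')) ∧
        (step J S).moves.filter (fun m => decide (m.1 ≤ t)) =
          (step J' S').moves.filter (fun m => decide (m.1 ≤ t)) := fun hS hS' he =>
      ⟨⟨hS.step, hS'.step⟩, by rw [hS.filter_moves_step, hS'.filter_moves_step, he]⟩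
    rcases ih with he | ⟨⟨hS, hS'⟩, he⟩
    · rw [← he]
      exact (h.step_eq_or_isQuiet _).imp_right fun hq => of_isQuiet hq.1 hq.2 rfl
    · exact Or.inr (of_isQuiet hS hS' he)

theorem Agree.upTo_generalSchedule_eq (h : Agree t J J') (s : X)
    (hJ : ∃ n, nextService J (stateAt J s n) = none)
    (hJ' : ∃ n, nextService J' (stateAt J' s n) = none) :
    (generalSchedule J s).upTo t = (generalSchedule J' s).upTo t := by
  simp only [Schedule.upTo, generalSchedule]
  rw [← stateAt_eq_of_le (nextService_serviceCount hJ) (le_max_left _ (serviceCount J' s)),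
    ← stateAt_eq_of_le (nextService_serviceCount hJ') (le_max_right (serviceCount J s) _)]
  exact h.filter_moves_stateAt_eq s _

end Causality

/-! ### Existence of the next service -/

section Semicontinuity

theorem mem_of_isClosed_of_Ico_subset {C : Set ℝ} (hC : IsClosed C) {a b : ℝ} (hab : a < b)
    (h : Ico a b ⊆ C) : b ∈ C :=
  closure_minimal h hC ((closure_Ico hab.ne).symm ▸ right_mem_Icc.2 hab.le)

theorem exists_le_and_forall_ge_of_semicontinuous {ι : Type*} {s : Set ι} (hs : s.Finite)
    {f g : ι → ℝ → ℝ} (hf : ∀ i, LowerSemicontinuous (f i)) (hg : ∀ i, UpperSemicontinuous (g i))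
    (hfg : ∀ i t, f i t ≤ g i t) {a c : ℝ} (ha : ∃ i ∈ s, f i a ≤ c)
    (hc : ∃ t, a ≤ t ∧ ∀ i ∈ s, c ≤ g i t) :
    ∃ t, a ≤ t ∧ (∃ i ∈ s, f i t ≤ c) ∧ ∀ i ∈ s, c ≤ g i t := by
  set A : Set ℝ := {t | a ≤ t ∧ ∀ i ∈ s, c ≤ g i t} with hA
  have hbdd : BddBelow A := ⟨a, fun t ht => ht.1⟩
  have hclosed : IsClosed A := by
    have hinter : A = Ici a ∩ ⋂ i ∈ s, {t | c ≤ g i t} := by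
      ext t
      simp only [hA, mem_ofPred_eq, mem_inter_iff, mem_Ici, mem_iInter]
    rw [hinter]
    exact isClosed_Ici.inter (isClosed_biInter fun i _ => (hg i).isClosed_preimage c)
  have hmem : sInf A ∈ A := hclosed.csInf_mem hc hbdd
  refine ⟨sInf A, hmem.1, ?_, hmem.2⟩
  rcases hmem.1.eq_or_lt with heq | hlt
  · rwa [← heq]
  · have hsub : Ico a (sInf A) ⊆ ⋃ i ∈ s, {t | f i t ≤ c} := fun t ht => by
      have hnot : t ∉ A := fun h => (csInf_le hbdd h).not_gt ht.2
      simp only [hA, mem_ofPred_eq, not_and, not_forall, not_le] at hnot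
      obtain ⟨i, hi, hlt⟩ := hnot ht.1
      exact mem_biUnion hi ((hfg i t).trans hlt.le)
    obtain ⟨i, hi, hle⟩ := mem_iUnion₂.1 (mem_of_isClosed_of_Ico_subset
      (hs.isClosed_biUnion fun i _ => (hf i).isClosed_preimage c) hlt hsub)
    exact ⟨i, hi, hle⟩

theorem isClosed_setOf_le_coe (b : WithBot ℝ) : IsClosed {t : ℝ | b ≤ t} := by
  induction b with
  | bot => simp only [bot_le, ofPred_true, isClosed_univ]
  | coe a => simpa only [WithBot.coe_le_coe] using isClosed_le continuous_const continuous_id'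

end Semicontinuity

section Excess

variable {X : Type*} (J : RequestSeq X) (S : ServerState X)

theorem excess_nonneg (t : ℝ) (i : ℕ) : 0 ≤ excess J S t i := le_max_left _ _

/-- The unpaid delay cost of a request which is served at time `t`. The `excess` is the limit of
this cost from the right. -/
noncomputable def lowerExcess (t : ℝ) (i : ℕ) : ℝ := max 0 ((J i).lower t - S.paid i)

theorem lowerExcess_nonneg (t : ℝ) (i : ℕ) : 0 ≤ lowerExcess J S t i := le_max_left _ _

theorem lowerExcess_le_excess (t : ℝ) (i : ℕ) : lowerExcess J S t i ≤ excess J S t i :=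
  max_le_max le_rfl (sub_le_sub_right ((J i).lower_le_upper t) _)

theorem continuous_max_zero_sub (c : ℝ) : Continuous fun x : ℝ => max 0 (x - c) := by fun_prop

theorem monotone_max_zero_sub (c : ℝ) : Monotone fun x : ℝ => max 0 (x - c) :=
  fun _ _ h => max_le_max le_rfl (sub_le_sub_right h c)

theorem upperSemicontinuous_excess (i : ℕ) : UpperSemicontinuous fun t => excess J S t i :=
  (continuous_max_zero_sub _).comp_upperSemicontinuous (J i).upper_usc (monotone_max_zero_sub _)

theorem lowerSemicontinuous_lowerExcess (i : ℕ) :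
    LowerSemicontinuous fun t => lowerExcess J S t i :=
  (continuous_max_zero_sub _).comp_lowerSemicontinuous (J i).lower_lsc (monotone_max_zero_sub _)

end Excess

section Existence

variable {X : Type*} [MetricSpace X] {J : RequestSeq X} {S : ServerState X}

open Classical in
/-- The requests of level at most `j` which have not been served yet, released or not. -/
noncomputable def unserved (J : RequestSeq X) (S : ServerState X) (j : ℤ) : Finset ℕ :=
  (Finset.range J.card).filter fun i => i ∉ S.served ∧ 0 < S.reach J i ∧ S.reach J i ≤ 2 ^ j

theorem mem_unserved {i : ℕ} {j : ℤ} : i ∈ unserved J S j ↔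
    i < J.card ∧ i ∉ S.served ∧ 0 < S.reach J i ∧ S.reach J i ≤ 2 ^ j := by
  simp only [unserved, Finset.mem_filter, Finset.mem_range]

theorem eligible_subset_unserved (t : ℝ) (j : ℤ) : eligible J S t j ⊆ unserved J S j :=
  fun _ hi =>
    have h := mem_eligible.1 hi
    mem_unserved.2 ⟨h.1, h.2.2⟩

theorem sum_eligible_eq_sum_unserved (hpaid : ∀ i, 0 ≤ S.paid i) (t : ℝ) (j : ℤ) :
    ∑ i ∈ eligible J S t j, excess J S t i = ∑ i ∈ unserved J S j, excess J S t i := by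
  refine Finset.sum_subset (eligible_subset_unserved t j) fun i hi hni => ?_
  have hmem := mem_unserved.1 hi
  have hr : t < (J i).release := by
    by_contra hr
    exact hni (mem_eligible.2 ⟨hmem.1, not_lt.1 hr, hmem.2⟩)
  rw [excess, (J i).upper_eq_zero t hr, zero_sub, max_eq_left (neg_nonpos.2 (hpaid i))]

theorem eligible_nonempty_of_le_sum {t : ℝ} {j : ℤ}
    (h : 2 ^ j ≤ ∑ i ∈ eligible J S t j, excess J S t i) : (eligible J S t j).Nonempty :=
  Finset.nonempty_of_sum_ne_zero (lt_of_lt_of_le (by positivity) h).ne'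

variable (J S) in
theorem exists_forall_unserved_nonempty_le : ∃ lo : ℤ, ∀ j, (unserved J S j).Nonempty → lo ≤ j := by
  obtain ⟨lo, hlo⟩ := ((Finset.range J.card).image fun i => Int.log 2 (S.reach J i)).bddBelow
  refine ⟨lo, fun j ⟨i, hi⟩ => ?_⟩
  obtain ⟨hcard, -, hpos, hj⟩ := mem_unserved.1 hi
  refine (hlo (Finset.mem_image_of_mem _ (Finset.mem_range.2 hcard))).trans ?_
  have hpow := (Int.zpow_log_le_self (R := ℝ) (b := 2) one_lt_two hpos).trans hj
  exact (zpow_le_zpow_iff_right₀ (one_lt_two (α := ℝ))).1 (by exact_mod_cast hpow)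

variable (J S) in
theorem exists_forall_ge_unserved_eq :
    ∃ hi : ℤ, ∀ j, hi ≤ j → unserved J S j = unserved J S hi := by
  obtain ⟨hi, hhi⟩ := ((Finset.range J.card).image fun i => Int.log 2 (S.reach J i) + 1).exists_le
  have hreach : ∀ i < J.card, S.reach J i ≤ 2 ^ hi := fun i hcard => by
    have hlog := hhi _ (Finset.mem_image_of_mem _ (Finset.mem_range.2 hcard))
    have hlt := Int.lt_zpow_succ_log_self (R := ℝ) (b := 2) one_lt_two (S.reach J i)
    exact hlt.le.trans (by exact_mod_cast zpow_le_zpow_right₀ (one_le_two (α := ℝ)) hlog)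
  refine ⟨hi, fun j hj => Finset.ext fun i => ?_⟩
  simp only [mem_unserved]
  refine and_congr_right fun hcard => and_congr_right fun _ => and_congr_right fun _ => ?_
  have hle := hreach i hcard
  exact ⟨fun _ => hle, fun _ => hle.trans (zpow_le_zpow_right₀ one_le_two hj)⟩

theorem isClosed_setOf_triggered (hpaid : ∀ i, 0 ≤ S.paid i) :
    IsClosed {t | Triggered J S t} := by
  obtain ⟨lo, hlo⟩ := exists_forall_unserved_nonempty_le J S
  obtain ⟨hi, hhi⟩ := exists_forall_ge_unserved_eq J S
  have hset : {t | Triggered J S t} = {t : ℝ | S.time ≤ t} ∩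
      ⋃ j ∈ Finset.Icc lo (max lo hi), {t | 2 ^ j ≤ ∑ i ∈ unserved J S j, excess J S t i} := by
    ext t
    simp only [Triggered, mem_ofPred_eq, mem_inter_iff, mem_iUnion, exists_prop,
      sum_eligible_eq_sum_unserved hpaid]
    refine and_congr_right fun _ => ⟨fun ⟨j, hj⟩ => ?_, fun ⟨j, _, hj⟩ => ⟨j, hj⟩⟩
    have hloj : lo ≤ j := hlo j ((eligible_nonempty_of_le_sum
      (by rwa [sum_eligible_eq_sum_unserved hpaid])).mono (eligible_subset_unserved t j))
    rcases le_total j (max lo hi) with hle | hle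
    · exact ⟨j, Finset.mem_Icc.2 ⟨hloj, hle⟩, hj⟩
    · refine ⟨max lo hi, Finset.mem_Icc.2 ⟨le_max_left _ _, le_rfl⟩, ?_⟩
      rw [hhi _ (le_max_right lo hi), ← hhi j ((le_max_right lo hi).trans hle)]
      exact (zpow_le_zpow_right₀ one_le_two hle).trans hj
  rw [hset]
  exact (isClosed_setOf_le_coe _).inter (isClosed_biUnion_finset fun j _ =>
    (upperSemicontinuous_sum fun i _ => upperSemicontinuous_excess J S i).isClosed_preimage _)

variable (J S) in
theorem bddBelow_setOf_triggered : BddBelow {t | Triggered J S t} := by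
  obtain ⟨b, hb⟩ := ((Finset.range J.card).image fun i => (J i).release).bddBelow
  refine ⟨b, fun t ⟨_, j, hj⟩ => ?_⟩
  obtain ⟨i, hi⟩ := eligible_nonempty_of_le_sum hj
  have hmem := mem_eligible.1 hi
  exact (hb (Finset.mem_image_of_mem _ (Finset.mem_range.2 hmem.1))).trans hmem.2.1

theorem setOf_nodup_finite (X : Type*) [Finite X] : {l : List X | l.Nodup}.Finite := by
  have := Fintype.ofFinite X
  exact (List.finite_length_le X (Fintype.card X)).subset fun l hl => List.Nodup.length_le_card hl

theorem exists_forall_le_tour_add_sum_upper [Finite X] (J : RequestSeq X) (a : X) (T : ℝ) {B : ℝ}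
    {miss : List X → Finset ℕ} (h : ∀ l, l.Nodup → miss l = ∅ → B ≤ tour a l) :
    ∃ t, T ≤ t ∧ ∀ l : List X, l.Nodup →
      B ≤ tour a l + ∑ i ∈ miss l, ((J i).upper t - (J i).lower T) := by
  have hnonneg : ∀ t, T ≤ t → ∀ i, 0 ≤ (J i).upper t - (J i).lower T := fun t ht i =>
    sub_nonneg.2 (((J i).lower_mono ht).trans ((J i).lower_le_upper t))
  have hevent : ∀ l : List X, l.Nodup → ∀ᶠ t in atTop,
      B ≤ tour a l + ∑ i ∈ miss l, ((J i).upper t - (J i).lower T) := fun l hl => by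
    rcases (miss l).eq_empty_or_nonempty with hempty | ⟨i, hi⟩
    · simpa only [hempty, Finset.sum_empty, add_zero, eventually_const] using h l hl hempty
    · have hupper := tendsto_atTop_atTop_of_monotone (J i).upper_mono (J i).upper_unbounded
      filter_upwards [hupper.eventually_ge_atTop (B + (J i).lower T), eventually_ge_atTop T]
        with t ht hTt
      have hsingle := Finset.single_le_sum (fun i _ => hnonneg t hTt i) hi
      linarith [tour_nonneg a l]
  obtain ⟨t, hTt, ht⟩ := ((eventually_ge_atTop T).and
    ((setOf_nodup_finite X).eventually_all.2 hevent)).exists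
  exact ⟨t, hTt, ht⟩

theorem exists_route_horizon [Finite X] (J : RequestSeq X) (a : X) (T : ℝ) {B : ℝ} (hB : 0 ≤ B)
    (miss : List X → Finset ℕ) :
    ∃ (l : List X) (τ : ℝ), T ≤ τ ∧
      tour a l + ∑ i ∈ miss l, ((J i).lower τ - (J i).lower T) ≤ B ∧
      (miss l = ∅ ∨ ∀ l : List X, l.Nodup →
        B ≤ tour a l + ∑ i ∈ miss l, ((J i).upper τ - (J i).lower T)) := by
  by_cases hfull : ∃ l : List X, l.Nodup ∧ miss l = ∅ ∧ tour a l ≤ B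
  · obtain ⟨l, -, hempty, htour⟩ := hfull
    exact ⟨l, T, le_rfl, by rwa [hempty, Finset.sum_empty, add_zero], Or.inl hempty⟩
  push Not at hfull
  obtain ⟨τ, hτ, ⟨l, -, hl⟩, hmax⟩ := exists_le_and_forall_ge_of_semicontinuous
    (f := fun l t => tour a l + ∑ i ∈ miss l, ((J i).lower t - (J i).lower T))
    (g := fun l t => tour a l + ∑ i ∈ miss l, ((J i).upper t - (J i).lower T))
    (setOf_nodup_finite X)
    (fun l => by
      simp only [sub_eq_add_neg]
      exact lowerSemicontinuous_const.add (lowerSemicontinuous_sum fun i _ =>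
        (J i).lower_lsc.add lowerSemicontinuous_const))
    (fun l => by
      simp only [sub_eq_add_neg]
      exact upperSemicontinuous_const.add (upperSemicontinuous_sum fun i _ =>
        (J i).upper_usc.add upperSemicontinuous_const))
    (fun l t => by gcongr with i; exact (J i).lower_le_upper t)
    ⟨[], List.nodup_nil, by simpa only [tour_nil, sub_self, Finset.sum_const_zero, add_zero]⟩
    (exists_forall_le_tour_add_sum_upper J a T fun l hl hempty => (hfull l hl hempty).le)
  exact ⟨l, τ, hτ, hl, Or.inr hmax⟩

theorem exists_isService [Finite X] (hpaid : ∀ i, 0 ≤ S.paid i)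
    (h : ∃ t, Triggered J S t) : ∃ d, IsService J S d := by
  have hbdd := bddBelow_setOf_triggered J S
  have hmem := (isClosed_setOf_triggered hpaid).csInf_mem h hbdd
  set T := sInf {t | Triggered J S t}
  obtain ⟨lo, hlo⟩ := exists_forall_unserved_nonempty_le J S
  obtain ⟨ℓ, hthreshold, hmin⟩ := Int.exists_least_of_bdd ⟨lo, fun j hj =>
    hlo j ((eligible_nonempty_of_le_sum hj).mono (eligible_subset_unserved T j))⟩ hmem.2
  obtain ⟨l, τ, hτ, hbudget, hmax⟩ := exists_route_horizon J S.pos T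
    (B := 8 * 2 ^ ℓ) (by positivity) (missed J S T ℓ)
  obtain ⟨p, hp⟩ : ∃ p, IsHeavy J S T ℓ p ∨ p = S.pos ∧ ∀ p, ¬ IsHeavy J S T ℓ p := by
    by_cases hex : ∃ p, IsHeavy J S T ℓ p
    · exact hex.imp fun p hp => Or.inl hp
    · exact ⟨S.pos, Or.inr ⟨rfl, not_exists.1 hex⟩⟩
  exact ⟨⟨T, ℓ, l, τ, p⟩, ⟨hmem, fun t ht => csInf_le hbdd ht⟩, hthreshold,
    fun j hj => not_le.1 fun hle => (hmin j hle).not_gt hj, hτ, hbudget, hmax, hp⟩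

end Existence

/-! ### The effect of a service -/

section Steps

variable {X : Type*} [MetricSpace X] {J : RequestSeq X} {S : ServerState X} {d : Service X}

theorem dist_le_reach (i : ℕ) : dist S.pos (J i).location ≤ S.reach J i := le_max_right _ _

theorem radius_le_reach (i : ℕ) : S.radius i ≤ S.reach J i := le_max_left _ _

theorem reach_nonneg (i : ℕ) : 0 ≤ S.reach J i := dist_nonneg.trans (dist_le_reach i)

theorem IsService.le_sum_outer (h : IsService J S d) :
    2 ^ (d.level - 1) ≤ ∑ i ∈ outer J S d.time d.level, excess J S d.time i := by
  have hsplit := Finset.sum_filter_add_sum_filter_not (eligible J S d.time d.level)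
    (fun i => 2 ^ (d.level - 1) < S.reach J i) (excess J S d.time)
  have hinner : ∑ i ∈ eligible J S d.time d.level with ¬ 2 ^ (d.level - 1) < S.reach J i,
      excess J S d.time i ≤ ∑ i ∈ eligible J S d.time (d.level - 1), excess J S d.time i := by
    refine Finset.sum_le_sum_of_subset_of_nonneg (fun i hi => ?_) fun i _ _ => excess_nonneg _ _ _ _
    obtain ⟨hi, hreach⟩ := Finset.mem_filter.1 hi
    obtain ⟨hcard, hr, hserved, hpos, -⟩ := mem_eligible.1 hi
    exact mem_eligible.2 ⟨hcard, hr, hserved, hpos, not_lt.1 hreach⟩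
  have hbelow := h.below (d.level - 1) (by lia)
  have hhalf : (2 : ℝ) ^ d.level = 2 * 2 ^ (d.level - 1) := by
    rw [← zpow_one_add₀ two_ne_zero, add_sub_cancel]
  rw [outer]
  linarith [h.threshold]

theorem IsService.dist_target_le (h : IsService J S d) :
    dist S.pos d.target ≤ 2 * 2 ^ d.level := by
  have hpos : (0 : ℝ) < 2 ^ d.level := by positivity
  rcases h.target_spec with hheavy | ⟨hstay, -⟩
  · have houter : 0 < ∑ i ∈ outer J S d.time d.level, excess J S d.time i :=
      lt_of_lt_of_le (by positivity) h.le_sum_outer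
    obtain ⟨i, hi⟩ : ((outer J S d.time d.level).filter
        fun i => dist d.target (J i).location ≤ 2 ^ d.level / 32).Nonempty :=
      Finset.nonempty_of_sum_ne_zero (lt_of_lt_of_le (by positivity) hheavy).ne'
    obtain ⟨hi, hnear⟩ := Finset.mem_filter.1 hi
    have hreach := (mem_eligible.1 (mem_outer.1 hi).1).2.2.2.2
    linarith [dist_triangle_right S.pos d.target (J i).location, dist_le_reach (S := S) (J := J) i]
  · rw [hstay, dist_self]
    positivity

theorem IsService.pathLength_moves_le (h : IsService J S d) :
    pathLength S.pos ((d.moves S.pos).map Prod.snd) ≤ 10 * 2 ^ d.level := by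
  have hmoves : pathLength S.pos ((d.moves S.pos).map Prod.snd) =
      tour S.pos d.route + dist S.pos d.target := by
    have hmap : (d.moves S.pos).map Prod.snd = (d.route ++ [S.pos]) ++ [d.target] := by
      simp [Service.moves]
    rw [hmap, tour, pathLength, stepSum_append, List.getLastD_concat, stepSum, stepSum, add_zero]
  have hdelay : 0 ≤ ∑ i ∈ missed J S d.time d.level d.route,
      ((J i).lower d.horizon - (J i).lower d.time) := Finset.sum_nonneg fun i _ =>
    sub_nonneg.2 ((J i).lower_mono h.time_le_horizon)
  rw [hmoves]
  linarith [h.budget, h.dist_target_le]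

theorem advance_radius_of_mem {i : ℕ} (hi : i ∈ eligible J S d.time d.level) :
    (S.advance J d).radius i = 2 ^ (d.level + 1) := if_pos hi

theorem advance_radius_of_released {i : ℕ} (hi : i ∉ eligible J S d.time d.level)
    (hcard : i < J.card) (hr : (J i).release ≤ d.time) :
    (S.advance J d).radius i = S.reach J i :=
  (if_neg hi).trans (if_pos ⟨hcard, hr⟩)

theorem advance_radius_of_not_released {i : ℕ} (hr : ¬ (i < J.card ∧ (J i).release ≤ d.time)) :
    (S.advance J d).radius i = S.radius i :=
  (if_neg fun h => hr ⟨(mem_eligible.1 h).1, (mem_eligible.1 h).2.1⟩).trans (if_neg hr)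

theorem advance_paid_of_notMem {i : ℕ} (hi : i ∉ eligible J S d.time d.level) :
    (S.advance J d).paid i = S.paid i := if_neg hi

open Classical in
theorem advance_paid_of_mem {i : ℕ} (hi : i ∈ eligible J S d.time d.level) :
    (S.advance J d).paid i = max (S.paid i)
      ((J i).lower (if (J i).location ∈ d.route then d.time else d.horizon)) := if_pos hi

theorem mem_advance_served {i : ℕ} : i ∈ (S.advance J d).served ↔ i ∈ S.served ∨
    (i < J.card ∧ (J i).release ≤ d.time ∧ S.reach J i = 0) ∨
    (i ∈ eligible J S d.time d.level ∧ (J i).location ∈ d.route) := Iff.rfl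

theorem radius_le_advance (i : ℕ) : S.radius i ≤ (S.advance J d).radius i := by
  by_cases hi : i ∈ eligible J S d.time d.level
  · rw [advance_radius_of_mem hi]
    refine (radius_le_reach (J := J) i).trans ((mem_eligible.1 hi).2.2.2.2.trans ?_)
    exact zpow_le_zpow_right₀ one_le_two (by lia)
  · by_cases hr : i < J.card ∧ (J i).release ≤ d.time
    · rw [advance_radius_of_released hi hr.1 hr.2]
      exact radius_le_reach i
    · rw [advance_radius_of_not_released hr]

theorem paid_le_advance (i : ℕ) : S.paid i ≤ (S.advance J d).paid i := by
  by_cases hi : i ∈ eligible J S d.time d.level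
  · rw [advance_paid_of_mem hi]; exact le_max_left _ _
  · rw [advance_paid_of_notMem hi]

theorem IsService.lower_le_advance_paid (h : IsService J S d) {i : ℕ}
    (hi : i ∈ eligible J S d.time d.level) : (J i).lower d.time ≤ (S.advance J d).paid i := by
  rw [advance_paid_of_mem hi]
  refine le_trans ((J i).lower_mono ?_) (le_max_right _ _)
  split_ifs
  · exact le_rfl
  · exact h.time_le_horizon

theorem zpow_level_lt_advance_radius {i : ℕ} (hcard : i < J.card) (hr : (J i).release ≤ d.time)
    (hs : i ∉ (S.advance J d).served) : 2 ^ d.level < (S.advance J d).radius i := by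
  by_cases hi : i ∈ eligible J S d.time d.level
  · rw [advance_radius_of_mem hi]
    exact zpow_lt_zpow_right₀ one_lt_two (by lia)
  · rw [advance_radius_of_released hi hcard hr]
    rw [mem_advance_served, not_or, not_or] at hs
    by_contra hle
    exact hi (mem_eligible.2 ⟨hcard, hr, hs.1,
      (reach_nonneg i).lt_of_ne fun hzero => hs.2.1 ⟨hcard, hr, hzero.symm⟩, not_lt.1 hle⟩)

open Classical in
theorem IsService.advance_paid_sub_le (h : IsService J S d) {i : ℕ}
    (hi : i ∈ eligible J S d.time d.level) :
    (S.advance J d).paid i - S.paid i ≤ lowerExcess J S d.time i +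
      if (J i).location ∉ d.route then (J i).lower d.horizon - (J i).lower d.time else 0 := by
  have hmono := (J i).lower_mono h.time_le_horizon
  have hnonneg := lowerExcess_nonneg J S d.time i
  have hsub : (J i).lower d.time - S.paid i ≤ lowerExcess J S d.time i := le_max_right _ _
  rw [advance_paid_of_mem hi, sub_le_iff_le_add]
  split_ifs <;> refine max_le ?_ ?_ <;> linarith

/-- The delay costs which have accrued up to time `t` are covered by the levels. -/
def IsCovered (J : RequestSeq X) (S : ServerState X) (t : ℝ) : Prop :=
  ∀ j : ℤ, ∑ i ∈ eligible J S t j, lowerExcess J S t i ≤ 2 ^ j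

theorem IsService.sum_eligible_advance_paid_sub_le (h : IsService J S d)
    (hc : IsCovered J S d.time) :
    ∑ i ∈ eligible J S d.time d.level, ((S.advance J d).paid i - S.paid i) ≤ 9 * 2 ^ d.level := by
  classical
  have hsum := Finset.sum_le_sum fun i hi => h.advance_paid_sub_le (i := i) hi
  rw [Finset.sum_add_distrib, ← Finset.sum_filter] at hsum
  have hmissed : ∑ i ∈ missed J S d.time d.level d.route,
      ((J i).lower d.horizon - (J i).lower d.time) ≤ 8 * 2 ^ d.level := by
    linarith [h.budget, tour_nonneg S.pos d.route]
  rw [missed] at hmissed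
  linarith [hc d.level]

theorem IsService.sum_advance_paid_le (h : IsService J S d) (hc : IsCovered J S d.time) :
    ∑ i ∈ Finset.range J.card, (S.advance J d).paid i ≤
      ∑ i ∈ Finset.range J.card, S.paid i + 9 * 2 ^ d.level := by
  rw [← sub_le_iff_le_add', ← Finset.sum_sub_distrib]
  refine le_trans (Finset.sum_subset (fun i hi => Finset.mem_range.2 (mem_eligible.1 hi).1)
    fun i _ hi => ?_).ge (h.sum_eligible_advance_paid_sub_le hc)
  rw [advance_paid_of_notMem hi, sub_self]

theorem IsService.advance_paid_le_add (h : IsService J S d) (hc : IsCovered J S d.time)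
    {i : ℕ} (hi : i ∈ eligible J S d.time d.level) :
    (S.advance J d).paid i ≤ S.paid i + 9 * 2 ^ d.level :=
  sub_le_iff_le_add'.1 ((Finset.single_le_sum
    (f := fun i => (S.advance J d).paid i - S.paid i)
    (fun i _ => sub_nonneg.2 (paid_le_advance i)) hi).trans (h.sum_eligible_advance_paid_sub_le hc))

theorem IsService.notMem_eligible_and_mem_eligible (h : IsService J S d) {i : ℕ} {j : ℤ}
    (hi : i ∈ eligible J (S.advance J d) d.time j)
    (hne : lowerExcess J (S.advance J d) d.time i ≠ 0) :
    i ∉ eligible J S d.time d.level ∧ i ∈ eligible J S d.time j := by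
  obtain ⟨hcard, hr, hserved, -, hreach⟩ := mem_eligible.1 hi
  have hradius := zpow_level_lt_advance_radius hcard hr hserved
  have hni : i ∉ eligible J S d.time d.level := fun hmem =>
    hne (max_eq_left (sub_nonpos.2 (h.lower_le_advance_paid hmem)))
  refine ⟨hni, ?_⟩
  rw [mem_advance_served, not_or] at hserved
  rw [advance_radius_of_released hni hcard hr] at hradius
  refine mem_eligible.2 ⟨hcard, hr, hserved.1, lt_trans (by positivity) hradius, ?_⟩
  rw [← advance_radius_of_released hni hcard hr]
  exact (radius_le_reach i).trans hreach

theorem IsService.isCovered_advance (h : IsService J S d) (hc : IsCovered J S d.time) :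
    IsCovered J (S.advance J d) d.time := fun j => by
  rw [← Finset.sum_filter_ne_zero]
  refine le_trans ?_ (hc j)
  refine (Finset.sum_congr rfl fun i hi => ?_).trans_le (Finset.sum_le_sum_of_subset_of_nonneg
    (fun i hi => ?_) fun i _ _ => lowerExcess_nonneg J S _ i)
  all_goals
    obtain ⟨hi, hne⟩ := Finset.mem_filter.1 hi
    obtain ⟨hni, hmem⟩ := h.notMem_eligible_and_mem_eligible hi hne
  · rw [lowerExcess, advance_paid_of_notMem hni, lowerExcess]
  · exact hmem

theorem IsService.isCovered (h : IsService J S d) (hpaid : ∀ i, 0 ≤ S.paid i)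
    (hc : ∀ t : ℝ, S.time = t → IsCovered J S t) : IsCovered J S d.time := by
  rcases h.time_le.eq_or_lt with heq | hlt
  · exact hc _ heq
  intro j
  obtain ⟨a, ha, haT⟩ : ∃ a : ℝ, S.time ≤ a ∧ a < d.time := by
    rcases hS : S.time with _ | a
    · exact ⟨d.time - 1, bot_le, by linarith⟩
    · rw [hS] at hlt
      exact ⟨a, le_rfl, WithBot.coe_lt_coe.1 hlt⟩
  refine (Finset.sum_le_sum_of_subset_of_nonneg (eligible_subset_unserved _ j)
    fun i _ _ => lowerExcess_nonneg J S _ i).trans ?_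
  refine mem_of_isClosed_of_Ico_subset
    (C := {t | ∑ i ∈ unserved J S j, lowerExcess J S t i ≤ 2 ^ j})
    ((lowerSemicontinuous_sum fun i _ =>
      lowerSemicontinuous_lowerExcess J S i).isClosed_preimage _) haT fun t ht => ?_
  have hnot : ∑ i ∈ eligible J S t j, excess J S t i < 2 ^ j := by
    by_contra hle
    exact (h.least.2 ⟨ha.trans (WithBot.coe_le_coe.2 ht.1), j, not_lt.1 hle⟩).not_gt ht.2
  rw [sum_eligible_eq_sum_unserved hpaid] at hnot
  exact (Finset.sum_le_sum fun i _ => lowerExcess_le_excess J S t i).trans hnot.le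

end Steps

/-! ### Executions -/

/-- The first `m` services `d` of the algorithm on an input, and the states `S` before them. -/
structure IsExecution {X : Type*} [MetricSpace X] (J : RequestSeq X) (s : X)
    (S : ℕ → ServerState X) (d : ℕ → Service X) (m : ℕ) : Prop where
  state_zero : S 0 = ServerState.init s
  isService : ∀ i < m, IsService J (S i) (d i)
  state_succ : ∀ i < m, S (i + 1) = (S i).advance J (d i)

/-- `Γ` bounds all distances and the length of a tour through all points. -/
structure IsExtentBound (X : Type*) [MetricSpace X] (Γ : ℝ) : Prop where
  dist_le : ∀ x y : X, dist x y ≤ Γ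
  exists_tour_le : ∃ l : List X, l.Nodup ∧ (∀ x, x ∈ l) ∧ ∀ a, tour a l ≤ Γ

theorem exists_isExtentBound (X : Type*) [MetricSpace X] [Finite X] :
    ∃ Γ : ℝ, IsExtentBound X Γ := by
  have := Fintype.ofFinite X
  set D : ℝ := ∑ x : X, ∑ y : X, dist x y
  have hdist : ∀ x y : X, dist x y ≤ D := fun x y =>
    (Finset.single_le_sum (f := fun y => dist x y) (fun _ _ => dist_nonneg)
      (Finset.mem_univ y)).trans (Finset.single_le_sum (f := fun x => ∑ y : X, dist x y)
        (fun _ _ => Finset.sum_nonneg fun _ _ => dist_nonneg) (Finset.mem_univ x))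
  have hD : 0 ≤ D := Finset.sum_nonneg fun _ _ => Finset.sum_nonneg fun _ _ => dist_nonneg
  set l := (Finset.univ : Finset X).toList
  refine ⟨(l.length + 1) * D, fun x y => (hdist x y).trans ?_, l, Finset.nodup_toList _,
    fun x => Finset.mem_toList.2 (Finset.mem_univ x), fun a => tour_le_length_mul hdist a l⟩
  exact le_mul_of_one_le_left hD (le_add_of_nonneg_left l.length.cast_nonneg)

namespace IsExecution

variable {X : Type*} [MetricSpace X] {J : RequestSeq X} {s : X} {S : ℕ → ServerState X}
  {d : ℕ → Service X} {m : ℕ}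

theorem time_succ (h : IsExecution J s S d m) {i : ℕ} (hi : i < m) :
    (S (i + 1)).time = (d i).time := by
  rw [h.state_succ i hi]; rfl

theorem pos_succ (h : IsExecution J s S d m) {i : ℕ} (hi : i < m) :
    (S (i + 1)).pos = (d i).target := by
  rw [h.state_succ i hi]; rfl

theorem moves_succ (h : IsExecution J s S d m) {i : ℕ} (hi : i < m) :
    (S (i + 1)).moves = (S i).moves ++ (d i).moves (S i).pos := by
  rw [h.state_succ i hi]; rfl

theorem rel_of_le (h : IsExecution J s S d m) {i : ℕ}
    {p : ServerState X → ServerState X → Prop}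
    (hrefl : ∀ a, p a a) (htrans : ∀ a b c, p a b → p b c → p a c)
    (hstep : ∀ i < m, p (S i) ((S i).advance J (d i))) {j : ℕ} (hij : i ≤ j) (hj : j ≤ m) :
    p (S i) (S j) := by
  induction j, hij using Nat.le_induction with
  | base => exact hrefl _
  | succ j _ ih =>
    refine htrans _ _ _ (ih (by lia)) ?_
    rw [h.state_succ j hj]
    exact hstep j hj

theorem time_mono (h : IsExecution J s S d m) {i j : ℕ} (hij : i ≤ j) (hj : j ≤ m) :
    (S i).time ≤ (S j).time :=
  h.rel_of_le (p := fun a b => a.time ≤ b.time) (fun _ => le_rfl) (fun _ _ _ => le_trans)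
    (fun i hi => (h.isService i hi).time_le) hij hj

theorem radius_mono (h : IsExecution J s S d m) {i j : ℕ} (hij : i ≤ j) (hj : j ≤ m)
    (q : ℕ) : (S i).radius q ≤ (S j).radius q :=
  h.rel_of_le (p := fun a b => a.radius q ≤ b.radius q) (fun _ => le_rfl)
    (fun _ _ _ => le_trans) (fun _ _ => radius_le_advance q) hij hj

theorem paid_mono (h : IsExecution J s S d m) {i j : ℕ} (hij : i ≤ j) (hj : j ≤ m)
    (q : ℕ) : (S i).paid q ≤ (S j).paid q :=
  h.rel_of_le (p := fun a b => a.paid q ≤ b.paid q) (fun _ => le_rfl)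
    (fun _ _ _ => le_trans) (fun _ _ => paid_le_advance q) hij hj

theorem served_mono (h : IsExecution J s S d m) {i j : ℕ} (hij : i ≤ j) (hj : j ≤ m) :
    (S i).served ⊆ (S j).served :=
  h.rel_of_le (p := fun a b => a.served ⊆ b.served) (fun _ => Subset.rfl)
    (fun _ _ _ => Subset.trans) (fun _ _ _ hq => Or.inl hq) hij hj

theorem time_service_le_time (h : IsExecution J s S d m) {i j : ℕ} (hij : i < j) (hj : j ≤ m) :
    ((d i).time : WithBot ℝ) ≤ (S j).time := by
  rw [← h.time_succ (hij.trans_le hj)]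
  exact h.time_mono hij hj

theorem time_service_mono (h : IsExecution J s S d m) {i j : ℕ} (hij : i ≤ j) (hj : j < m) :
    (d i).time ≤ (d j).time := by
  rcases hij.eq_or_lt with rfl | hij
  · exact le_rfl
  · exact WithBot.coe_le_coe.1
      ((h.time_service_le_time hij hj.le).trans (h.isService j hj).time_le)

theorem untouched_of_time_lt_release (h : IsExecution J s S d m) {i : ℕ} (hi : i ≤ m) {q : ℕ}
    (hq : (S i).time < (J q).release) :
    q ∉ (S i).served ∧ (S i).radius q = 0 ∧ (S i).paid q = 0 := by
  induction i with
  | zero => rw [h.state_zero]; exact ⟨id, rfl, rfl⟩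
  | succ i ih =>
    have hlt : ¬ (J q).release ≤ (d i).time := by
      rw [h.time_succ hi] at hq
      exact not_le.2 (WithBot.coe_lt_coe.1 hq)
    obtain ⟨hserved, hradius, hpaid⟩ :=
      ih (Nat.le_of_succ_le hi) ((h.time_mono (Nat.le_succ i) hi).trans_lt hq)
    have hne : q ∉ eligible J (S i) (d i).time (d i).level := fun hm => hlt (mem_eligible.1 hm).2.1
    rw [h.state_succ i hi, mem_advance_served, advance_radius_of_not_released fun h => hlt h.2,
      advance_paid_of_notMem hne]
    refine ⟨?_, hradius, hpaid⟩
    rintro (hs | hs | hs)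
    · exact hserved hs
    · exact hlt hs.2.1
    · exact hne hs.1

theorem paid_nonneg (h : IsExecution J s S d m) {i : ℕ} (hi : i ≤ m) (q : ℕ) :
    0 ≤ (S i).paid q := by
  have hmono := h.paid_mono (Nat.zero_le i) hi q
  rwa [h.state_zero] at hmono

theorem zpow_level_lt_radius (h : IsExecution J s S d m) {i j : ℕ} (hij : i < j) (hj : j ≤ m)
    {q : ℕ} (hq : q < J.card) (hr : (J q).release ≤ (d i).time) (hs : q ∉ (S j).served) :
    2 ^ (d i).level < (S j).radius q := by
  refine lt_of_lt_of_le ?_ (h.radius_mono (Nat.succ_le_of_lt hij) hj q)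
  have hs' : q ∉ (S (i + 1)).served := fun hs' => hs (h.served_mono (Nat.succ_le_of_lt hij) hj hs')
  rw [Nat.succ_eq_add_one, h.state_succ i (hij.trans_le hj)] at *
  exact zpow_level_lt_advance_radius hq hr hs'

theorem lt_release_of_mem_eligible (h : IsExecution J s S d m) {i j : ℕ} {ℓ : ℤ} (hij : i < j)
    (hj : j < m) {q : ℕ} (hq : q ∈ eligible J (S j) (d j).time ℓ) (hℓ : ℓ ≤ (d i).level) :
    (d i).time < (J q).release := by
  obtain ⟨hcard, -, hserved, -, hreach⟩ := mem_eligible.1 hq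
  by_contra hle
  have hradius := h.zpow_level_lt_radius hij hj.le hcard (not_lt.1 hle) hserved
  have hpow : (2 : ℝ) ^ ℓ ≤ 2 ^ (d i).level := zpow_le_zpow_right₀ one_le_two hℓ
  linarith [radius_le_reach (S := S j) (J := J) q]

theorem isCovered (h : IsExecution J s S d m) {i : ℕ} (hi : i ≤ m) :
    ∀ t : ℝ, (S i).time = t → IsCovered J (S i) t := by
  induction i with
  | zero =>
    intro t ht
    rw [h.state_zero] at ht
    exact absurd ht.symm WithBot.coe_ne_bot
  | succ i ih =>
    intro t ht
    rw [h.time_succ hi] at ht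
    rw [← WithBot.coe_inj.1 ht, h.state_succ i hi]
    have hs := h.isService i hi
    exact hs.isCovered_advance (hs.isCovered (h.paid_nonneg (Nat.le_of_succ_le hi))
      (ih (Nat.le_of_succ_le hi)))

theorem isCovered_service (h : IsExecution J s S d m) {i : ℕ} (hi : i < m) :
    IsCovered J (S i) (d i).time :=
  (h.isService i hi).isCovered (h.paid_nonneg hi.le) (h.isCovered hi.le)

theorem sum_paid_le (h : IsExecution J s S d m) {i : ℕ} (hi : i ≤ m) :
    ∑ q ∈ Finset.range J.card, (S i).paid q ≤
      9 * ∑ j ∈ Finset.range i, (2 : ℝ) ^ (d j).level := by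
  induction i with
  | zero => rw [h.state_zero]; simp [ServerState.init]
  | succ i ih =>
    rw [h.state_succ i hi, Finset.sum_range_succ]
    linarith [ih (Nat.le_of_succ_le hi),
      (h.isService i hi).sum_advance_paid_le (h.isCovered_service hi)]

theorem paid_le_radius (h : IsExecution J s S d m) {i : ℕ} (hi : i ≤ m) (q : ℕ) :
    (S i).paid q ≤ 9 * (S i).radius q := by
  induction i with
  | zero => rw [h.state_zero]; simp [ServerState.init]
  | succ i ih =>
    have ih := ih (Nat.le_of_succ_le hi)
    rw [h.state_succ i hi]
    by_cases hq : q ∈ eligible J (S i) (d i).time (d i).level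
    · have hadd := (h.isService i hi).advance_paid_le_add (h.isCovered_service hi) hq
      have hradius := (radius_le_reach (J := J) q).trans (mem_eligible.1 hq).2.2.2.2
      rw [advance_radius_of_mem hq, zpow_add_one₀ two_ne_zero]
      linarith
    · rw [advance_paid_of_notMem hq]
      linarith [radius_le_advance (J := J) (S := S i) (d := d i) q]

theorem radius_le (h : IsExecution J s S d m) {Γ : ℝ} (hΓ : IsExtentBound X Γ) {i : ℕ}
    (hi : i ≤ m) {q : ℕ} (hq : q ∉ (S i).served) : (S i).radius q ≤ Γ := by
  obtain ⟨l, hnodup, hmem, htour⟩ := hΓ.exists_tour_le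
  induction i with
  | zero => rw [h.state_zero]; exact (tour_nonneg s l).trans (htour s)
  | succ i ih =>
    have ih := ih (Nat.le_of_succ_le hi) fun hm => hq (h.served_mono (Nat.le_succ i) hi hm)
    rw [h.state_succ i hi] at hq ⊢
    by_cases hqe : q ∈ eligible J (S i) (d i).time (d i).level
    · rw [advance_radius_of_mem hqe, zpow_add_one₀ two_ne_zero]
      rw [mem_advance_served, not_or, not_or] at hq
      have hmiss : q ∈ missed J (S i) (d i).time (d i).level (d i).route :=
        mem_missed.2 ⟨hqe, fun hm => hq.2.2 ⟨hqe, hm⟩⟩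
      have hmax := (h.isService i hi).maximal.resolve_left (Finset.ne_empty_of_mem hmiss) l hnodup
      have hempty : missed J (S i) (d i).time (d i).level l = ∅ :=
        Finset.eq_empty_of_forall_notMem fun i hi => (mem_missed.1 hi).2 (hmem _)
      rw [hempty, Finset.sum_empty] at hmax
      have hpos : (0 : ℝ) < 2 ^ (d i).level := by positivity
      linarith [htour (S i).pos]
    · by_cases hr : q < J.card ∧ (J q).release ≤ (d i).time
      · rw [advance_radius_of_released hqe hr.1 hr.2]
        exact max_le ih (hΓ.dist_le _ _)
      · rwa [advance_radius_of_not_released hr]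

theorem outer_nonempty (h : IsExecution J s S d m) {i : ℕ} (hi : i < m) :
    (outer J (S i) (d i).time (d i).level).Nonempty :=
  Finset.nonempty_of_sum_ne_zero
    (lt_of_lt_of_le (by positivity) (h.isService i hi).le_sum_outer).ne'

theorem zpow_level_le (h : IsExecution J s S d m) {Γ : ℝ} (hΓ : IsExtentBound X Γ) {i : ℕ}
    (hi : i < m) : 2 ^ (d i).level ≤ 2 * Γ := by
  obtain ⟨q, hq⟩ := h.outer_nonempty hi
  obtain ⟨heligible, hlevel⟩ := mem_outer.1 hq
  have hreach : (S i).reach J q ≤ Γ :=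
    max_le (h.radius_le hΓ hi.le (mem_eligible.1 heligible).2.2.1) (hΓ.dist_le _ _)
  rw [zpow_sub_one₀ two_ne_zero] at hlevel
  linarith

theorem paid_le (h : IsExecution J s S d m) {Γ : ℝ} (hΓ : IsExtentBound X Γ) {i : ℕ}
    (hi : i ≤ m) (q : ℕ) : (S i).paid q ≤ 36 * Γ := by
  induction i with
  | zero =>
    rw [h.state_zero]
    exact mul_nonneg (by norm_num) (dist_nonneg.trans (hΓ.dist_le s s))
  | succ i ih =>
    have hp := h.paid_le_radius hi q
    rw [h.state_succ i hi] at hp ⊢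
    by_cases hqe : q ∈ eligible J (S i) (d i).time (d i).level
    · rw [advance_radius_of_mem hqe, zpow_add_one₀ two_ne_zero] at hp
      linarith [h.zpow_level_le hΓ hi]
    · rw [advance_paid_of_notMem hqe]
      exact ih (Nat.le_of_succ_le hi)

theorem exists_moves_eq_append (h : IsExecution J s S d m) {i j : ℕ} (hij : i ≤ j) (hj : j ≤ m) :
    ∃ l, (S j).moves = (S i).moves ++ l ∧ ∀ x ∈ l, (d i).time ≤ x.1 ∧ i < j := by
  induction j, hij using Nat.le_induction with
  | base => exact ⟨[], (List.append_nil _).symm, fun x hx => absurd hx List.not_mem_nil⟩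
  | succ j hij ih =>
    obtain ⟨l, hl, htime⟩ := ih (Nat.le_of_succ_le hj)
    refine ⟨l ++ (d j).moves (S j).pos, by rw [h.moves_succ hj, hl, List.append_assoc],
      fun x hx => ⟨?_, Nat.lt_succ_of_le hij⟩⟩
    rcases List.mem_append.1 hx with hx | hx
    · exact (htime x hx).1
    · rw [Service.time_eq_of_mem_moves hx]
      exact h.time_service_mono hij hj

theorem isChronological (h : IsExecution J s S d m) {i : ℕ} (hi : i ≤ m) :
    (S i).IsChronological := by
  induction i with
  | zero => rw [h.state_zero]; exact ServerState.isChronological_init s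
  | succ i ih =>
    rw [h.state_succ i hi]
    exact (h.isService i hi).isChronological_advance (ih (Nat.le_of_succ_le hi))

theorem getLastD_moves (h : IsExecution J s S d m) {i : ℕ} (hi : i ≤ m) :
    ((S i).moves.map Prod.snd).getLastD s = (S i).pos := by
  cases i with
  | zero => rw [h.state_zero]; rfl
  | succ i =>
    have hmap : ((S i).moves ++ (d i).moves (S i).pos).map Prod.snd =
        ((S i).moves.map Prod.snd ++ (d i).route ++ [(S i).pos]) ++ [(d i).target] := by
      simp [Service.moves]
    rw [h.moves_succ hi, h.pos_succ hi, hmap, List.getLastD_concat]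

theorem pathLength_moves_le (h : IsExecution J s S d m) {i : ℕ} (hi : i ≤ m) :
    pathLength s ((S i).moves.map Prod.snd) ≤
      10 * ∑ j ∈ Finset.range i, (2 : ℝ) ^ (d j).level := by
  induction i with
  | zero => rw [h.state_zero]; simp [ServerState.init, stepSum]
  | succ i ih =>
    rw [h.moves_succ hi, List.map_append, pathLength, stepSum_append,
      h.getLastD_moves (Nat.le_of_succ_le hi), Finset.sum_range_succ]
    linarith [ih (Nat.le_of_succ_le hi), (h.isService i hi).pathLength_moves_le]

theorem visitsAt_release (h : IsExecution J s S d m) {σ : Schedule X} (hσ : σ.moves = (S m).moves)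
    {i : ℕ} (hi : i ≤ m) {q : ℕ} (hloc : (S i).pos = (J q).location)
    (hafter : (S i).time < (J q).release) (hbefore : i < m → (J q).release ≤ (d i).time) :
    σ.VisitsAt s (J q).location (J q).release := by
  left
  obtain ⟨l, hl, htime⟩ := h.exists_moves_eq_append hi le_rfl
  rw [Schedule.positionBefore, hσ, hl, List.filter_append, List.filter_eq_self.2,
    List.filter_eq_nil_iff.2, List.append_nil, h.getLastD_moves hi, hloc]
  · intro x hx
    have hle := (hbefore (htime x hx).2).trans (htime x hx).1
    simpa only [decide_eq_true_eq, not_lt] using hle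
  · intro x hx
    have hlt := ((h.isChronological hi).2 x hx).trans_lt hafter
    simpa only [decide_eq_true_eq] using WithBot.coe_lt_coe.1 hlt

theorem time_lt_release_of_reach_eq_zero (h : IsExecution J s S d m) {i : ℕ} (hi : i ≤ m) {q : ℕ}
    (hq : q < J.card) (hs : q ∉ (S i).served) (hzero : (S i).reach J q = 0) :
    (S i).time < (J q).release := by
  cases i with
  | zero => rw [h.state_zero]; exact WithBot.bot_lt_coe _
  | succ i =>
    by_contra hle
    rw [h.time_succ hi, not_lt] at hle
    have hradius := h.zpow_level_lt_radius (Nat.lt_succ_self i) hi hq (WithBot.coe_le_coe.1 hle) hs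
    have hpos : (0 : ℝ) < 2 ^ (d i).level := by positivity
    linarith [radius_le_reach (S := S (i + 1)) (J := J) q]

theorem exists_visit_of_reach_eq_zero (h : IsExecution J s S d m) {σ : Schedule X}
    (hσ : σ.moves = (S m).moves) {i : ℕ} (hi : i ≤ m) {q : ℕ} (hq : q < J.card)
    (hs : q ∉ (S i).served) (hzero : (S i).reach J q = 0)
    (hbefore : i < m → (J q).release ≤ (d i).time) :
    ∃ t, (J q).release ≤ t ∧ σ.VisitsAt s (J q).location t ∧ (J q).lower t ≤ (S i).paid q := by
  refine ⟨(J q).release, le_rfl, h.visitsAt_release hσ hi (dist_le_zero.1 (hzero ▸ dist_le_reach q))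
    (h.time_lt_release_of_reach_eq_zero hi hq hs hzero) hbefore, ?_⟩
  rw [(J q).lower_eq_zero _ le_rfl]
  exact h.paid_nonneg hi q

theorem exists_visit_of_served (h : IsExecution J s S d m) {σ : Schedule X}
    (hσ : σ.moves = (S m).moves) {i : ℕ} (hi : i ≤ m) {q : ℕ} (hs : q ∈ (S i).served) :
    ∃ t, (J q).release ≤ t ∧ σ.VisitsAt s (J q).location t ∧ (J q).lower t ≤ (S i).paid q := by
  induction i with
  | zero =>
    rw [h.state_zero] at hs
    exact absurd hs id
  | succ i ih =>
    have hi' := Nat.le_of_succ_le hi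
    have hpaid := h.paid_mono (Nat.le_succ i) hi q
    by_cases hs' : q ∈ (S i).served
    · obtain ⟨t, hr, hvisit, hlower⟩ := ih hi' hs'
      exact ⟨t, hr, hvisit, hlower.trans hpaid⟩
    rw [h.state_succ i hi, mem_advance_served] at hs
    rcases hs.resolve_left hs' with ⟨hcard, hr, hzero⟩ | ⟨heligible, hroute⟩
    · obtain ⟨t, hr, hvisit, hlower⟩ :=
        h.exists_visit_of_reach_eq_zero hσ hi' hcard hs' hzero fun _ => hr
      exact ⟨t, hr, hvisit, hlower.trans hpaid⟩
    · refine ⟨(d i).time, (mem_eligible.1 heligible).2.1, Or.inr ?_, ?_⟩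
      · obtain ⟨l, hl, -⟩ := h.exists_moves_eq_append hi le_rfl
        rw [hσ, hl, h.moves_succ hi]
        refine List.mem_append_left _ (List.mem_append_right _ ?_)
        exact List.mem_map.2 ⟨_, List.mem_append_left _ hroute, rfl⟩
      · rw [h.state_succ i hi]
        exact (h.isService i hi).lower_le_advance_paid heligible

end IsExecution

section Termination

variable {X : Type*} [MetricSpace X] {J : RequestSeq X} {S : ServerState X}

theorem exists_triggered_of_reach_pos {q : ℕ} (hq : q < J.card) (hs : q ∉ S.served)
    (hpos : 0 < S.reach J q) : ∃ t, Triggered J S t := by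
  obtain ⟨j, hj⟩ : ∃ j : ℤ, S.reach J q ≤ 2 ^ j := by
    refine ⟨Int.log 2 (S.reach J q) + 1, ?_⟩
    exact_mod_cast (Int.lt_zpow_succ_log_self (R := ℝ) one_lt_two (S.reach J q)).le
  obtain ⟨t, ht⟩ := (J q).upper_unbounded (2 ^ j + S.paid q)
  obtain ⟨b, hb⟩ : ∃ b : ℝ, S.time ≤ b := by
    rcases S.time with _ | b
    · exact ⟨0, bot_le⟩
    · exact ⟨b, le_rfl⟩
  set u := max t (max b (J q).release)
  have hbu : b ≤ u := (le_max_left _ _).trans (le_max_right _ _)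
  refine ⟨u, hb.trans (WithBot.coe_le_coe.2 hbu), j, ?_⟩
  have hmem : q ∈ eligible J S u j :=
    mem_eligible.2 ⟨hq, (le_max_right _ _).trans (le_max_right _ _), hs, hpos, hj⟩
  refine le_trans (le_trans ?_ (le_max_right _ _))
    (Finset.single_le_sum (fun i _ => excess_nonneg J S u i) hmem)
  linarith [(J q).upper_mono (le_max_left t (max b (J q).release))]

theorem IsExecution.exists_visit_of_not_triggered {s : X} {S : ℕ → ServerState X}
    {d : ℕ → Service X} {m : ℕ} (h : IsExecution J s S d m) (hm : ¬ ∃ t, Triggered J (S m) t)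
    {σ : Schedule X} (hσ : σ.moves = (S m).moves) {q : ℕ} (hq : q < J.card) :
    ∃ t, (J q).release ≤ t ∧ σ.VisitsAt s (J q).location t ∧ (J q).lower t ≤ (S m).paid q := by
  by_cases hs : q ∈ (S m).served
  · exact h.exists_visit_of_served hσ le_rfl hs
  · rcases (reach_nonneg (S := S m) (J := J) q).eq_or_lt with hzero | hpos
    · exact h.exists_visit_of_reach_eq_zero hσ le_rfl hq hs hzero.symm
        fun hlt => absurd hlt (lt_irrefl _)
    · exact absurd (exists_triggered_of_reach_pos hq hs hpos) hm

theorem exists_isExecution (s : X) {n : ℕ}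
    (h : ∀ i < n, nextService J (stateAt J s i) ≠ none) :
    ∃ d : ℕ → Service X, IsExecution J s (stateAt J s) d n := by
  have hsome : ∀ i, i < n → ∃ d, nextService J (stateAt J s i) = some d := fun i hi =>
    Option.ne_none_iff_exists'.1 (h i hi)
  have : Nonempty (Service X) := ⟨⟨0, 0, [], 0, s⟩⟩
  choose! d hd using hsome
  exact ⟨d, rfl, fun i hi => isService_of_nextService (hd i hi),
    fun i hi => by rw [stateAt_succ, step_of_some (hd i hi)]⟩

theorem finite_of_strictMonoOn_of_le {A : Set ℕ} {f : ℕ → ℤ} (hf : StrictMonoOn f A) {b : ℤ}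
    (hb : ∀ i ∈ A, f i ≤ b) : A.Finite := by
  rcases A.eq_empty_or_nonempty with rfl | hne
  · exact finite_empty
  · refine Finite.of_finite_image ((finite_Icc (f (sInf A)) b).subset ?_) hf.injOn
    rintro - ⟨i, hi, rfl⟩
    exact ⟨hf.monotoneOn (Nat.sInf_mem hne) hi (Nat.sInf_le hi), hb i hi⟩

theorem IsExecution.level_lt_level {s : X} {S : ℕ → ServerState X} {d : ℕ → Service X} {m : ℕ}
    (h : IsExecution J s S d m) {i j q : ℕ} (hij : i < j) (hj : j < m)
    (hqi : q ∈ eligible J (S i) (d i).time (d i).level)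
    (hqj : q ∈ eligible J (S j) (d j).time (d j).level) : (d i).level < (d j).level := by
  obtain ⟨hcard, hr, -⟩ := mem_eligible.1 hqi
  obtain ⟨-, -, hserved, -, hreach⟩ := mem_eligible.1 hqj
  exact (zpow_lt_zpow_iff_right₀ (one_lt_two (α := ℝ))).1
    ((h.zpow_level_lt_radius hij hj.le hcard hr hserved).trans_le
      ((radius_le_reach q).trans hreach))

/- Every service is caused by an outer request, and the levels of the services caused by the same
request increase. -/
variable (J) in
theorem exists_nextService_eq_none [Finite X] (s : X) :
    ∃ n, nextService J (stateAt J s n) = none := by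
  by_contra! hne
  choose d hd using fun i => Option.ne_none_iff_exists'.1 (hne i)
  have h : ∀ m, IsExecution J s (stateAt J s) d m := fun m =>
    ⟨rfl, fun i _ => isService_of_nextService (hd i),
      fun i _ => by rw [stateAt_succ, step_of_some (hd i)]⟩
  obtain ⟨Γ, hΓ⟩ := exists_isExtentBound X
  have hlevel : ∀ i, (d i).level ≤ Int.log 2 (2 * Γ) := fun i => by
    have hle := (h (i + 1)).zpow_level_le hΓ (Nat.lt_succ_self i)
    exact (Int.zpow_le_iff_le_log one_lt_two (lt_of_lt_of_le (by positivity) hle)).1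
      (by exact_mod_cast hle)
  have hfinite : ∀ q, {i | q ∈ outer J (stateAt J s i) (d i).time (d i).level}.Finite := fun q =>
    finite_of_strictMonoOn_of_le
      (fun i hi j hj hij => (h (j + 1)).level_lt_level hij (Nat.lt_succ_self j)
        (mem_outer.1 hi).1 (mem_outer.1 hj).1)
      fun i _ => hlevel i
  refine infinite_univ (((finite_Iio J.card).biUnion fun q _ => hfinite q).subset fun i _ => ?_)
  obtain ⟨q, hq⟩ := (h (i + 1)).outer_nonempty (Nat.lt_succ_self i)
  exact mem_biUnion (mem_eligible.1 (mem_outer.1 hq).1).1 hq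

theorem not_triggered_of_nextService_eq_none [Finite X] (hpaid : ∀ i, 0 ≤ S.paid i)
    (h : nextService J S = none) : ¬ ∃ t, Triggered J S t := by
  intro htriggered
  rw [nextService, dif_pos (exists_isService hpaid htriggered)] at h
  exact absurd h (Option.some_ne_none _)

variable (J) in
theorem exists_complete_isExecution [Finite X] (s : X) :
    ∃ (S : ℕ → ServerState X) (d : ℕ → Service X) (m : ℕ), IsExecution J s S d m ∧
      (generalSchedule J s).moves = (S m).moves ∧ ¬ ∃ t, Triggered J (S m) t := by
  classical
  have hex := exists_nextService_eq_none J s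
  have hcount : serviceCount J s = Nat.find hex := by rw [serviceCount, dif_pos hex]
  obtain ⟨d, hd⟩ := exists_isExecution s fun i (hi : i < serviceCount J s) =>
    Nat.find_min hex (hcount ▸ hi)
  exact ⟨_, d, _, hd, rfl, not_triggered_of_nextService_eq_none (hd.paid_nonneg le_rfl)
    (nextService_serviceCount hex)⟩

end Termination

/-! ### Movements during a time interval -/

section TimedMovements

variable {X : Type*}

open Classical in
/-- The movements of a list whose times lie in `I`. The times are compared in `WithBot ℝ` because
the initial state of the algorithm has time `⊥`. -/
noncomputable def movesDuring (I : Set (WithBot ℝ)) (l : List (ℝ × X)) : List (ℝ × X) :=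
  l.filter fun m => (m.1 : WithBot ℝ) ∈ I

/-- The location of a server which starts at `s` and performs the movements of a list whose times
lie in `I`. -/
noncomputable def positionAfter (s : X) (l : List (ℝ × X)) (I : Set (WithBot ℝ)) : X :=
  ((movesDuring I l).map Prod.snd).getLastD s

/-- The location of the server after its movements by a given time. -/
noncomputable abbrev posAt (s : X) (l : List (ℝ × X)) (b : WithBot ℝ) : X :=
  positionAfter s l (Iic b)

variable {s : X} {l : List (ℝ × X)} {I J K : Set (WithBot ℝ)}

theorem mem_movesDuring {m : ℝ × X} : m ∈ movesDuring I l ↔ m ∈ l ∧ (m.1 : WithBot ℝ) ∈ I := by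
  simp [movesDuring]

theorem movesDuring_univ (l : List (ℝ × X)) : movesDuring univ l = l := by
  simp [movesDuring]

theorem movesDuring_sublist (I : Set (WithBot ℝ)) (l : List (ℝ × X)) :
    (movesDuring I l).Sublist l :=
  List.filter_sublist

theorem movesDuring_cons_of_mem {m : ℝ × X} (hm : (m.1 : WithBot ℝ) ∈ I) (l : List (ℝ × X)) :
    movesDuring I (m :: l) = m :: movesDuring I l :=
  List.filter_cons_of_pos (by simpa using hm)

theorem movesDuring_cons_of_notMem {m : ℝ × X} (hm : (m.1 : WithBot ℝ) ∉ I) (l : List (ℝ × X)) :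
    movesDuring I (m :: l) = movesDuring I l :=
  List.filter_cons_of_neg (by simpa using hm)

theorem movesDuring_eq_append (hl : l.Pairwise fun m m' => m.1 ≤ m'.1) (hI : IsLowerSet I)
    (hIJ : I ⊆ J) : movesDuring J l = movesDuring I l ++ movesDuring (J \ I) l := by
  induction l with
  | nil => rfl
  | cons m l ih =>
    obtain ⟨hm, hl⟩ := List.pairwise_cons.1 hl
    by_cases hmI : (m.1 : WithBot ℝ) ∈ I
    · rw [movesDuring_cons_of_mem (hIJ hmI), movesDuring_cons_of_mem hmI,
        movesDuring_cons_of_notMem fun h => h.2 hmI, ih hl, List.cons_append]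
    · have hnil : movesDuring I (m :: l) = [] := by
        refine List.eq_nil_iff_forall_not_mem.2 fun x hx => ?_
        obtain ⟨hxl, hxI⟩ := mem_movesDuring.1 hx
        rcases List.mem_cons.1 hxl with rfl | hxl
        · exact hmI hxI
        · exact hmI (hI (WithBot.coe_le_coe.2 (hm x hxl)) hxI)
      rw [hnil, List.nil_append]
      exact List.filter_congr fun x hx => by
        have hxI : (x.1 : WithBot ℝ) ∉ I := fun hxI =>
          List.not_mem_nil (hnil ▸ mem_movesDuring.2 ⟨hx, hxI⟩)
        simp [hxI]

theorem getLastD_append (l l' : List X) (s : X) :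
    (l ++ l').getLastD s = l'.getLastD (l.getLastD s) := by
  induction l generalizing s with
  | nil => rfl
  | cons x l ih => rw [List.cons_append, List.getLastD_cons, List.getLastD_cons, ih]

theorem positionAfter_eq_getLastD (hl : l.Pairwise fun m m' => m.1 ≤ m'.1) (hI : IsLowerSet I)
    (hIJ : I ⊆ J) : positionAfter s l J =
      ((movesDuring (J \ I) l).map Prod.snd).getLastD (positionAfter s l I) := by
  rw [positionAfter, movesDuring_eq_append hl hI hIJ, List.map_append, getLastD_append,
    positionAfter]

theorem positionAfter_mem_cons (hl : l.Pairwise fun m m' => m.1 ≤ m'.1) (hI : IsLowerSet I)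
    (hIJ : I ⊆ J) (hJK : J ⊆ K) :
    positionAfter s l J ∈ positionAfter s l I :: (movesDuring (K \ I) l).map Prod.snd := by
  rw [positionAfter_eq_getLastD hl hI hIJ]
  refine List.cons_subset_cons _ (List.map_subset _ fun m hm => ?_) List.getLastD_mem_cons
  obtain ⟨hml, hmJ, hmI⟩ := mem_movesDuring.1 hm
  exact mem_movesDuring.2 ⟨hml, hJK hmJ, hmI⟩

theorem positionAfter_mem {Y : Finset X} (hs : s ∈ Y) (hl : ∀ m ∈ l, m.2 ∈ Y)
    (I : Set (WithBot ℝ)) : positionAfter s l I ∈ Y := by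
  have hmem : positionAfter s l I ∈ s :: (movesDuring I l).map Prod.snd := List.getLastD_mem_cons
  rcases List.mem_cons.1 hmem with h | h
  · rwa [h]
  · obtain ⟨m, hm, hmI⟩ := List.mem_map.1 h
    exact hmI ▸ hl m (mem_movesDuring.1 hm).1

theorem Schedule.positionBefore_eq_positionAfter (s : X) (σ : Schedule X) (t : ℝ) :
    σ.positionBefore s t = positionAfter s σ.moves (Iio t) := by
  simp [positionBefore, positionAfter, movesDuring, WithBot.coe_lt_coe]

theorem Schedule.VisitsAt.mem_cons {σ : Schedule X} {p : X} {t : ℝ} (h : σ.VisitsAt s p t)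
    {b c : WithBot ℝ} (hb : b < t) (hc : t ≤ c) :
    p ∈ posAt s σ.moves b :: (movesDuring (Iic c \ Iic b) σ.moves).map Prod.snd := by
  rcases h with h | h
  · rw [positionBefore_eq_positionAfter] at h
    rw [← h]
    exact positionAfter_mem_cons σ.chronological (isLowerSet_Iic b)
      (fun _ hx => lt_of_le_of_lt hx hb) fun _ hx => (le_of_lt hx).trans hc
  · exact List.mem_cons_of_mem _
      (List.mem_map.2 ⟨(t, p), mem_movesDuring.2 ⟨h, hc, not_le.2 hb⟩, rfl⟩)

end TimedMovements

/-! ### Offline schedules -/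

namespace Schedule

variable {X : Type*} {σ : Schedule X} {Y : Finset X} {s : X}

open Classical in
/-- The schedule which skips the movements to points outside of a set. It still visits all the
points of the set which the original schedule visits, and at the same times. -/
noncomputable def restrict (σ : Schedule X) (Y : Finset X) : Schedule X :=
  ⟨σ.moves.filter fun m => m.2 ∈ Y, σ.chronological.sublist List.filter_sublist⟩

theorem mem_restrict_moves {m : ℝ × X} : m ∈ (σ.restrict Y).moves ↔ m ∈ σ.moves ∧ m.2 ∈ Y := by
  simp [restrict]

theorem VisitsAt.restrict {p : X} {t : ℝ} (h : σ.VisitsAt s p t) (hp : p ∈ Y) :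
    (σ.restrict Y).VisitsAt s p t := by
  classical
  refine h.imp (fun h => ?_) fun h => mem_restrict_moves.2 ⟨h, hp⟩
  have hcomm : (σ.restrict Y).moves.filter (fun m => decide (m.1 < t)) =
      (σ.moves.filter fun m => decide (m.1 < t)).filter fun m => decide (m.2 ∈ Y) := by
    rw [Schedule.restrict]
    simp only [List.filter_filter, Bool.and_comm]
  rw [positionBefore] at h ⊢
  rw [hcomm]
  rcases List.eq_nil_or_concat (σ.moves.filter fun m => decide (m.1 < t)) with
    hnil | ⟨l, m, hlm⟩
  · simpa [hnil] using h
  · rw [hlm] at h ⊢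
    have hm : m.2 = p := by simpa using h
    simp [List.filter_append, hm, hp]

end Schedule

section MovementIn

variable {X : Type*} [PseudoMetricSpace X]

/-- The sum of a function of the lengths of the movements whose times lie in `I`. -/
noncomputable def movementIn (g : ℝ → ℝ) (I : Set (WithBot ℝ)) : X → List (ℝ × X) → ℝ
  | _, [] => 0
  | s, m :: l => I.indicator (fun _ => g (dist s m.2)) m.1 + movementIn g I m.2 l

theorem movementIn_append (g : ℝ → ℝ) (I : Set (WithBot ℝ)) (s : X) (l l' : List (ℝ × X)) :
    movementIn g I s (l ++ l') =
      movementIn g I s l + movementIn g I ((l.map Prod.snd).getLastD s) l' := by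
  induction l generalizing s with
  | nil => simp [movementIn]
  | cons m l ih =>
    rw [List.cons_append, movementIn, movementIn, ih, List.map_cons, List.getLastD_cons, add_assoc]

theorem movementIn_eq_zero {I : Set (WithBot ℝ)} {l : List (ℝ × X)}
    (h : ∀ m ∈ l, (m.1 : WithBot ℝ) ∉ I) (g : ℝ → ℝ) (s : X) : movementIn g I s l = 0 := by
  induction l generalizing s with
  | nil => rfl
  | cons m l ih =>
    rw [List.forall_mem_cons] at h
    rw [movementIn, indicator_of_notMem h.1, ih h.2, add_zero]

theorem movementIn_eq_stepSum {I : Set (WithBot ℝ)} {l : List (ℝ × X)}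
    (h : ∀ m ∈ l, (m.1 : WithBot ℝ) ∈ I) (g : ℝ → ℝ) (s : X) :
    movementIn g I s l = stepSum g s (l.map Prod.snd) := by
  induction l generalizing s with
  | nil => rfl
  | cons m l ih =>
    rw [List.forall_mem_cons] at h
    rw [movementIn, indicator_of_mem h.1, ih h.2, List.map_cons, stepSum]

theorem movementIn_diff {l : List (ℝ × X)} (hl : l.Pairwise fun m m' => m.1 ≤ m'.1)
    {I J : Set (WithBot ℝ)} (hI : IsLowerSet I) (hJ : IsLowerSet J) (hIJ : I ⊆ J) (g : ℝ → ℝ)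
    (s : X) : movementIn g (J \ I) s l =
      stepSum g (positionAfter s l I) ((movesDuring (J \ I) l).map Prod.snd) := by
  have hsplit : l = movesDuring I l ++ movesDuring (J \ I) l ++ movesDuring (univ \ J) l := by
    rw [← movesDuring_eq_append hl hI hIJ, ← movesDuring_eq_append hl hJ (subset_univ J),
      movesDuring_univ]
  conv_lhs => rw [hsplit]
  rw [movementIn_append, movementIn_append,
    movementIn_eq_zero fun m hm h => h.2 (mem_movesDuring.1 hm).2,
    movementIn_eq_stepSum fun m hm => (mem_movesDuring.1 hm).2,
    movementIn_eq_zero fun m hm h => (mem_movesDuring.1 hm).2.2 h.1, zero_add, add_zero,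
    positionAfter]

theorem sum_movementIn_le_mul_pathLength {ι : Type*} (F : Finset ι) (g : ι → ℝ → ℝ)
    (I : ι → Set (WithBot ℝ)) {K : ℝ}
    (hK : ∀ (t : WithBot ℝ) (d : ℝ), 0 ≤ d →
      ∑ i ∈ F, (I i).indicator (fun _ => g i d) t ≤ K * d)
    (s : X) (l : List (ℝ × X)) :
    ∑ i ∈ F, movementIn (g i) (I i) s l ≤ K * pathLength s (l.map Prod.snd) := by
  induction l generalizing s with
  | nil => simp [movementIn, stepSum]
  | cons m l ih =>
    simp only [movementIn, Finset.sum_add_distrib, List.map_cons, stepSum, mul_add]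
    exact add_le_add (hK _ _ dist_nonneg) (ih m.2)

theorem pathLength_le_dist_add (s a : X) (l : List X) :
    pathLength s l ≤ dist s a + pathLength a l := by
  cases l with
  | nil => simp [stepSum]
  | cons x l =>
    simp only [stepSum]
    linarith [dist_triangle s a x]

theorem pathLength_le_of_sublist {l l' : List X} (h : l'.Sublist l) (s : X) :
    pathLength s l' ≤ pathLength s l := by
  induction h generalizing s with
  | slnil => exact le_rfl
  | cons a _ ih => exact (pathLength_le_dist_add s a _).trans (add_le_add_right (ih a) _)
  | cons_cons a _ ih => exact add_le_add_right (ih a) _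

theorem dist_getLastD_le_pathLength (s : X) (l : List X) :
    dist s (l.getLastD s) ≤ pathLength s l := by
  induction l generalizing s with
  | nil => simp [stepSum]
  | cons x l ih =>
    rw [List.getLastD_cons]
    exact (dist_triangle s x _).trans (add_le_add_right (ih x) _)

theorem sum_dist_posAt_le {l : List (ℝ × X)} (hl : l.Pairwise fun m m' => m.1 ≤ m'.1) (s : X)
    (b : ℕ → WithBot ℝ) (m : ℕ) (hb : ∀ i < m, b i ≤ b (i + 1)) :
    ∑ i ∈ Finset.range m, dist (posAt s l (b i)) (posAt s l (b (i + 1))) ≤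
      pathLength s (l.map Prod.snd) := by
  suffices hprefix : ∀ n ≤ m, ∑ i ∈ Finset.range n, dist (posAt s l (b i)) (posAt s l (b (i + 1))) ≤
      pathLength s ((movesDuring (Iic (b n)) l).map Prod.snd) from
    (hprefix m le_rfl).trans (pathLength_le_of_sublist ((movesDuring_sublist _ l).map _) s)
  intro n hn
  induction n with
  | zero => simpa using pathLength_nonneg _ _
  | succ n ih =>
    have hIic := Iic_subset_Iic.2 (hb n hn)
    rw [Finset.sum_range_succ, movesDuring_eq_append hl (isLowerSet_Iic (b n)) hIic,
      List.map_append, pathLength, stepSum_append]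
    refine add_le_add (ih (Nat.le_of_succ_le hn)) ?_
    rw [posAt, posAt, positionAfter_eq_getLastD hl (isLowerSet_Iic (b n)) hIic]
    exact dist_getLastD_le_pathLength _ _

end MovementIn

section Offline

variable {X : Type*} [MetricSpace X]

theorem Schedule.movementCost_eq_pathLength (s : X) (σ : Schedule X) :
    σ.movementCost s = pathLength s (σ.moves.map Prod.snd) := by
  rw [movementCost]
  induction σ.moves generalizing s with
  | nil => rfl
  | cons m l ih => rw [travel, List.map_cons, pathLength, stepSum, ih]

theorem Schedule.movementCost_nonneg (s : X) (σ : Schedule X) : 0 ≤ σ.movementCost s :=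
  movementCost_eq_pathLength s σ ▸ pathLength_nonneg _ _

theorem Schedule.movementCost_restrict_le (σ : Schedule X) (Y : Finset X) (s : X) :
    (σ.restrict Y).movementCost s ≤ σ.movementCost s := by
  rw [movementCost_eq_pathLength, movementCost_eq_pathLength]
  exact pathLength_le_of_sublist (List.filter_sublist.map _) s

/-- A schedule which serves the requests of `J` at the times `ts`, and visits only points
of `Y`. The costs do not jump before the requests are served. -/
structure IsOffline {X : Type*} (J : RequestSeq X) (s : X) (σ : Schedule X) (ts : ℕ → ℝ)
    (Y : Finset X) : Prop where
  release_le : ∀ q < J.card, (J q).release ≤ ts q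
  visitsAt : ∀ q < J.card, σ.VisitsAt s (J q).location (ts q)
  upper_eq : ∀ q < J.card, ∀ t < ts q, (J q).upper t = (J q).lower t
  start_mem : s ∈ Y
  moves_mem : ∀ m ∈ σ.moves, m.2 ∈ Y

theorem IsOffline.exists_tour {J : RequestSeq X} {s : X} {σ : Schedule X} {ts : ℕ → ℝ}
    {Y : Finset X} (ho : IsOffline J s σ ts Y) {b c : WithBot ℝ} (hbc : b ≤ c) {ℓ : ℤ}
    (h : movementIn (trunc Y.card ℓ) (Iic c \ Iic b) s σ.moves < 2 ^ ℓ / 128) :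
    ∃ l : List X, l.Nodup ∧ tour (posAt s σ.moves b) l ≤ 2 ^ ℓ / 32 ∧
      (∀ e ∈ Icc b c, posAt s σ.moves e ∈ l) ∧
      ∀ q < J.card, b < (J q).release → ts q ≤ c → (J q).location ∈ l := by
  rw [movementIn_diff σ.chronological (isLowerSet_Iic b) (isLowerSet_Iic c)
    (Iic_subset_Iic.2 hbc)] at h
  obtain ⟨l, hnodup, hmem, htour⟩ := exists_short_tour ℓ
    (positionAfter_mem ho.start_mem ho.moves_mem _) (fun z hz => by
      obtain ⟨m, hm, rfl⟩ := List.mem_map.1 hz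
      exact ho.moves_mem m (mem_movesDuring.1 hm).1) h
  refine ⟨l, hnodup, htour, fun e he => hmem _ ?_, fun q hq hb hts => hmem _ ?_⟩
  · exact positionAfter_mem_cons σ.chronological (isLowerSet_Iic b) (Iic_subset_Iic.2 he.1)
      (Iic_subset_Iic.2 he.2)
  · exact (ho.visitsAt q hq).mem_cons (hb.trans_le (WithBot.coe_le_coe.2 (ho.release_le q hq))) hts

end Offline

/-! ### Charging the services to an offline schedule -/

/-- The services from `a` up to but not including `i` have a level below `ℓ`. -/
def LevelsBelow {X : Type*} (d : ℕ → Service X) (a i : ℕ) (ℓ : ℤ) : Prop :=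
  ∀ j, a ≤ j → j < i → (d j).level < ℓ

/-- The service `j` is the last one before `i` whose level is as high as that of the requests which
cause the service `i`. These requests were left behind by the service `j`. -/
structure IsParent {X : Type*} (d : ℕ → Service X) (j i : ℕ) : Prop where
  lt : j < i
  level_eq : (d i).level = (d j).level + 1
  levelsBelow : LevelsBelow d (j + 1) i (d i).level

section Definitions

variable {X : Type*} [MetricSpace X] (J : RequestSeq X) (s : X) (S : ℕ → ServerState X)
  (d : ℕ → Service X) (σ : Schedule X) (ts : ℕ → ℝ) (Y : Finset X)

/-- The reach of the request `q` before the service `i` was set by the service `j`, which left the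
request behind. -/
structure IsLeftover (j i q : ℕ) : Prop where
  lt : j < i
  mem : q ∈ missed J (S j) (d j).time (d j).level (d j).route
  reach_eq : (S i).reach J q = 2 ^ ((d j).level + 1)
  lower_le_paid : (J q).lower (d j).horizon ≤ (S i).paid q

/-- The eligible requests of the service `i` which an offline solution serves later than `T`. -/
noncomputable def lateRequests (i : ℕ) (T : ℝ) : Finset ℕ :=
  (eligible J (S i) (d i).time (d i).level).filter fun q => T < ts q

/-- The service `i` is charged to the movements of `σ` up to this service, since the last service
before `j` which has at least the level of `j`. -/
def IsMovementCharged (j i : ℕ) : Prop :=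
  ∃ a ≤ j, LevelsBelow d a j (d j).level ∧ 2 ^ (d i).level ≤
    128 * movementIn (trunc Y.card (d i).level) (Iic (S (i + 1)).time \ Iic (S a).time) s σ.moves

/-- The service `i` is charged to the unpaid delay cost of its requests. -/
def IsDelayCharged (i : ℕ) : Prop :=
  2 ^ (d i).level ≤
    8 * ∑ q ∈ lateRequests J S d ts i (d i).time, lowerExcess J (S i) (d i).time q

/-- The service `i` is charged to the delay cost of the requests of the service `j` since then. -/
def IsParentDelayCharged (j i : ℕ) : Prop :=
  2 ^ (d i).level ≤ ∑ q ∈ lateRequests J S d ts j (d i).time,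
    ((J q).lower (d i).time - (J q).lower (d j).time)

/-- Between the services `j` and `i`, the server has approached the server of `σ`. -/
structure IsApproach (j i : ℕ) : Prop where
  le : j ≤ i
  exists_mem_eligible :
    ∃ q ∈ eligible J (S i) (d i).time (d i).level, (J q).release ≤ (d j).time
  le_dist : 2 ^ ((d i).level - 2) ≤ dist (S j).pos (posAt s σ.moves (S (j + 1)).time)
  dist_le : dist (S (i + 1)).pos (posAt s σ.moves (S (i + 1)).time) ≤ 2 ^ (d i).level / 16

/-- From the service `a` to the service `i`, the server of `σ` stays in a set of points with a short
tour. This set contains the requests of the service `j` which `σ` has served by then. -/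
structure IsConfined (a j i : ℕ) (l : List X) : Prop where
  nodup : l.Nodup
  tour_le : tour (posAt s σ.moves (S a).time) l ≤ 2 ^ (d i).level / 32
  posAt_mem : ∀ e ∈ Icc (S a).time (S (i + 1)).time, posAt s σ.moves e ∈ l
  lt_release : ∀ q ∈ eligible J (S j) (d j).time (d j).level, (S a).time < (J q).release
  location_mem : ∀ q ∈ eligible J (S j) (d j).time (d j).level, ts q ≤ (d i).time →
    (J q).location ∈ l

end Definitions

section Charging

variable {X : Type*} [MetricSpace X] {J : RequestSeq X} {s : X} {S : ℕ → ServerState X}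
  {d : ℕ → Service X} {m : ℕ} {σ : Schedule X} {ts : ℕ → ℝ} {Y : Finset X}

theorem mem_lateRequests {i q : ℕ} {T : ℝ} : q ∈ lateRequests J S d ts i T ↔
    q ∈ eligible J (S i) (d i).time (d i).level ∧ T < ts q :=
  Finset.mem_filter

theorem IsExecution.exists_levelsBelow (h : IsExecution J s S d m) {i : ℕ} (hi : i < m) (ℓ : ℤ) :
    ∃ a ≤ i, LevelsBelow d a i ℓ ∧
      ∀ q ∈ eligible J (S i) (d i).time ℓ, (S a).time < (J q).release := by
  classical
  by_cases hex : ∃ j < i, ℓ ≤ (d j).level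
  · obtain ⟨j, ⟨hji, hj⟩, hmax⟩ := exists_max_image {j | j < i ∧ ℓ ≤ (d j).level} id
      ((finite_Iio i).subset fun _ h => h.1) hex
    refine ⟨j + 1, hji, fun n hn hni => ?_, fun q hq => ?_⟩
    · by_contra hle
      exact absurd (hmax n ⟨hni, not_lt.1 hle⟩) (not_le.2 hn)
    · rw [h.time_succ (hji.trans hi)]
      exact WithBot.coe_lt_coe.2 (h.lt_release_of_mem_eligible hji hi hq hj)
  · push Not at hex
    refine ⟨0, Nat.zero_le i, fun j _ hji => hex j hji, fun q _ => ?_⟩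
    rw [h.state_zero]
    exact WithBot.bot_lt_coe _

theorem IsExecution.isLeftover_succ_self (h : IsExecution J s S d m) {i : ℕ} (hi : i < m) {q : ℕ}
    (hq : q ∈ eligible J (S i) (d i).time (d i).level) (hs : q ∉ (S (i + 1)).served)
    (hreach : (S (i + 1)).reach J q = (S (i + 1)).radius q) : IsLeftover J S d i (i + 1) q := by
  rw [h.state_succ i hi, mem_advance_served, not_or, not_or] at hs
  have hmissed : (J q).location ∉ (d i).route := fun hm => hs.2.2 ⟨hq, hm⟩
  refine ⟨Nat.lt_succ_self i, mem_missed.2 ⟨hq, hmissed⟩, ?_, ?_⟩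
  · rw [hreach, h.state_succ i hi, advance_radius_of_mem hq]
  · rw [h.state_succ i hi, advance_paid_of_mem hq, if_neg hmissed]
    exact le_max_right _ _

theorem IsExecution.exists_reach_eq_or_isLeftover (h : IsExecution J s S d m) {i : ℕ} (hi : i < m)
    {q : ℕ} (hq : q < J.card) (hr : (J q).release ≤ (d i).time) (hs : q ∉ (S i).served) :
    (∃ j ≤ i, (J q).release ≤ (d j).time ∧ (S i).reach J q = dist (S j).pos (J q).location) ∨
      ∃ j, IsLeftover J S d j i q := by
  induction i with
  | zero =>
    refine Or.inl ⟨0, le_rfl, hr, ?_⟩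
    rw [ServerState.reach, h.state_zero]
    exact max_eq_right dist_nonneg
  | succ i ih =>
    rcases le_or_gt ((S (i + 1)).radius q) (dist (S (i + 1)).pos (J q).location) with hd | hd
    · exact Or.inl ⟨i + 1, le_rfl, hr, max_eq_right hd⟩
    have hreach : (S (i + 1)).reach J q = (S (i + 1)).radius q := max_eq_left hd.le
    have hri : (J q).release ≤ (d i).time := by
      by_contra hlt
      rw [(h.untouched_of_time_lt_release hi.le (by
        rw [h.time_succ (Nat.lt_of_succ_lt hi)]
        exact WithBot.coe_lt_coe.2 (not_le.1 hlt))).2.1] at hd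
      exact dist_nonneg.not_gt hd
    have him := Nat.lt_of_succ_lt hi
    by_cases hqe : q ∈ eligible J (S i) (d i).time (d i).level
    · exact Or.inr ⟨i, h.isLeftover_succ_self him hqe hs hreach⟩
    have hreach_eq : (S (i + 1)).reach J q = (S i).reach J q := by
      rw [hreach, h.state_succ i him, advance_radius_of_released hqe hq hri]
    rcases ih him hri fun hm => hs (h.served_mono (Nat.le_succ i) hi.le hm) with
      ⟨j, hji, hrj, hdist⟩ | ⟨j, hj⟩
    · exact Or.inl ⟨j, Nat.le_succ_of_le hji, hrj, hreach_eq.trans hdist⟩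
    · refine Or.inr ⟨j, Nat.lt_succ_of_lt hj.lt, hj.mem, hreach_eq.trans hj.reach_eq, ?_⟩
      rw [h.state_succ i him, advance_paid_of_notMem hqe]
      exact hj.lower_le_paid

theorem IsExecution.isMovementCharged_or_isConfined (h : IsExecution J s S d m)
    (ho : IsOffline J s σ ts Y) {j i : ℕ} (hj : j ≤ i) (hi : i < m) :
    IsMovementCharged s S d σ Y j i ∨ ∃ a ≤ j, ∃ l, IsConfined J s S d σ ts a j i l := by
  obtain ⟨a, ha, hbelow, hrelease⟩ := h.exists_levelsBelow (hj.trans_lt hi) (d j).level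
  refine or_iff_not_imp_left.2 fun hcharge => ⟨a, ha, ?_⟩
  have hshort : movementIn (trunc Y.card (d i).level) (Iic (S (i + 1)).time \ Iic (S a).time) s
      σ.moves < 2 ^ (d i).level / 128 := by
    by_contra hle
    exact hcharge ⟨a, ha, hbelow, by linarith⟩
  obtain ⟨l, hnodup, htour, hpos, hmem⟩ := ho.exists_tour
    (h.time_mono ((ha.trans hj).trans (Nat.le_succ i)) hi) hshort
  refine ⟨l, hnodup, htour, hpos, hrelease, fun q hq hts => hmem q (mem_eligible.1 hq).1
    (hrelease q hq) ?_⟩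
  rw [h.time_succ hi]
  exact WithBot.coe_le_coe.2 hts

/-! ### Services caused by leftover requests -/

theorem IsLeftover.isParent (h : IsExecution J s S d m) {j i q : ℕ} (hi : i < m)
    (hq : q ∈ outer J (S i) (d i).time (d i).level) (hl : IsLeftover J S d j i q) :
    IsParent d j i := by
  obtain ⟨hel, hgt⟩ := mem_outer.1 hq
  have hle := (mem_eligible.1 hel).2.2.2.2
  rw [hl.reach_eq] at hgt hle
  rw [zpow_lt_zpow_iff_right₀ one_lt_two] at hgt
  rw [zpow_le_zpow_iff_right₀ one_lt_two] at hle
  refine ⟨hl.lt, by lia, fun n hn hni => ?_⟩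
  by_contra hlevel
  have hlate := h.lt_release_of_mem_eligible hni hi hel (not_lt.1 hlevel)
  have hearly := (mem_eligible.1 (mem_missed.1 hl.mem).1).2.1
  linarith [h.time_service_mono (Nat.le_of_succ_le hn) (hni.trans hi)]

theorem IsLeftover.horizon_le {j i q : ℕ} (hl : IsLeftover J S d j i q)
    (hex : 0 < excess J (S i) (d i).time q) : (d j).horizon ≤ (d i).time := by
  by_contra hlt
  have hupper := (J q).upper_le_lower _ _ (not_le.1 hlt)
  exact hex.ne' (max_eq_left (by linarith [hl.lower_le_paid]))

theorem IsOffline.sum_missed_le_sum_late (ho : IsOffline J s σ ts Y) {j : ℕ} {T : ℝ}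
    (hjT : (d j).time ≤ T) (hT : (d j).horizon ≤ T) {l : List X}
    (hl : ∀ q ∈ missed J (S j) (d j).time (d j).level l, T < ts q) :
    ∑ q ∈ missed J (S j) (d j).time (d j).level l,
        ((J q).upper (d j).horizon - (J q).lower (d j).time) ≤
      ∑ q ∈ lateRequests J S d ts j T, ((J q).lower T - (J q).lower (d j).time) := by
  refine (Finset.sum_le_sum fun q hq => ?_).trans
    (Finset.sum_le_sum_of_subset_of_nonneg (fun q hq => ?_) fun q _ _ => ?_)
  · have hupper := ho.upper_eq q (mem_eligible.1 (mem_missed.1 hq).1).1 _ (hl q hq)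
    linarith [(J q).upper_mono hT]
  · exact mem_lateRequests.2 ⟨(mem_missed.1 hq).1, hl q hq⟩
  · exact sub_nonneg.2 ((J q).lower_mono hjT)

/- The tour through the points visited by the server of `σ`, or the empty tour if they are far away,
was an option for the service `j`. It was not within the budget, so that the delay cost of the
requests off this tour is high; and these requests have not been served by `σ` yet. -/
theorem IsConfined.isParentDelayCharged (h : IsExecution J s S d m) (ho : IsOffline J s σ ts Y)
    {a j i : ℕ} (hi : i < m) (hp : IsParent d j i) {l : List X}
    (hc : IsConfined J s S d σ ts a j i l)
    (hmissed : (missed J (S j) (d j).time (d j).level (d j).route).Nonempty)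
    (hhorizon : (d j).horizon ≤ (d i).time) (haj : a ≤ j) : IsParentDelayCharged J S d ts j i := by
  have hjm := hp.lt.trans hi
  have hmax := (h.isService j hjm).maximal.resolve_left hmissed.ne_empty
  have htime := h.time_service_mono hp.lt.le hi
  have hpos : (0 : ℝ) < 2 ^ (d j).level := by positivity
  have hlevel : (2 : ℝ) ^ (d i).level = 2 ^ (d j).level * 2 := by
    rw [hp.level_eq, zpow_add_one₀ two_ne_zero]
  have hlate : ∀ q ∈ eligible J (S j) (d j).time (d j).level, (J q).location ∉ l →
      (d i).time < ts q := fun q hq hql => not_le.1 fun hts => hql (hc.location_mem q hq hts)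
  have htour := hc.tour_le
  rw [IsParentDelayCharged]
  by_cases hnear : ∃ q ∈ eligible J (S j) (d j).time (d j).level, (J q).location ∈ l
  · obtain ⟨q, hq, hql⟩ := hnear
    have hcost := hmax l hc.nodup
    have hsum := ho.sum_missed_le_sum_late htime hhorizon fun q hq =>
      hlate q (mem_missed.1 hq).1 (mem_missed.1 hq).2
    have hreach := (dist_le_reach (S := S j) q).trans (mem_eligible.1 hq).2.2.2.2
    have hdist := dist_le_tour (a := posAt s σ.moves (S a).time) hql (hc.posAt_mem _
      ⟨le_rfl, h.time_mono (haj.trans (hp.lt.le.trans (Nat.le_succ i))) hi⟩)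
    linarith [tour_le_tour_add (S j).pos (posAt s σ.moves (S a).time) l,
      dist_triangle (S j).pos (J q).location (posAt s σ.moves (S a).time)]
  · push Not at hnear
    have hcost := hmax [] List.nodup_nil
    rw [tour_nil] at hcost
    linarith [ho.sum_missed_le_sum_late (l := []) htime hhorizon fun q hq =>
      hlate q (mem_missed.1 hq).1 (hnear q (mem_missed.1 hq).1)]

/-! ### Services caused by requests near an earlier location of the server -/

theorem IsHeavy.dist_le {S : ServerState X} {t : ℝ} {ℓ : ℤ} {p p' : X} (hp : IsHeavy J S t ℓ p)
    (hp' : IsHeavy J S t ℓ p') (hpos : 0 < ∑ q ∈ outer J S t ℓ, excess J S t q) :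
    dist p p' ≤ 2 ^ ℓ / 16 := by
  classical
  rw [IsHeavy] at hp hp'
  set A := (outer J S t ℓ).filter fun q => dist p (J q).location ≤ 2 ^ ℓ / 32
  set B := (outer J S t ℓ).filter fun q => dist p' (J q).location ≤ 2 ^ ℓ / 32
  obtain ⟨q, hq⟩ : (A ∩ B).Nonempty := by
    rw [Finset.nonempty_iff_ne_empty]
    intro hempty
    have hunion := Finset.sum_union_inter (s₁ := A) (s₂ := B) (f := excess J S t)
    have hle : ∑ q ∈ A ∪ B, excess J S t q ≤ ∑ q ∈ outer J S t ℓ, excess J S t q :=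
      Finset.sum_le_sum_of_subset_of_nonneg
        (Finset.union_subset (Finset.filter_subset _ _) (Finset.filter_subset _ _))
        fun q _ _ => excess_nonneg _ _ _ _
    rw [hempty, Finset.sum_empty] at hunion
    linarith
  obtain ⟨hqA, hqB⟩ := Finset.mem_inter.1 hq
  have hdist := (Finset.mem_filter.1 hqA).2
  have hdist' := (Finset.mem_filter.1 hqB).2
  linarith [dist_triangle_right p p' (J q).location]

theorem IsOffline.sum_outer_late_le (ho : IsOffline J s σ ts Y) (i : ℕ) :
    ∑ q ∈ outer J (S i) (d i).time (d i).level with (d i).time < ts q,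
        excess J (S i) (d i).time q ≤
      ∑ q ∈ lateRequests J S d ts i (d i).time, lowerExcess J (S i) (d i).time q := by
  refine (Finset.sum_congr rfl fun q hq => ?_).trans_le (Finset.sum_le_sum_of_subset_of_nonneg
    (fun q hq => ?_) fun q _ _ => lowerExcess_nonneg _ _ _ _)
  all_goals obtain ⟨hqo, hts⟩ := Finset.mem_filter.1 hq
  · rw [excess, lowerExcess, ho.upper_eq q (mem_eligible.1 (mem_outer.1 hqo).1).1 _ hts]
  · exact mem_lateRequests.2 ⟨(mem_outer.1 hqo).1, hts⟩

theorem IsConfined.isHeavy {a i : ℕ} {l : List X} (hc : IsConfined J s S d σ ts a i i l)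
    (hlate : 4 * ∑ q ∈ outer J (S i) (d i).time (d i).level with (d i).time < ts q,
      excess J (S i) (d i).time q < ∑ q ∈ outer J (S i) (d i).time (d i).level,
        excess J (S i) (d i).time q) {p : X} (hp : p ∈ l) :
    IsHeavy J (S i) (d i).time (d i).level p := by
  have hsplit := Finset.sum_filter_add_sum_filter_not (outer J (S i) (d i).time (d i).level)
    (fun q => (d i).time < ts q) (excess J (S i) (d i).time)
  have hnear : ∑ q ∈ outer J (S i) (d i).time (d i).level with ¬ (d i).time < ts q,
      excess J (S i) (d i).time q ≤
      ∑ q ∈ outer J (S i) (d i).time (d i).level with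
        dist p (J q).location ≤ 2 ^ (d i).level / 32, excess J (S i) (d i).time q := by
    refine Finset.sum_le_sum_of_subset_of_nonneg (fun q hq => ?_)
      fun q _ _ => excess_nonneg _ _ _ _
    obtain ⟨hqo, hts⟩ := Finset.mem_filter.1 hq
    exact Finset.mem_filter.2 ⟨hqo, (dist_le_tour hp (hc.location_mem q (mem_outer.1 hqo).1
      (not_lt.1 hts))).trans hc.tour_le⟩
  rw [IsHeavy]
  linarith

theorem IsConfined.le_dist (h : IsExecution J s S d m) {a j i q : ℕ} (hj : j ≤ i) (hi : i < m)
    {l : List X} (hc : IsConfined J s S d σ ts a i i l)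
    (hq : q ∈ outer J (S i) (d i).time (d i).level) (hts : ts q ≤ (d i).time)
    (hr : (J q).release ≤ (d j).time) (hreach : (S i).reach J q = dist (S j).pos (J q).location) :
    2 ^ ((d i).level - 2) ≤ dist (S j).pos (posAt s σ.moves (S (j + 1)).time) := by
  obtain ⟨hel, hgt⟩ := mem_outer.1 hq
  have hposAt : posAt s σ.moves (S (j + 1)).time ∈ l := by
    refine hc.posAt_mem _ ⟨?_, h.time_mono (Nat.succ_le_succ hj) hi⟩
    rw [h.time_succ (hj.trans_lt hi)]
    exact (hc.lt_release q hel).le.trans (WithBot.coe_le_coe.2 hr)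
  have hdist := (dist_le_tour (a := posAt s σ.moves (S a).time) hposAt
    (hc.location_mem q hel hts)).trans hc.tour_le
  have hquarter : (2 : ℝ) ^ ((d i).level - 2) = 2 ^ (d i).level / 4 := by
    rw [zpow_sub₀ two_ne_zero]; norm_num
  rw [hreach, zpow_sub_one₀ two_ne_zero] at hgt
  have hpos : (0 : ℝ) < 2 ^ (d i).level := by positivity
  linarith [dist_triangle (S j).pos (posAt s σ.moves (S (j + 1)).time) (J q).location]

/- If most of the weight is on requests which `σ` has served, then these requests are close to the
server of `σ`, and the server relocates to them. -/
theorem IsConfined.isDelayCharged_or_isApproach (h : IsExecution J s S d m)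
    (ho : IsOffline J s σ ts Y) {a i : ℕ} (hi : i < m) (hai : a ≤ i) {l : List X}
    (hc : IsConfined J s S d σ ts a i i l)
    (hnear : ∀ q ∈ outer J (S i) (d i).time (d i).level, 0 < excess J (S i) (d i).time q →
      ∃ j ≤ i, (J q).release ≤ (d j).time ∧ (S i).reach J q = dist (S j).pos (J q).location) :
    IsDelayCharged J S d ts i ∨ ∃ j, IsApproach J s S d σ j i := by
  have hs := h.isService i hi
  have hhalf := hs.le_sum_outer
  rw [zpow_sub_one₀ two_ne_zero] at hhalf
  have hpos : (0 : ℝ) < 2 ^ (d i).level := by positivity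
  by_cases hlate : ∑ q ∈ outer J (S i) (d i).time (d i).level, excess J (S i) (d i).time q ≤
      4 * ∑ q ∈ outer J (S i) (d i).time (d i).level with (d i).time < ts q,
        excess J (S i) (d i).time q
  · refine Or.inl ?_
    rw [IsDelayCharged]
    linarith [ho.sum_outer_late_le (S := S) (d := d) i]
  refine Or.inr ?_
  rw [not_le] at hlate
  have hheavy := hc.isHeavy hlate (hc.posAt_mem (S (i + 1)).time
    ⟨h.time_mono (hai.trans (Nat.le_succ i)) hi, le_rfl⟩)
  have hdist := (hs.target_spec.resolve_right fun hno => hno.2 _ hheavy).dist_le hheavy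
    (by linarith)
  obtain ⟨q, hq, hts, hex⟩ : ∃ q ∈ outer J (S i) (d i).time (d i).level,
      ts q ≤ (d i).time ∧ 0 < excess J (S i) (d i).time q := by
    by_contra! hzero
    have hsum : ∑ q ∈ outer J (S i) (d i).time (d i).level with (d i).time < ts q,
        excess J (S i) (d i).time q =
        ∑ q ∈ outer J (S i) (d i).time (d i).level, excess J (S i) (d i).time q :=
      Finset.sum_filter_of_ne fun q hq hne => not_le.1 fun hts =>
        hne ((hzero q hq hts).antisymm (excess_nonneg _ _ _ _))
    linarith
  obtain ⟨j, hj, hr, hreach⟩ := hnear q hq hex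
  exact ⟨j, hj, ⟨q, (mem_outer.1 hq).1, hr⟩, hc.le_dist h hj hi hq hts hr hreach,
    by rwa [h.pos_succ hi]⟩

theorem IsExecution.exists_charge (h : IsExecution J s S d m) (ho : IsOffline J s σ ts Y)
    {i : ℕ} (hi : i < m) :
    IsMovementCharged s S d σ Y i i ∨ IsDelayCharged J S d ts i ∨
      (∃ j, IsParent d j i ∧ IsMovementCharged s S d σ Y j i) ∨
      (∃ j, IsParent d j i ∧ IsParentDelayCharged J S d ts j i) ∨
      ∃ j, IsApproach J s S d σ j i := by
  by_cases hleft : ∃ q ∈ outer J (S i) (d i).time (d i).level,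
      0 < excess J (S i) (d i).time q ∧ ∃ j, IsLeftover J S d j i q
  · obtain ⟨q, hq, hex, j, hl⟩ := hleft
    have hp := hl.isParent h hi hq
    rcases h.isMovementCharged_or_isConfined ho hl.lt.le hi with hcharge | ⟨a, haj, l, hc⟩
    · exact Or.inr (Or.inr (Or.inl ⟨j, hp, hcharge⟩))
    · exact Or.inr (Or.inr (Or.inr (Or.inl ⟨j, hp, hc.isParentDelayCharged h ho hi hp
        ⟨q, hl.mem⟩ (hl.horizon_le hex) haj⟩)))
  · rcases h.isMovementCharged_or_isConfined ho le_rfl hi with hcharge | ⟨a, hai, l, hc⟩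
    · exact Or.inl hcharge
    · rcases hc.isDelayCharged_or_isApproach h ho hi hai fun q hq hex => by
        obtain ⟨hcard, hr, hserved, -⟩ := mem_eligible.1 (mem_outer.1 hq).1
        exact (h.exists_reach_eq_or_isLeftover hi hcard hr hserved).resolve_right
          fun hl => hleft ⟨q, hq, hex, hl⟩ with hcharge | happroach
      · exact Or.inr (Or.inl hcharge)
      · exact Or.inr (Or.inr (Or.inr (Or.inr happroach)))

end Charging

/-! ### Summing the charges -/

section Sums

variable {ι : Type*} [LinearOrder ι]

/-- Indices which hold at the same time have different levels. -/
theorem sum_filter_le_sum_image (F : Finset ι) (p : ι → Prop) [DecidablePred p] (ℓ : ι → ℤ)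
    (f : ℤ → ℝ) (hf : ∀ j, 0 ≤ f j)
    (hp : ∀ i ∈ F, ∀ j ∈ F, i < j → ℓ i = ℓ j → p i → ¬ p j) :
    ∑ i ∈ F with p i, f (ℓ i) ≤ ∑ j ∈ F.image ℓ, f j := by
  have hinj : Set.InjOn ℓ (F.filter p) := by
    intro i hi j hj hij
    obtain ⟨hi, hpi⟩ := Finset.mem_filter.1 (Finset.mem_coe.1 hi)
    obtain ⟨hj, hpj⟩ := Finset.mem_filter.1 (Finset.mem_coe.1 hj)
    rcases lt_trichotomy i j with h | h | h
    · exact absurd hpj (hp i hi j hj h hij hpi)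
    · exact h
    · exact absurd hpi (hp j hj i hi h hij.symm hpj)
  rw [← Finset.sum_image (f := f) hinj]
  exact Finset.sum_le_sum_of_subset_of_nonneg
    (Finset.image_subset_image (Finset.filter_subset _ _)) fun j _ _ => hf j

theorem sum_sum_length_le {X : Type*} {J : RequestSeq X} {ts : ℕ → ℝ} (F : Finset ι)
    (Q : ι → Finset ℕ) (hQ : ∀ i, ∀ q ∈ Q i, q < J.card) (a b : ι → ℕ → ℝ)
    (ha : ∀ i ∈ F, ∀ q ∈ Q i, 0 ≤ a i q)
    (hb : ∀ i ∈ F, ∀ q ∈ Q i, b i q ≤ (J q).lower (ts q))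
    (hab : ∀ i ∈ F, ∀ j ∈ F, i < j → ∀ q ∈ Q i, q ∈ Q j → b i q ≤ a j q) :
    ∑ i ∈ F, ∑ q ∈ Q i, max 0 (b i q - a i q) ≤
      ∑ q ∈ Finset.range J.card, (J q).lower (ts q) := by
  rw [Finset.sum_comm' (t' := Finset.range J.card) (s' := fun q => F.filter fun i => q ∈ Q i)]
  · refine Finset.sum_le_sum fun q _ => ?_
    have hmem : ∀ i ∈ F.filter fun i => q ∈ Q i, i ∈ F ∧ q ∈ Q i := fun i hi =>
      Finset.mem_filter.1 hi
    refine (sum_length_disjoint_intervals_le _ (fun i => a i q) (fun i => b i q)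
      ((J q).lower_nonneg _) (fun i hi => ha i (hmem i hi).1 q (hmem i hi).2)
      (fun i hi => hb i (hmem i hi).1 q (hmem i hi).2) fun i hi j hj hij =>
        hab i (hmem i hi).1 j (hmem j hj).1 hij q (hmem i hi).2 (hmem j hj).2).trans_eq
      (sub_zero _)
  · intro i q
    rw [Finset.mem_filter, Finset.mem_range]
    exact ⟨fun h => ⟨h, hQ i q h.2⟩, fun h => h.1⟩

theorem sum_filter_or_le (R : Finset ι) (w : ι → ℝ) (hw : ∀ i, 0 ≤ w i) (P Q : ι → Prop)
    [DecidablePred P] [DecidablePred Q] :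
    ∑ i ∈ R with P i ∨ Q i, w i ≤ ∑ i ∈ R with P i, w i + ∑ i ∈ R with Q i, w i := by
  rw [Finset.filter_or, ← Finset.sum_union_inter]
  exact le_add_of_nonneg_right (Finset.sum_nonneg fun i _ => hw i)

theorem sum_range_two_mul (f : ℕ → ℝ) (m : ℕ) :
    ∑ n ∈ Finset.range (2 * m), f n = ∑ j ∈ Finset.range m, (f (2 * j) + f (2 * j + 1)) := by
  induction m with
  | zero => simp
  | succ m ih =>
    rw [mul_add_one, Finset.sum_range_succ, Finset.sum_range_succ, Finset.sum_range_succ, ih,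
      add_assoc]

theorem sub_le_sum_Ico_max (u : ℕ → ℝ) {a b : ℕ} (hab : a ≤ b) :
    u a - u b ≤ ∑ n ∈ Finset.Ico a b, max 0 (u n - u (n + 1)) := by
  rw [← neg_sub, ← Finset.sum_Ico_sub u hab, ← Finset.sum_neg_distrib]
  exact Finset.sum_le_sum fun n _ => (neg_sub _ _).trans_le (le_max_right _ _)

theorem sum_max_sub_succ_le (u : ℕ → ℝ) (n : ℕ) (h : u 0 ≤ u n) :
    ∑ i ∈ Finset.range n, max 0 (u i - u (i + 1)) ≤
      ∑ i ∈ Finset.range n, max 0 (u (i + 1) - u i) := by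
  have hmax : ∀ i, max 0 (u i - u (i + 1)) = max 0 (u (i + 1) - u i) + (u i - u (i + 1)) :=
    fun i => by rw [max_add, zero_add, sub_add_sub_cancel, sub_self, max_comm]
  simp only [hmax, Finset.sum_add_distrib, Finset.sum_range_sub' u n]
  linarith

theorem band_mono (ℓ : ℤ) : Monotone (band ℓ) :=
  fun _ _ h => max_le_max le_rfl (min_le_min h le_rfl)

theorem sum_sum_max_band_sub_le (u : ℕ → ℝ) (n : ℕ) (h : u 0 ≤ u n) (Λ : Finset ℤ) :
    ∑ i ∈ Finset.range n, ∑ ℓ ∈ Λ, max 0 (band ℓ (u i) - band ℓ (u (i + 1))) ≤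
      ∑ i ∈ Finset.range n, max 0 (u (i + 1) - u i) := by
  rw [Finset.sum_comm]
  refine (Finset.sum_le_sum fun ℓ _ => sum_max_sub_succ_le (fun i => band ℓ (u i)) n
    (band_mono ℓ h)).trans ?_
  rw [Finset.sum_comm]
  exact Finset.sum_le_sum fun i _ => sum_max_band_sub_le Λ _ _

end Sums

section Summation

variable {X : Type*} [MetricSpace X] {J : RequestSeq X} {s : X} {S : ℕ → ServerState X}
  {d : ℕ → Service X} {m : ℕ} {σ : Schedule X} {ts : ℕ → ℝ} {Y : Finset X}

theorem IsExecution.sum_movementIn_le (h : IsExecution J s S d m) {N : ℕ} (hN : 0 < N)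
    (l : List (ℝ × X)) (F : Finset ℕ) (hF : ∀ i ∈ F, i < m) (a : ℕ → ℕ) (ha : ∀ i ∈ F, a i ≤ i)
    (hdisj : ∀ i ∈ F, ∀ j ∈ F, i < j → (d i).level = (d j).level → i < a j) :
    ∑ i ∈ F, movementIn (trunc N (d i).level) (Iic (S (i + 1)).time \ Iic (S (a i)).time) s l ≤
      (3 + Real.logb 2 (128 * N)) * pathLength s (l.map Prod.snd) := by
  classical
  refine sum_movementIn_le_mul_pathLength F (fun i => trunc N (d i).level)
    (fun i => Iic (S (i + 1)).time \ Iic (S (a i)).time) (fun t c hc => ?_) s l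
  simp only [indicator_apply, ← Finset.sum_filter]
  refine (sum_filter_le_sum_image F _ (fun i => (d i).level) (fun j => trunc N j c)
    (fun j => trunc_nonneg N j hc) fun i hi j hj hij hlevel hti htj => ?_).trans
    ((sum_trunc_le hN _ hc).trans_eq (mul_comm _ _))
  exact htj.2 (le_trans hti.1
    (h.time_mono (hdisj i hi j hj hij hlevel) ((ha j hj).trans (hF j hj).le)))

theorem IsExecution.sum_zpow_le_of_isMovementCharged_self (h : IsExecution J s S d m)
    (hY : 0 < Y.card) (F : Finset ℕ) (hF : ∀ i ∈ F, i < m)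
    (hcharge : ∀ i ∈ F, IsMovementCharged s S d σ Y i i) :
    ∑ i ∈ F, (2 : ℝ) ^ (d i).level ≤
      128 * ((3 + Real.logb 2 (128 * Y.card)) * σ.movementCost s) := by
  choose! a ha hbelow hcharge using hcharge
  refine (Finset.sum_le_sum hcharge).trans ?_
  rw [← Finset.mul_sum, σ.movementCost_eq_pathLength]
  refine mul_le_mul_of_nonneg_left ?_ (by norm_num)
  refine h.sum_movementIn_le hY _ F hF a ha fun i _ j hj hij hlevel => ?_
  by_contra hle
  exact (hbelow j hj i (not_lt.1 hle) hij).ne hlevel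

theorem IsExecution.sum_zpow_le_of_isMovementCharged_parent (h : IsExecution J s S d m)
    (hY : 0 < Y.card) (F : Finset ℕ) (hF : ∀ i ∈ F, i < m)
    (hcharge : ∀ i ∈ F, ∃ j, IsParent d j i ∧ IsMovementCharged s S d σ Y j i) :
    ∑ i ∈ F, (2 : ℝ) ^ (d i).level ≤
      128 * ((3 + Real.logb 2 (128 * Y.card)) * σ.movementCost s) := by
  choose! p hp a ha hbelow hcharge using hcharge
  refine (Finset.sum_le_sum hcharge).trans ?_
  rw [← Finset.mul_sum, σ.movementCost_eq_pathLength]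
  refine mul_le_mul_of_nonneg_left ?_ (by norm_num)
  refine h.sum_movementIn_le hY _ F hF a (fun i hi => (ha i hi).trans (hp i hi).lt.le)
    fun i hi j hj hij hlevel => ?_
  have hparent := (hp j hj).level_eq
  by_contra hle
  rcases lt_trichotomy i (p j) with hlt | rfl | hlt
  · have := hbelow j hj i (not_lt.1 hle) hlt
    omega
  · omega
  · have := (hp j hj).levelsBelow i hlt hij
    omega

theorem IsExecution.sum_zpow_le_of_isDelayCharged (h : IsExecution J s S d m) (F : Finset ℕ)
    (hF : ∀ i ∈ F, i < m) (hcharge : ∀ i ∈ F, IsDelayCharged J S d ts i) :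
    ∑ i ∈ F, (2 : ℝ) ^ (d i).level ≤ 8 * ∑ q ∈ Finset.range J.card, (J q).lower (ts q) := by
  refine (Finset.sum_le_sum hcharge).trans ?_
  rw [← Finset.mul_sum]
  refine mul_le_mul_of_nonneg_left ?_ (by norm_num)
  refine sum_sum_length_le F (fun i => lateRequests J S d ts i (d i).time)
    (fun i q hq => (mem_eligible.1 (mem_lateRequests.1 hq).1).1)
    (fun i q => (S i).paid q) (fun i q => (J q).lower (d i).time)
    (fun i hi q _ => h.paid_nonneg (hF i hi).le q)
    (fun i _ q hq => (J q).lower_mono (mem_lateRequests.1 hq).2.le)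
    fun i hi j hj hij q hq _ => ?_
  have hpaid := (h.isService i (hF i hi)).lower_le_advance_paid (mem_lateRequests.1 hq).1
  rw [← h.state_succ i (hF i hi)] at hpaid
  exact hpaid.trans (h.paid_mono hij (hF j hj).le q)

theorem IsExecution.sum_zpow_le_of_isParentDelayCharged (h : IsExecution J s S d m)
    (F : Finset ℕ) (hF : ∀ i ∈ F, i < m)
    (hcharge : ∀ i ∈ F, ∃ j, IsParent d j i ∧ IsParentDelayCharged J S d ts j i) :
    ∑ i ∈ F, (2 : ℝ) ^ (d i).level ≤ ∑ q ∈ Finset.range J.card, (J q).lower (ts q) := by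
  choose! p hp hcharge using hcharge
  refine (Finset.sum_le_sum fun i hi => (hcharge i hi).trans
    (Finset.sum_le_sum fun q _ => le_max_right 0 _)).trans ?_
  refine sum_sum_length_le F (fun i => lateRequests J S d ts (p i) (d i).time)
    (fun i q hq => (mem_eligible.1 (mem_lateRequests.1 hq).1).1)
    (fun i q => (J q).lower (d (p i)).time) (fun i q => (J q).lower (d i).time)
    (fun i _ q _ => (J q).lower_nonneg _)
    (fun i _ q hq => (J q).lower_mono (mem_lateRequests.1 hq).2.le)
    fun i hi j hj hij q hqi hqj => (J q).lower_mono ?_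
  have hqi := (mem_lateRequests.1 hqi).1
  have hqj := (mem_lateRequests.1 hqj).1
  have hpj : p j < m := (hp j hj).lt.trans (hF j hj)
  have hpi : p i < m := (hp i hi).lt.trans (hF i hi)
  have hlevel := (hp i hi).level_eq
  refine h.time_service_mono ?_ hpj
  rcases lt_trichotomy (p i) (p j) with hlt | heq | hlt
  · have hlevels := h.level_lt_level hlt hpj hqi hqj
    by_contra hle
    have := (hp i hi).levelsBelow (p j) hlt (not_le.1 hle)
    omega
  · have hilevel := (hp j hj).levelsBelow i (heq ▸ (hp i hi).lt) hij
    have hjlevel := (hp j hj).level_eq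
    rw [← heq] at hjlevel
    omega
  · have hlevels := h.level_lt_level hlt hpi hqj hqi
    have := (hp j hj).levelsBelow (p i) hlt ((hp i hi).lt.trans hij)
    have := (hp j hj).level_eq
    omega

end Summation

section Approach

variable {X : Type*} [MetricSpace X] {J : RequestSeq X} {s : X} {S : ℕ → ServerState X}
  {d : ℕ → Service X} {m : ℕ} {σ : Schedule X}

/-- The distance between the servers of the execution and of `σ`, after the first `n` steps, when
the two servers take turns: `σ` moves up to the next service, then this service takes place. -/
noncomputable def gap (s : X) (S : ℕ → ServerState X) (σ : Schedule X) (n : ℕ) : ℝ :=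
  dist (S (n / 2)).pos (posAt s σ.moves (S ((n + 1) / 2)).time)

theorem gap_two_mul (j : ℕ) :
    gap s S σ (2 * j) = dist (S j).pos (posAt s σ.moves (S j).time) := by
  rw [gap, show 2 * j / 2 = j by omega, show (2 * j + 1) / 2 = j by omega]

theorem gap_two_mul_add_one (j : ℕ) :
    gap s S σ (2 * j + 1) = dist (S j).pos (posAt s σ.moves (S (j + 1)).time) := by
  rw [gap, show (2 * j + 1) / 2 = j by omega, show (2 * j + 1 + 1) / 2 = j + 1 by omega]

theorem IsExecution.gap_zero (h : IsExecution J s S d m) : gap s S σ 0 = 0 := by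
  simp [gap, h.state_zero, ServerState.init, positionAfter, movesDuring]

theorem IsApproach.zpow_le_sum_band {i j : ℕ} (h : IsApproach J s S d σ j i) :
    (2 : ℝ) ^ (d i).level / 8 ≤ ∑ n ∈ Finset.Ico (2 * j + 1) (2 * (i + 1)),
      max 0 (band (d i).level (gap s S σ n) - band (d i).level (gap s S σ (n + 1))) := by
  have hpos : (0 : ℝ) < 2 ^ (d i).level := by positivity
  have hlower : (2 : ℝ) ^ ((d i).level - 3) = 2 ^ (d i).level / 8 := by
    rw [zpow_sub₀ two_ne_zero]; norm_num
  have hupper : (2 : ℝ) ^ ((d i).level - 2) = 2 ^ (d i).level / 4 := by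
    rw [zpow_sub₀ two_ne_zero]; norm_num
  have hfar : band (d i).level (gap s S σ (2 * j + 1)) = 2 ^ (d i).level / 4 := by
    rw [gap_two_mul_add_one, band, min_eq_right h.le_dist, hlower, hupper,
      max_eq_right (by linarith)]
  have hnear : band (d i).level (gap s S σ (2 * (i + 1))) = 2 ^ (d i).level / 8 := by
    rw [gap_two_mul, band, hlower]
    exact max_eq_left ((min_le_left _ _).trans (by linarith [h.dist_le]))
  have hij := h.le
  have hsum := sub_le_sum_Ico_max (fun n => band (d i).level (gap s S σ n))
    (show 2 * j + 1 ≤ 2 * (i + 1) by omega)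
  rw [hfar, hnear] at hsum
  linarith

/-- Approaches of the same level take place during disjoint periods. -/
theorem IsExecution.sum_sum_approach_le (h : IsExecution J s S d m) (F : Finset ℕ)
    (hF : ∀ i ∈ F, i < m) {p : ℕ → ℕ} (hp : ∀ i ∈ F, IsApproach J s S d σ (p i) i)
    (f : ℤ → ℕ → ℝ) (hf : ∀ ℓ n, 0 ≤ f ℓ n) :
    ∑ i ∈ F, ∑ n ∈ Finset.Ico (2 * p i + 1) (2 * (i + 1)), f (d i).level n ≤
      ∑ n ∈ Finset.range (2 * m), ∑ ℓ ∈ F.image fun i => (d i).level, f ℓ n := by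
  rw [Finset.sum_comm' (t' := Finset.range (2 * m))
    (s' := fun n => F.filter fun i => n ∈ Finset.Ico (2 * p i + 1) (2 * (i + 1)))]
  · refine Finset.sum_le_sum fun n _ => ?_
    refine sum_filter_le_sum_image F _ (fun i => (d i).level) (fun ℓ => f ℓ n)
      (fun ℓ => hf ℓ n) fun i hi j hj hij hlevel hni hnj => ?_
    rw [Finset.mem_Ico] at hni hnj
    obtain ⟨q, hq, hr⟩ := (hp j hj).exists_mem_eligible
    have htime := (h.lt_release_of_mem_eligible hij (hF j hj) hq hlevel.ge).trans_le hr
    have hip : i < p j := by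
      by_contra hle
      exact (h.time_service_mono (not_lt.1 hle) (hF i hi)).not_gt htime
    omega
  · intro i n
    simp only [Finset.mem_filter, Finset.mem_range, Finset.mem_Ico]
    have := hF i
    grind

open Classical in
theorem IsExecution.sum_max_gap_sub_le (h : IsExecution J s S d m) (F : Finset ℕ)
    (hF : ∀ i ∈ F, i < m) (hnear : ∀ i ∈ F,
      dist (S (i + 1)).pos (posAt s σ.moves (S (i + 1)).time) ≤ 2 ^ (d i).level / 16) :
    ∑ n ∈ Finset.range (2 * m), max 0 (gap s S σ (n + 1) - gap s S σ n) ≤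
      σ.movementCost s + ((∑ i ∈ F, (2 : ℝ) ^ (d i).level) / 16 +
        2 * ∑ i ∈ Finset.range m with i ∉ F, (2 : ℝ) ^ (d i).level) := by
  have hoffline : ∑ j ∈ Finset.range m, max 0 (gap s S σ (2 * j + 1) - gap s S σ (2 * j)) ≤
      σ.movementCost s := by
    rw [σ.movementCost_eq_pathLength]
    refine (Finset.sum_le_sum fun j _ => ?_).trans (sum_dist_posAt_le σ.chronological s
      (fun i => (S i).time) m fun i hi => h.time_mono (Nat.le_succ i) hi)
    rw [gap_two_mul, gap_two_mul_add_one]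
    exact max_le dist_nonneg (sub_le_iff_le_add'.2 (dist_triangle _ _ _))
  have hservice : ∀ j ∈ Finset.range m,
      max 0 (gap s S σ (2 * j + 1 + 1) - gap s S σ (2 * j + 1)) ≤
        if j ∈ F then 2 ^ (d j).level / 16 else 2 * 2 ^ (d j).level := by
    intro j hj
    rw [gap_two_mul_add_one, show 2 * j + 1 + 1 = 2 * (j + 1) by ring, gap_two_mul]
    split_ifs with hjF
    · exact max_le (by positivity) ((sub_le_self _ dist_nonneg).trans (hnear j hjF))
    · have hjm := Finset.mem_range.1 hj
      have htarget := (h.isService j hjm).dist_target_le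
      rw [← h.pos_succ hjm] at htarget
      refine max_le (by positivity) ?_
      linarith [dist_triangle_left (S (j + 1)).pos (posAt s σ.moves (S (j + 1)).time) (S j).pos]
  have hfilter : (Finset.range m).filter (· ∈ F) = F := by
    ext j
    simpa using hF j
  rw [sum_range_two_mul, Finset.sum_add_distrib]
  refine add_le_add hoffline ((Finset.sum_le_sum hservice).trans_eq ?_)
  rw [Finset.sum_ite, hfilter, Finset.sum_div, Finset.mul_sum]

open Classical in
/-- The gap between the servers can only decrease as much as it has increased before, and it
increases only by movements of `σ` and by services which do not bring the servers together. -/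
theorem IsExecution.sum_zpow_le_of_isApproach (h : IsExecution J s S d m) (F : Finset ℕ)
    (hF : ∀ i ∈ F, i < m) (happroach : ∀ i ∈ F, ∃ j, IsApproach J s S d σ j i) :
    ∑ i ∈ F, (2 : ℝ) ^ (d i).level ≤ 16 * σ.movementCost s +
      32 * ∑ i ∈ Finset.range m with i ∉ F, (2 : ℝ) ^ (d i).level := by
  choose! p hp using happroach
  have hgap : gap s S σ 0 ≤ gap s S σ (2 * m) := h.gap_zero.trans_le dist_nonneg
  have hsum : ∑ i ∈ F, (2 : ℝ) ^ (d i).level / 8 ≤ σ.movementCost s +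
      ((∑ i ∈ F, (2 : ℝ) ^ (d i).level) / 16 +
        2 * ∑ i ∈ Finset.range m with i ∉ F, (2 : ℝ) ^ (d i).level) :=
    calc ∑ i ∈ F, (2 : ℝ) ^ (d i).level / 8
        ≤ _ := Finset.sum_le_sum fun i hi => (hp i hi).zpow_le_sum_band
      _ ≤ _ := h.sum_sum_approach_le F hF hp
          (fun ℓ n => max 0 (band ℓ (gap s S σ n) - band ℓ (gap s S σ (n + 1))))
          fun _ _ => le_max_left _ _
      _ ≤ _ := sum_sum_max_band_sub_le (gap s S σ) (2 * m) hgap _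
      _ ≤ _ := h.sum_max_gap_sub_le F hF fun i hi => (hp i hi).dist_le
  rw [← Finset.sum_div] at hsum
  linarith

end Approach

section Total

variable {X : Type*} [MetricSpace X] {J : RequestSeq X} {s : X} {S : ℕ → ServerState X}
  {d : ℕ → Service X} {m : ℕ} {σ : Schedule X} {ts : ℕ → ℝ} {Y : Finset X}

open Classical in
theorem IsExecution.sum_zpow_not_approach_le (h : IsExecution J s S d m)
    (ho : IsOffline J s σ ts Y) :
    ∑ i ∈ Finset.range m with ¬ ∃ j, IsApproach J s S d σ j i, (2 : ℝ) ^ (d i).level ≤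
      256 * ((3 + Real.logb 2 (128 * Y.card)) * σ.movementCost s) +
        9 * ∑ q ∈ Finset.range J.card, (J q).lower (ts q) := by
  have hY : 0 < Y.card := Finset.card_pos.2 ⟨s, ho.start_mem⟩
  have hw : ∀ i, (0 : ℝ) ≤ 2 ^ (d i).level := fun i => by positivity
  have hlt : ∀ P : ℕ → Prop, ∀ i ∈ (Finset.range m).filter P, i < m := fun P i hi =>
    Finset.mem_range.1 (Finset.mem_filter.1 hi).1
  have hmem : ∀ P : ℕ → Prop, ∀ i ∈ (Finset.range m).filter P, P i := fun P i hi =>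
    (Finset.mem_filter.1 hi).2
  set P₁ : ℕ → Prop := fun i => IsMovementCharged s S d σ Y i i
  set P₂ : ℕ → Prop := fun i => IsDelayCharged J S d ts i
  set P₃ : ℕ → Prop := fun i => ∃ j, IsParent d j i ∧ IsMovementCharged s S d σ Y j i
  set P₄ : ℕ → Prop := fun i => ∃ j, IsParent d j i ∧ IsParentDelayCharged J S d ts j i
  have hcover : (Finset.range m).filter (fun i => ¬ ∃ j, IsApproach J s S d σ j i) ⊆
      (Finset.range m).filter fun i => P₁ i ∨ P₂ i ∨ P₃ i ∨ P₄ i := fun i hi => by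
    obtain ⟨hi, hfar⟩ := Finset.mem_filter.1 hi
    have hcases : P₁ i ∨ P₂ i ∨ P₃ i ∨ P₄ i ∨ ∃ j, IsApproach J s S d σ j i :=
      h.exists_charge ho (Finset.mem_range.1 hi)
    exact Finset.mem_filter.2 ⟨hi, by simpa only [hfar, or_false] using hcases⟩
  have hsum := Finset.sum_le_sum_of_subset_of_nonneg hcover fun i _ _ => hw i
  linarith [sum_filter_or_le (Finset.range m) _ hw P₁ fun i => P₂ i ∨ P₃ i ∨ P₄ i,
    sum_filter_or_le (Finset.range m) _ hw P₂ fun i => P₃ i ∨ P₄ i,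
    sum_filter_or_le (Finset.range m) _ hw P₃ P₄,
    h.sum_zpow_le_of_isMovementCharged_self hY _ (hlt P₁) (hmem P₁),
    h.sum_zpow_le_of_isDelayCharged _ (hlt P₂) (hmem P₂),
    h.sum_zpow_le_of_isMovementCharged_parent hY _ (hlt P₃) (hmem P₃),
    h.sum_zpow_le_of_isParentDelayCharged _ (hlt P₄) (hmem P₄)]

theorem IsExecution.sum_zpow_level_le (h : IsExecution J s S d m) (ho : IsOffline J s σ ts Y) :
    ∑ i ∈ Finset.range m, (2 : ℝ) ^ (d i).level ≤
      8464 * (3 + Real.logb 2 (128 * Y.card)) *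
        (σ.movementCost s + ∑ q ∈ Finset.range J.card, (J q).lower (ts q)) := by
  classical
  have hY : (1 : ℝ) ≤ Y.card := by exact_mod_cast Finset.card_pos.2 ⟨s, ho.start_mem⟩
  have hlog : 0 ≤ Real.logb 2 (128 * Y.card) := Real.logb_nonneg one_lt_two (by linarith)
  have hmove := σ.movementCost_nonneg s
  have hdelay : 0 ≤ ∑ q ∈ Finset.range J.card, (J q).lower (ts q) :=
    Finset.sum_nonneg fun q _ => (J q).lower_nonneg _
  have hrest := h.sum_zpow_not_approach_le ho
  have happroach := h.sum_zpow_le_of_isApproach (σ := σ)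
    ((Finset.range m).filter fun i => ∃ j, IsApproach J s S d σ j i)
    (fun i hi => Finset.mem_range.1 (Finset.mem_filter.1 hi).1)
    fun i hi => (Finset.mem_filter.1 hi).2
  rw [show (Finset.range m).filter (fun i => i ∉ (Finset.range m).filter fun i =>
      ∃ j, IsApproach J s S d σ j i) = (Finset.range m).filter fun i =>
      ¬ ∃ j, IsApproach J s S d σ j i from Finset.filter_congr fun i hi => by simp [hi]]
    at happroach
  rw [← Finset.sum_filter_add_sum_filter_not (Finset.range m) fun i =>
    ∃ j, IsApproach J s S d σ j i]
  generalize Real.logb 2 (128 * (Y.card : ℝ)) = K at hlog hrest ⊢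
  nlinarith [mul_nonneg hlog hmove, mul_nonneg hlog hdelay]

end Total

/-! ### The competitive ratio -/

section CompetitiveRatio

variable {X : Type*}

theorem Schedule.serviceTime_le {σ : Schedule X} {s : X} {q : Request X} {t : ℝ}
    (h : t ∈ σ.visitTimes s q) : σ.serviceTime s q ≤ t :=
  csInf_le ⟨q.release, fun _ hu => hu.1⟩ h

open Classical in
/-- The points which matter for the input: the locations of the requests, and the start `s`. -/
noncomputable def RequestSeq.points (J : RequestSeq X) (s : X) : Finset X :=
  insert s ((Finset.range J.card).image fun q => (J q).location)

variable {J : RequestSeq X} {s : X} {σ : Schedule X}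

theorem RequestSeq.card_points_le [Fintype X] :
    (J.points s).card ≤ min (Fintype.card X) J.card + 1 := by
  classical
  refine (le_min ((Finset.card_le_univ _).trans (Nat.le_succ _)) ?_).trans_eq
    (min_add_add_right _ _ 1)
  exact (Finset.card_insert_le _ _).trans
    (Nat.succ_le_succ (Finset.card_image_le.trans_eq (Finset.card_range _)))

open Classical in
theorem isOffline_restrict_points
    (hvisit : ∀ q < J.card, (σ.visitTimes s (J q).toRequest).Nonempty)
    (hupper : ∀ q < J.card, ∀ t < σ.serviceTime s (J q).toRequest,
      (J q).upper t = (J q).lower t) :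
    IsOffline J s (σ.restrict (J.points s)) (fun q => σ.serviceTime s (J q).toRequest)
      (J.points s) where
  release_le q hq := (σ.serviceTime_mem s _ (hvisit q hq)).1
  visitsAt q hq := (σ.serviceTime_mem s _ (hvisit q hq)).2.restrict
    (Finset.mem_insert_of_mem (Finset.mem_image_of_mem _ (Finset.mem_range.2 hq)))
  upper_eq := hupper
  start_mem := Finset.mem_insert_self _ _
  moves_mem _ hm := (Schedule.mem_restrict_moves.1 hm).2

variable [MetricSpace X]

/-- The cost of a schedule which serves all requests. -/
noncomputable def RequestSeq.cost (J : RequestSeq X) (s : X) (σ : Schedule X) : ℝ :=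
  σ.movementCost s + ∑ q ∈ Finset.range J.card, (J q).lower (σ.serviceTime s (J q).toRequest)

theorem RequestSeq.cost_nonneg : 0 ≤ J.cost s σ :=
  add_nonneg (σ.movementCost_nonneg s) (Finset.sum_nonneg fun q _ => (J q).lower_nonneg _)

theorem IsExecution.cost_le {S : ℕ → ServerState X} {d : ℕ → Service X} {m : ℕ}
    (h : IsExecution J s S d m) (hσ : σ.moves = (S m).moves)
    (hm : ¬ ∃ t, Triggered J (S m) t) :
    J.cost s σ ≤ 19 * ∑ i ∈ Finset.range m, (2 : ℝ) ^ (d i).level := by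
  have hmove : σ.movementCost s ≤ 10 * ∑ i ∈ Finset.range m, (2 : ℝ) ^ (d i).level := by
    rw [σ.movementCost_eq_pathLength, hσ]
    exact h.pathLength_moves_le le_rfl
  have hdelay : ∑ q ∈ Finset.range J.card, (J q).lower (σ.serviceTime s (J q).toRequest) ≤
      9 * ∑ i ∈ Finset.range m, (2 : ℝ) ^ (d i).level := by
    refine (Finset.sum_le_sum fun q hq => ?_).trans (h.sum_paid_le le_rfl)
    obtain ⟨t, hr, hvisit, hpaid⟩ := h.exists_visit_of_not_triggered hm hσ (Finset.mem_range.1 hq)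
    exact ((J q).lower_mono (Schedule.serviceTime_le ⟨hr, hvisit⟩)).trans hpaid
  rw [RequestSeq.cost]
  linarith

theorem logb_two_le {c μ : ℕ} (hc : 0 < c) (h : c ≤ μ + 1) :
    Real.logb 2 c ≤ 1 + 2 * Real.log μ := by
  rcases Nat.eq_zero_or_pos μ with rfl | hμ
  · obtain rfl : c = 1 := by omega
    simp
  have hμ' : (1 : ℝ) ≤ μ := by exact_mod_cast hμ
  have hcμ : (c : ℝ) ≤ 2 * μ := by
    have : (c : ℝ) ≤ μ + 1 := by exact_mod_cast h
    linarith
  calc Real.logb 2 c ≤ Real.logb 2 (2 * μ) :=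
        Real.logb_le_logb_of_le one_lt_two (by exact_mod_cast hc) hcμ
    _ = 1 + Real.logb 2 μ := by
        rw [Real.logb_mul two_ne_zero (by positivity), Real.logb_self_eq_one one_lt_two]
    _ ≤ 1 + 2 * Real.log μ := by
        rw [Real.logb, add_le_add_iff_left, div_le_iff₀ (Real.log_pos one_lt_two)]
        nlinarith [Real.log_two_gt_d9, Real.log_nonneg hμ']

theorem three_add_logb_le {c μ : ℕ} (hc : 0 < c) (h : c ≤ μ + 1) :
    3 + Real.logb 2 (128 * c) ≤ 11 * (1 + Real.log μ) := by
  have hlogb : Real.logb 2 128 = 7 := by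
    rw [show (128 : ℝ) = 2 ^ (7 : ℝ) by norm_num]
    exact Real.logb_rpow two_pos one_lt_two.ne'
  rw [Real.logb_mul (by norm_num) (by positivity), hlogb]
  linarith [logb_two_le hc h, Real.log_natCast_nonneg μ]

theorem cost_generalSchedule_le [Fintype X] (J : RequestSeq X) (s : X) (σ : Schedule X)
    (hvisit : ∀ q < J.card, (σ.visitTimes s (J q).toRequest).Nonempty)
    (hupper : ∀ q < J.card, ∀ t < σ.serviceTime s (J q).toRequest,
      (J q).upper t = (J q).lower t) :
    J.cost s (generalSchedule J s) ≤
      2000000 * (1 + Real.log (min (Fintype.card X) J.card : ℕ)) * J.cost s σ := by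
  obtain ⟨S, d, m, h, hmoves, hm⟩ := exists_complete_isExecution J s
  set μ := min (Fintype.card X) J.card
  have hμ : 0 ≤ 1 + Real.log μ := add_nonneg zero_le_one (Real.log_natCast_nonneg _)
  have hoffline := isOffline_restrict_points hvisit hupper
  have hratio := three_add_logb_le (Finset.card_pos.2 ⟨s, hoffline.start_mem⟩)
    (RequestSeq.card_points_le (J := J) (s := s))
  have hrestrict : (σ.restrict (J.points s)).movementCost s +
      ∑ q ∈ Finset.range J.card, (J q).lower (σ.serviceTime s (J q).toRequest) ≤ J.cost s σ :=
    add_le_add_left (σ.movementCost_restrict_le _ s) _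
  calc J.cost s (generalSchedule J s)
      ≤ 19 * ∑ i ∈ Finset.range m, (2 : ℝ) ^ (d i).level := h.cost_le hmoves hm
    _ ≤ 19 * (8464 * (3 + Real.logb 2 (128 * (J.points s).card)) * _) := by
        gcongr
        exact h.sum_zpow_level_le hoffline
    _ ≤ 19 * (8464 * (11 * (1 + Real.log μ)) * J.cost s σ) := by
        gcongr
        exact add_nonneg ((σ.restrict _).movementCost_nonneg s)
          (Finset.sum_nonneg fun q _ => (J q).lower_nonneg _)
    _ ≤ 2000000 * (1 + Real.log μ) * J.cost s σ := by
        linarith [mul_nonneg hμ (RequestSeq.cost_nonneg (J := J) (s := s) (σ := σ))]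

theorem exists_mem_visitTimes_generalSchedule [Finite X] {Γ : ℝ} (hΓ : IsExtentBound X Γ)
    (J : RequestSeq X) (s : X) {q : ℕ} (hq : q < J.card) :
    ∃ t ∈ (generalSchedule J s).visitTimes s (J q).toRequest, (J q).lower t ≤ 36 * Γ := by
  obtain ⟨S, d, m, h, hmoves, hm⟩ := exists_complete_isExecution J s
  obtain ⟨t, hr, hvisit, hpaid⟩ := h.exists_visit_of_not_triggered hm hmoves hq
  exact ⟨t, ⟨hr, hvisit⟩, hpaid.trans (h.paid_le hΓ le_rfl q)⟩

end CompetitiveRatio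

/-! ### Lists of requests -/

section Lists

/-- A request which nobody makes, to extend a list of requests to a sequence. -/
def fillRequest {X : Type*} (s : X) : GeneralRequest X where
  location := s
  release := 0
  lower t := max t 0
  upper t := max t 0
  lower_mono := monotone_id.max monotone_const
  upper_mono := monotone_id.max monotone_const
  lower_le_upper _ := le_rfl
  upper_le_lower _ _ h := max_le_max_right 0 h.le
  lower_eq_zero _ h := max_eq_right h
  upper_eq_zero _ h := max_eq_right h.le
  lower_lsc := (continuous_id.max continuous_const).lowerSemicontinuous
  upper_usc := (continuous_id.max continuous_const).upperSemicontinuous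
  upper_unbounded c := ⟨c, le_max_left _ _⟩

variable {X Q : Type*} {rel : Q → ℝ}

/-- The requests of a list, translated by `f`, as a sequence. -/
def requestSeq (f : Q → GeneralRequest X) (s : X) (l : List Q) : RequestSeq X :=
  ⟨l.length, fun i => (l[i]?.map f).getD (fillRequest s)⟩

theorem requestSeq_apply (f : Q → GeneralRequest X) (s : X) {l : List Q} {i : ℕ}
    (hi : i < l.length) : requestSeq f s l i = f l[i] := by
  simp [requestSeq, hi]

theorem forall_lt_card_requestSeq {f : Q → GeneralRequest X} {s : X} {l : List Q}
    {p : GeneralRequest X → Prop} :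
    (∀ i < (requestSeq f s l).card, p (requestSeq f s l i)) ↔ ∀ q ∈ l, p (f q) := by
  rw [List.forall_mem_iff_getElem]
  exact forall₂_congr fun i hi => by rw [requestSeq_apply f s hi]

theorem getElem?_filter_of_pairwise {l : List Q} (hl : l.Pairwise fun q q' => rel q ≤ rel q')
    (t : ℝ) (i : ℕ) : (l.filter fun q => decide (rel q ≤ t))[i]? =
      l[i]?.filter fun q => decide (rel q ≤ t) := by
  induction l generalizing i with
  | nil => simp
  | cons a l ih =>
    obtain ⟨ha, hl⟩ := List.pairwise_cons.1 hl
    by_cases hat : rel a ≤ t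
    · rw [List.filter_cons_of_pos (by simpa using hat)]
      cases i with
      | zero => simp [Option.filter, hat]
      | succ i => simpa using ih hl i
    · have hlate : ∀ b ∈ a :: l, ¬ rel b ≤ t :=
        List.forall_mem_cons.2 ⟨hat, fun b hb hbt => hat ((ha b hb).trans hbt)⟩
      rw [List.filter_eq_nil_iff.2 fun b hb => by simpa using hlate b hb, List.getElem?_nil,
        eq_comm, Option.filter_eq_none_iff]
      exact fun b hb => by simpa using hlate b (List.mem_of_getElem? hb)

theorem agree_requestSeq {f : Q → GeneralRequest X} (hf : ∀ q, (f q).release = rel q) (s : X)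
    {I I' : Input Q rel} {t : ℝ} (h : I.upTo t = I'.upTo t) :
    Agree t (requestSeq f s I.requests) (requestSeq f s I'.requests) := by
  have hfilter : ∀ i : ℕ, I.requests[i]?.filter (fun q => decide (rel q ≤ t)) =
      I'.requests[i]?.filter (fun q => decide (rel q ≤ t)) := fun i => by
    rw [← getElem?_filter_of_pairwise I.sorted, ← getElem?_filter_of_pairwise I'.sorted]
    exact congrArg (fun l : List Q => l[i]?) h
  have hreleased : ∀ (I : Input Q rel) (i : ℕ), (i < (requestSeq f s I.requests).card ∧
      (requestSeq f s I.requests i).release ≤ t) ↔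
      ∃ q, I.requests[i]?.filter (fun q => decide (rel q ≤ t)) = some q := by
    intro I i
    by_cases hi : i < I.requests.length
    · rw [requestSeq_apply f s hi, hf]
      simp [requestSeq, hi]
    · simp [requestSeq, hi]
  refine ⟨fun i => by rw [hreleased, hreleased, hfilter], fun i hi hr => ?_⟩
  obtain ⟨q, hq⟩ := (hreleased I i).1 ⟨hi, hr⟩
  have hI := (Option.filter_eq_some_iff.1 hq).1
  have hI' := (Option.filter_eq_some_iff.1 ((hfilter i).symm.trans hq)).1
  simp only [requestSeq, hI, hI']

variable [MetricSpace X]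

/-- The online algorithm for requests which `f` translates to general requests. -/
noncomputable def generalAlgorithm [Finite X] (f : Q → GeneralRequest X)
    (hf : ∀ q, (f q).release = rel q) (s : X) : OnlineAlgorithm X Q rel where
  run I := generalSchedule (requestSeq f s I.requests) s
  causal _ _ _ h := (agree_requestSeq hf s h).upTo_generalSchedule_eq s
    (exists_nextService_eq_none _ s) (exists_nextService_eq_none _ s)

theorem cost_requestSeq (f : Q → GeneralRequest X) (s : X) (l : List Q) (σ : Schedule X) :
    (requestSeq f s l).cost s σ = σ.movementCost s +
      (l.map fun q => (f q).lower (σ.serviceTime s (f q).toRequest)).sum := by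
  rw [RequestSeq.cost, Finset.sum_range, ← Fin.sum_univ_fun_getElem]
  congr 1
  exact Finset.sum_congr rfl fun i _ => by rw [requestSeq_apply f s i.2]; rfl

theorem exists_mem_visitTimes_generalAlgorithm [Finite X] {Γ : ℝ} (hΓ : IsExtentBound X Γ)
    (f : Q → GeneralRequest X) (hf : ∀ q, (f q).release = rel q) (s : X) (I : Input Q rel) :
    ∀ q ∈ I.requests, ∃ t ∈ ((generalAlgorithm f hf s).run I).visitTimes s (f q).toRequest,
      (f q).lower t ≤ 36 * Γ :=
  (forall_lt_card_requestSeq (p := fun g =>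
    ∃ t ∈ ((generalAlgorithm f hf s).run I).visitTimes s g.toRequest, g.lower t ≤ 36 * Γ)).1
    fun _ hi => exists_mem_visitTimes_generalSchedule hΓ _ s hi

theorem cost_generalAlgorithm_le [Fintype X] (f : Q → GeneralRequest X)
    (hf : ∀ q, (f q).release = rel q) (s : X) (I : Input Q rel) (σ : Schedule X)
    (hvisit : ∀ q ∈ I.requests, (σ.visitTimes s (f q).toRequest).Nonempty)
    (hupper : ∀ q ∈ I.requests, ∀ t < σ.serviceTime s (f q).toRequest,
      (f q).upper t = (f q).lower t) :
    (requestSeq f s I.requests).cost s ((generalAlgorithm f hf s).run I) ≤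
      2000000 * (1 + Real.log (min (Fintype.card X) I.numRequests : ℕ)) *
        (requestSeq f s I.requests).cost s σ :=
  cost_generalSchedule_le _ s σ
    ((forall_lt_card_requestSeq (p := fun g => (σ.visitTimes s g.toRequest).Nonempty)).2 hvisit)
    ((forall_lt_card_requestSeq (p := fun g =>
      ∀ t < σ.serviceTime s g.toRequest, g.upper t = g.lower t)).2 hupper)

end Lists

/-! ### Delay and deadlines -/

section Delay

variable {X : Type*}

/-- A request with delay as a general request, whose cost does not jump. -/
noncomputable def DelayRequest.toGeneral (q : DelayRequest X) : GeneralRequest X :=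
  have hmono : Monotone fun t => q.delay (max t q.release) := fun _ _ h =>
    q.delay_mono (mem_Ici.2 (le_max_right _ _)) (mem_Ici.2 (le_max_right _ _))
      (max_le_max_right _ h)
  have hcont : Continuous fun t => q.delay (max t q.release) :=
    q.delay_continuous.comp_continuous (continuous_id.max continuous_const)
      fun _ => mem_Ici.2 (le_max_right _ _)
  have hzero : ∀ t, t ≤ q.release → q.delay (max t q.release) = 0 := fun t h => by
    rw [max_eq_right h, q.delay_release]
  { toRequest := q.toRequest
    lower := fun t => q.delay (max t q.release)
    upper := fun t => q.delay (max t q.release)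
    lower_mono := hmono
    upper_mono := hmono
    lower_le_upper := fun _ => le_rfl
    upper_le_lower := fun _ _ h => hmono h.le
    lower_eq_zero := hzero
    upper_eq_zero := fun t h => hzero t h.le
    lower_lsc := hcont.lowerSemicontinuous
    upper_usc := hcont.upperSemicontinuous
    upper_unbounded := fun c => by
      obtain ⟨t, hc, ht⟩ := ((q.delay_tendsto.eventually_ge_atTop c).and
        (eventually_ge_atTop q.release)).exists
      exact ⟨t, by rwa [max_eq_left ht]⟩ }

theorem DelayRequest.toGeneral_release (q : DelayRequest X) : q.toGeneral.release = q.release :=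
  rfl

variable [MetricSpace X] {s : X} {I : DelayInput X} {σ : Schedule X}

theorem DelayInput.IsSolution.cost_eq (h : I.IsSolution s σ) :
    DelayInput.cost s I σ = (requestSeq DelayRequest.toGeneral s I.requests).cost s σ := by
  rw [cost_requestSeq, DelayInput.cost]
  congr 2
  refine List.map_congr_left fun q hq => ?_
  exact congrArg q.delay (max_eq_left (σ.serviceTime_mem s q.toRequest (h q hq)).1).symm

theorem exists_delayAlgorithm_isCompetitive [Fintype X] (s : X) :
    ∃ A : DelayAlgorithm X, A.IsCompetitive s fun I =>
      2000000 * (1 + Real.log (min (Fintype.card X) I.numRequests : ℕ)) := by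
  obtain ⟨Γ, hΓ⟩ := exists_isExtentBound X
  let A := generalAlgorithm DelayRequest.toGeneral DelayRequest.toGeneral_release s
  refine ⟨A, fun I => ?_⟩
  have hsol : DelayInput.IsSolution s I (A.run I) := fun q hq =>
    let ⟨t, ht, _⟩ := exists_mem_visitTimes_generalAlgorithm hΓ _ _ s I q hq
    ⟨t, ht⟩
  refine ⟨hsol, fun σ hσ => ?_⟩
  rw [hsol.cost_eq, hσ.cost_eq]
  exact cost_generalAlgorithm_le _ _ s I σ hσ fun _ _ _ _ => rfl

end Delay

section Deadline

variable {X : Type*}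

/-- A request with a deadline as a general request, whose cost jumps at the deadline from `0`
to `B`. -/
noncomputable def DeadlineRequest.toGeneral {B : ℝ} (hB : 0 ≤ B) (q : DeadlineRequest X) :
    GeneralRequest X where
  toRequest := q.toRequest
  lower t := if t ≤ q.deadline then 0 else B + (t - q.deadline)
  upper t := if t < q.deadline then 0 else B + (t - q.deadline)
  lower_mono a b h := by dsimp only; split_ifs <;> linarith
  upper_mono a b h := by dsimp only; split_ifs <;> linarith
  lower_le_upper t := by split_ifs <;> linarith
  upper_le_lower a b h := by split_ifs <;> linarith
  lower_eq_zero t h := if_pos (h.trans q.release_le_deadline)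
  upper_eq_zero t h := if_pos (h.trans_le q.release_le_deadline)
  lower_lsc t y hy := by
    dsimp only at hy ⊢
    split_ifs at hy with ht
    · refine Eventually.of_forall fun u => ?_
      split_ifs <;> linarith
    · have hnhds : ∀ᶠ u in nhds t, y < B + (u - q.deadline) :=
        (by fun_prop : Continuous fun u => B + (u - q.deadline)).continuousAt.eventually
          (lt_mem_nhds hy)
      filter_upwards [hnhds, lt_mem_nhds (not_le.1 ht)] with u hu hlate
      rwa [if_neg (not_le.2 hlate)]
  upper_usc t y hy := by
    dsimp only at hy ⊢
    split_ifs at hy with ht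
    · filter_upwards [gt_mem_nhds ht] with u hu
      rwa [if_pos hu]
    · have hnhds : ∀ᶠ u in nhds t, B + (u - q.deadline) < y :=
        (by fun_prop : Continuous fun u => B + (u - q.deadline)).continuousAt.eventually
          (gt_mem_nhds hy)
      filter_upwards [hnhds] with u hu
      split_ifs <;> linarith
  upper_unbounded c := by
    refine ⟨q.deadline + max c 0, ?_⟩
    rw [if_neg (by linarith [le_max_right c 0])]
    linarith [le_max_left c 0]

theorem DeadlineRequest.toGeneral_release {B : ℝ} (hB : 0 ≤ B) (q : DeadlineRequest X) :
    (q.toGeneral hB).release = q.release :=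
  rfl

theorem DeadlineRequest.le_deadline_of_lower_le {B : ℝ} (hB : 0 ≤ B) (q : DeadlineRequest X)
    {t : ℝ} (h : (q.toGeneral hB).lower t ≤ B) : t ≤ q.deadline := by
  by_contra hlate
  simp only [toGeneral, if_neg hlate] at h
  linarith

variable {s : X} {I : DeadlineInput X} {σ : Schedule X}

theorem DeadlineInput.IsSolution.serviceTime_le_deadline (h : I.IsSolution s σ)
    {q : DeadlineRequest X} (hq : q ∈ I.requests) : σ.serviceTime s q.toRequest ≤ q.deadline :=
  let ⟨_, ht, htd⟩ := h q hq
  (Schedule.serviceTime_le ht).trans htd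

variable [MetricSpace X]

theorem DeadlineInput.IsSolution.cost_eq (h : I.IsSolution s σ) {B : ℝ} (hB : 0 ≤ B) :
    (requestSeq (DeadlineRequest.toGeneral hB) s I.requests).cost s σ = σ.movementCost s := by
  rw [cost_requestSeq, add_eq_left]
  refine List.sum_eq_zero fun x hx => ?_
  obtain ⟨q, hq, rfl⟩ := List.mem_map.1 hx
  exact if_pos (h.serviceTime_le_deadline hq)

/-- Missing a deadline costs more than the delay which the general algorithm ever pays for a
request. -/
theorem exists_deadlineAlgorithm_isCompetitive [Fintype X] (s : X) :
    ∃ A : DeadlineAlgorithm X, A.IsCompetitive s fun I =>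
      2000000 * (1 + Real.log (min (Fintype.card X) I.numRequests : ℕ)) := by
  obtain ⟨Γ, hΓ⟩ := exists_isExtentBound X
  have hB : 0 ≤ 36 * Γ := mul_nonneg (by norm_num) (dist_nonneg.trans (hΓ.dist_le s s))
  let A := generalAlgorithm (DeadlineRequest.toGeneral hB)
    (DeadlineRequest.toGeneral_release hB) s
  refine ⟨A, fun I => ?_⟩
  have hsol : DeadlineInput.IsSolution s I (A.run I) := fun q hq =>
    let ⟨t, ht, hle⟩ := exists_mem_visitTimes_generalAlgorithm hΓ _ _ s I q hq
    ⟨t, ht, q.le_deadline_of_lower_le hB hle⟩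
  refine ⟨hsol, fun σ hσ => ?_⟩
  rw [← hsol.cost_eq hB, ← hσ.cost_eq hB]
  refine cost_generalAlgorithm_le _ _ s I σ
    (fun q hq => let ⟨t, ht, _⟩ := hσ q hq; ⟨t, ht⟩) fun q hq t ht => ?_
  have htd := ht.trans_le (hσ.serviceTime_le_deadline hq)
  simp only [DeadlineRequest.toGeneral, if_pos htd, if_pos htd.le]

end Deadline

end OnlineService

theorem theoremB1 :
    ∃ C : ℝ, 0 < C ∧ ∀ (X : Type*) [Fintype X] [MetricSpace X] (s : X),
      (∃ A : OnlineService.DelayAlgorithm X,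
        OnlineService.DelayAlgorithm.IsCompetitive A s (fun I =>
          C * (1 + Real.log (min (Fintype.card X) I.numRequests : ℕ)))) ∧
      (∃ A : OnlineService.DeadlineAlgorithm X,
        OnlineService.DeadlineAlgorithm.IsCompetitive A s (fun I =>
          C * (1 + Real.log (min (Fintype.card X) I.numRequests : ℕ)))) :=
  ⟨2000000, by norm_num, fun _ _ _ s =>
    ⟨OnlineService.exists_delayAlgorithm_isCompetitive s,
      OnlineService.exists_deadlineAlgorithm_isCompetitive s⟩⟩
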